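/- Let $*$ denote complex conjugation and $\mathbb{C}_+$ the open upper half plane. Consider the (focusing) nonlocal NLS equation \[ iu_t(x,t)+u_{xx}(x,t)+2\left[|u(x,t)|^2+|u(-x,t)|^2\right]u(x,t)=0, \qquad (1) \] which is the reduction $v(x,t)=u(-x,t)$ of the Manakov system $iu_t+u_{xx}+2(|u|^2+|v|^2)u=0$, $iv_t+v_{xx}+2(|u|^2+|v|^2)v=0$. Its scattering problem, for a continuous integrable profile $q(x)$ (for instance $q=u(\cdot,t)$), is \[ Y_x=(-i\zeta J+Q)Y,\quad J=\begin{pmatrix}1&0&0\\0&1&0\\0&0&-1\end{pmatrix},\quad Q=\begin{pmatrix}0&0&q(x)\\0&0&q(-x)\\-q(x)^*&-q(-x)^*&0\end{pmatrix}, \] and $\zeta\in\mathbb{C}_+$ is a discrete eigenvalue if there is a nonzero solution $Y\in L^2(\mathbb{R};\mathbb{C}^3)$. For distinct $\zeta_1,\dots,\zeta_N\in\mathbb{C}_+$ and eigenvectors $\mathbf{w}_{k0}=(\alpha_k,\beta_k,1)^T$ with $(\alpha_k,\beta_k)\in\mathbb{C}^2\setminus\{(0,0)\}$, the Manakov $N$-soliton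 with these data is \[ \begin{pmatrix}u\\v\end{pmatrix}=2i\sum_{j,k=1}^N\begin{pmatrix}\alpha_j\\\beta_j\end{pmatrix}e^{\theta_j-\theta_k^*}(M^{-1})_{jk},\qquad M_{jk}=\frac{e^{-(\theta_j^*+\theta_k)}+(\alpha_j^*\alpha_k+\beta_j^*\beta_k)e^{\theta_j^*+\theta_k}}{\zeta_j^*-\zeta_k},\qquad \theta_k=-i\zeta_kx-2i\zeta_k^2t. \] We say that the data give a soliton of (1) if $v(x,t)=u(-x,t)$ for all real $x,t$. **Theorem 1.** (a) If $\zeta\in\mathbb{C}_+$ is a discrete eigenvalue of the scattering problem, then so is $-\zeta^*\in\mathbb{C}_+$. Thus eigenvalues in $\mathbb{C}_+$ are either purely imaginary or appear in pairs $(\zeta,-\zeta^*)$ with $-\zeta^*\ne\zeta$. (b) If the data give a soliton of (1), then $u$ is indeed a classical solution of (1). For $N=1$, $\zeta_1$ is then purely imaginary; for $N=2$, either $\zeta_1,\zeta_2$ are both purely imaginary or $\zeta_2=-\zeta_1^*$. (c) For $N=1$, $\zeta_1=i\eta$, $\eta>0$, the data give a soliton of (1) if and only if $\mathbf{w}_{10}=(2^{-1/2}e^{i\gamma},2^{-1/2}e^{i\gamma},1)^T$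 for some real $\gamma$ (which is arbitrary). (d) For $N=2$, $\zeta_1=i\eta_1$, $\zeta_2=i\eta_2$ with $\eta_1,\eta_2>0$, $\eta_1\neq\eta_2$, put $g=(\eta_1+\eta_2)/(\eta_2-\eta_1)$. The data give a soliton of (1) if and only if \begin{align*} &|\alpha_1|^2+|\beta_1|^2=|\alpha_2|^2+|\beta_2|^2,\\ &g^2\left[(|\alpha_1|^2+|\beta_1|^2)^2-1\right]=(1-g^2)\left(1-|\alpha_1^*\alpha_2+\beta_1^*\beta_2|^2\right),\\ &\beta_1=(1+g)(\alpha_1\alpha_2^*+\beta_1\beta_2^*)\alpha_2-g(|\alpha_2|^2+|\beta_2|^2)\alpha_1,\\ &\beta_2=g(|\alpha_1|^2+|\beta_1|^2)\alpha_2+(1-g)(\alpha_1^*\alpha_2+\beta_1^*\beta_2)\alpha_1. \end{align*} (These relations themselves force $(\alpha_k,\beta_k)\neq(0,0)$.) For a given $q\in\mathbb{C}$, they admit a solution with $\alpha_1^*\alpha_2+\beta_1^*\beta_2=q$ if and only if $|q|\le1$. For fixed $\eta_1,\eta_2$, the solutions have four free real parameters: the set of all solutions $(\alpha_1,\alpha_2,\beta_1,\beta_2)\in\mathbb{C}^4$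 is a smooth embedded submanifold of real dimension $4$. (e) For $N=2$, $\zeta_1\in\mathbb{C}_+$ not purely imaginary and $\zeta_2=-\zeta_1^*$, the data give a soliton of (1) if and only if $(\alpha_2,\beta_2)^T=S\,(\alpha_1,\beta_1)^T$, where \[ S=\left(\frac1{\zeta_1^*-\zeta_1}-\frac1{2\zeta_1^*}\right)\begin{pmatrix}-\frac{\alpha_1^*\beta_1}{2\zeta_1^*}&\frac{|\alpha_1|^2+|\beta_1|^2}{\zeta_1^*-\zeta_1}-\frac{|\beta_1|^2}{2\zeta_1^*}\\[2pt]\frac{|\alpha_1|^2+|\beta_1|^2}{\zeta_1^*-\zeta_1}-\frac{|\alpha_1|^2}{2\zeta_1^*}&-\frac{\alpha_1\beta_1^*}{2\zeta_1^*}\end{pmatrix}^{-1}; \] the inverted matrix is invertible for every $(\alpha_1,\beta_1)\ne(0,0)$, and $(\alpha_1,\beta_1)\in\mathbb{C}^2\setminus\{(0,0)\}$ is free: every choice gives $(\alpha_2,\beta_2)\neq(0,0)$ and a soliton of (1). -/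

import Mathlib

namespace NonlocalNLS

open Complex Matrix MeasureTheory
open scoped ComplexConjugate ContDiff

noncomputable section

/-! ### The equation -/

/-- `u` (written `u x t`) is a classical solution of the focusing nonlocal NLS equation
`i u_t + u_xx + 2 (|u(x,t)|² + |u(-x,t)|²) u = 0` on the whole `(x,t)`-plane. -/
def SolvesNonlocalNLS (u : ℝ → ℝ → ℂ) : Prop :=
  ∃ ut ux uxx : ℝ → ℝ → ℂ,
    (∀ x t, HasDerivAt (fun s => u x s) (ut x t) t) ∧
    (∀ x t, HasDerivAt (fun y => u y t) (ux x t) x) ∧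
    (∀ x t, HasDerivAt (fun y => ux y t) (uxx x t) x) ∧
    ∀ x t, I * ut x t + uxx x t
      + 2 * (((‖u x t‖ ^ 2 + ‖u (-x) t‖ ^ 2 : ℝ)) : ℂ) * u x t = 0

/-! ### The scattering problem -/

/-- The matrix `J = diag(1, 1, -1)`. -/
def J : Matrix (Fin 3) (Fin 3) ℂ := !![1, 0, 0; 0, 1, 0; 0, 0, -1]

/-- The potential matrix `Q` of the Manakov system (focusing case), with `v(x) = q(-x)` and
`u(x) = q(x)`. -/
def Q (q : ℝ → ℂ) (x : ℝ) : Matrix (Fin 3) (Fin 3) ℂ :=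
  !![0, 0, q x;
     0, 0, q (-x);
     -conj (q x), -conj (q (-x)), 0]

/-- `ζ` is a discrete eigenvalue of the scattering problem `Y_x = (-iζJ + Q) Y` with profile
`q`: the problem has a nonzero square-integrable solution on the line. -/
def IsDiscreteEigenvalue (q : ℝ → ℂ) (ζ : ℂ) : Prop :=
  ∃ Y : ℝ → Fin 3 → ℂ, Y ≠ 0 ∧ MemLp Y 2 volume ∧
    ∀ x, HasDerivAt Y (((-(I * ζ)) • J + Q q x) *ᵥ Y x) x

/-! ### Manakov `N`-solitons -/

/-- `θ = -iζx - 2iζ²t`. -/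
def theta (ζ : ℂ) (x t : ℝ) : ℂ := -I * ζ * x - 2 * I * ζ ^ 2 * t

/-- The `N × N` matrix `M` of the Manakov `N`-soliton. -/
def solitonMatrix {N : ℕ} (ζ α β : Fin N → ℂ) (x t : ℝ) : Matrix (Fin N) (Fin N) ℂ :=
  Matrix.of fun j k =>
    1 / (conj (ζ j) - ζ k) *
      (exp (-(conj (theta (ζ j) x t) + theta (ζ k) x t))
        + (conj (α j) * α k + conj (β j) * β k)
          * exp (conj (theta (ζ j) x t) + theta (ζ k) x t))

/-- First component `u(x,t)` of the Manakov `N`-soliton with zeros `ζ k` and eigenvectors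
`(α k, β k, 1)`. -/
def solitonU {N : ℕ} (ζ α β : Fin N → ℂ) (x t : ℝ) : ℂ :=
  2 * I * ∑ j, ∑ k, α j * exp (theta (ζ j) x t - conj (theta (ζ k) x t))
    * (solitonMatrix ζ α β x t)⁻¹ j k

/-- Second component `v(x,t)` of the Manakov `N`-soliton. -/
def solitonV {N : ℕ} (ζ α β : Fin N → ℂ) (x t : ℝ) : ℂ :=
  2 * I * ∑ j, ∑ k, β j * exp (theta (ζ j) x t - conj (theta (ζ k) x t))
    * (solitonMatrix ζ α β x t)⁻¹ j k

/-- The eigenvector `w_{k0} = (α_k, β_k, 1)ᵀ`. -/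
def eigenvector {N : ℕ} (α β : Fin N → ℂ) (k : Fin N) : Fin 3 → ℂ := ![α k, β k, 1]

/-- Discrete scattering data of an `N`-soliton: distinct (simple) zeros `ζ k` in the open upper
half plane, and eigenvectors `(α k, β k, 1)` with `(α k, β k) ≠ (0, 0)`. If `(α k, β k) = (0, 0)`,
then `ζ k` is not a discrete eigenvalue of the resulting potential, which is a soliton with
fewer eigenvalues (or zero). -/
def IsSolitonData {N : ℕ} (ζ α β : Fin N → ℂ) : Prop :=
  (∀ k, 0 < (ζ k).im) ∧ Function.Injective ζ ∧ ∀ k, (α k, β k) ≠ (0, 0)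

/-- The Manakov soliton obeys the reduction `v(x,t) = u(-x,t)`. -/
def SatisfiesReduction {N : ℕ} (ζ α β : Fin N → ℂ) : Prop :=
  ∀ x t : ℝ, solitonV ζ α β x t = solitonU ζ α β (-x) t

/-! ### Relations between the eigenvectors of two-solitons -/

/-- `g = (η₁ + η₂) / (η₂ - η₁)`. -/
def gPar (η₁ η₂ : ℝ) : ℝ := (η₁ + η₂) / (η₂ - η₁)

/-- The four algebraic relations between the eigenvectors `(α 0, β 0, 1)` and `(α 1, β 1, 1)` of
a two-soliton with two purely imaginary eigenvalues. -/
def ImaginaryRelations (g : ℝ) (α β : Fin 2 → ℂ) : Prop :=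
  ‖α 0‖ ^ 2 + ‖β 0‖ ^ 2 = ‖α 1‖ ^ 2 + ‖β 1‖ ^ 2 ∧
  g ^ 2 * ((‖α 0‖ ^ 2 + ‖β 0‖ ^ 2) ^ 2 - 1)
    = (1 - g ^ 2) * (1 - ‖conj (α 0) * α 1 + conj (β 0) * β 1‖ ^ 2) ∧
  β 0 = (1 + g) * (α 0 * conj (α 1) + β 0 * conj (β 1)) * α 1
    - g * ((‖α 1‖ ^ 2 + ‖β 1‖ ^ 2 : ℝ) : ℂ) * α 0 ∧
  β 1 = g * ((‖α 0‖ ^ 2 + ‖β 0‖ ^ 2 : ℝ) : ℂ) * α 1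
    + (1 - g) * (conj (α 0) * α 1 + conj (β 0) * β 1) * α 0

/-- The set of solutions `(α, β)` of the four relations. -/
def imaginarySolutions (g : ℝ) : Set ((Fin 2 → ℂ) × (Fin 2 → ℂ)) :=
  {p | ImaginaryRelations g p.1 p.2}

/-- `S` is described by `d` free real parameters: it is a smooth embedded submanifold of dimension
`d`, i.e. near each of its points it is parametrized, homeomorphically and by a smooth immersion,
by an open subset of `ℝ^d`. -/
def HasFreeRealParameters (d : ℕ) {E : Type*} [NormedAddCommGroup E] [NormedSpace ℝ E]
    (S : Set E) : Prop :=
  ∀ p ∈ S, ∃ (U : Set (EuclideanSpace ℝ (Fin d))) (W : Set E)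
    (φ : EuclideanSpace ℝ (Fin d) → E) (ψ : E → EuclideanSpace ℝ (Fin d)),
    IsOpen U ∧ IsOpen W ∧ p ∈ W ∧
    ContDiffOn ℝ ∞ φ U ∧ (∀ x ∈ U, Function.Injective (fderiv ℝ φ x)) ∧
    φ '' U = S ∩ W ∧ ContinuousOn ψ (S ∩ W) ∧ ∀ x ∈ U, ψ (φ x) = x

/-- The matrix whose inverse enters `S`. -/
def pairMatrix (ζ a b : ℂ) : Matrix (Fin 2) (Fin 2) ℂ :=
  !![-(conj a * b / (2 * conj ζ)),
      ((‖a‖ ^ 2 + ‖b‖ ^ 2 : ℝ) : ℂ) / (conj ζ - ζ) - ((‖b‖ ^ 2 : ℝ) : ℂ) / (2 * conj ζ);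
     ((‖a‖ ^ 2 + ‖b‖ ^ 2 : ℝ) : ℂ) / (conj ζ - ζ) - ((‖a‖ ^ 2 : ℝ) : ℂ) / (2 * conj ζ),
      -(a * conj b / (2 * conj ζ))]

/-- The matrix `S` (for `ζ₁ = ζ`, `α₁ = a`, `β₁ = b`). -/
def S (ζ a b : ℂ) : Matrix (Fin 2) (Fin 2) ℂ :=
  (1 / (conj ζ - ζ) - 1 / (2 * conj ζ)) • (pairMatrix ζ a b)⁻¹

end

end NonlocalNLS

/-! Eigenvalue symmetry. The reflection (Y₁, Y₂, Y₃)(x) ↦ (Y₂, Y₁, -Y₃)(-x) sends the spectral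
parameter ζ to -ζ, while pairing solutions at ζ and ζ* gives a constant. At ζ* there are two Jost
solutions decaying at +∞ and, by reflecting one at -ζ*, one decaying at -∞. A bound state at ζ is
orthogonal to all three, so they are linearly dependent. The reflected one therefore decays at both
ends, and undoing the reflection gives a bound state at -ζ* (`isDiscreteEigenvalue_neg_conj`). The
Jost solutions come from a contraction (`exists_bounded_solution`).

Solitons. Up to diagonal factors the soliton matrix is a Gram matrix H with entries ⟨w_j, w_k⟩ /
(ζ_j* - ζ_k). It is skew-Hermitian and satisfies Z*H - HZ = (⟨w_j, w_k⟩), of rank at most three,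
where Z = diag ζ. This one identity gives invertibility of H (`isUnit_det_gram`), the Manakov
equation (`solitonU_manakov`), and explicit eigenfunctions `rVec`, `pVec` together with regular
solutions of the scattering problem.

Reduction. If v(x,t) = u(-x,t), reflected eigenfunctions solve the same scattering problem.
Comparing them with the regular solutions shows that the ζ_k are symmetric under ζ ↦ -ζ*
(`exists_eigenvalue_eq_neg_conj`), and comparing leading coefficients at both ends gives G diag(κ)
π(α*) = β* and G diag(κ) π(β*) = α*. Here G is the Gram matrix of the vectors (α_k, β_k), π permutes
indices by ζ_{π k} = -ζ_k*, and κ solves the Cauchy system Kκ = 1. These equations also suffice,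
because they determine the inverse of G up to permutation and scaling (`sum_gram_reflected`). The
result is the criterion `satisfiesReduction_iff`, free of x and t.

Parts (c), (d), (e) are this criterion for N = 1, 2. Write w_k = (α_k, β_k), σ for the exchange of
components, q = ⟨w₁, w₂⟩. For imaginary eigenvalues the criterion expresses σw₁, σw₂ through w₁, w₂;
σ being a symmetric involution yields the four relations. Splitting into even and odd parts under σ
makes them diagonal: q and two phases are free, and the solution set is a copy of S³ × S¹, hence of
dimension four (`image_solutionOf`). For a pair (ζ, -ζ*) the criterion forces q to be real and
becomes a linear system for w₂. -/

namespace NonlocalNLS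

open Complex Matrix MeasureTheory Filter Topology
open scoped ComplexConjugate ContDiff

/-! ### Cauchy-like Gram matrices -/

section Gram

variable {N : ℕ}

/-- The matrix with entries `⟨w_j, w_k⟩ / (ζ_j* - ζ_k)`, where `w_k = (a_k, b_k, c_k)`. -/
noncomputable def gram (ζ a b c : Fin N → ℂ) : Matrix (Fin N) (Fin N) ℂ :=
  Matrix.of fun j k =>
    (conj (a j) * a k + conj (b j) * b k + conj (c j) * c k) / (conj (ζ j) - ζ k)

/-- The matrix with entries `⟨w_j, w_k⟩`, where `w_k = (a_k, b_k, c_k)`. -/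
def overlap (a b c : Fin N → ℂ) : Matrix (Fin N) (Fin N) ℂ :=
  Matrix.of fun j k => conj (a j) * a k + conj (b j) * b k + conj (c j) * c k

lemma gram_swap (ζ a b c : Fin N → ℂ) : gram ζ a b c = gram ζ b a c := by
  ext j k
  simp only [gram, Matrix.of_apply]
  ring

lemma conj_sub_ne_zero {ζ : Fin N → ℂ} (hζ : ∀ k, 0 < (ζ k).im) (j k : Fin N) :
    conj (ζ j) - ζ k ≠ 0 := by
  intro h
  have := congrArg Complex.im h
  simp at this
  linarith [hζ j, hζ k]

lemma gram_mul_sub {ζ : Fin N → ℂ} (hζ : ∀ k, 0 < (ζ k).im) (a b c : Fin N → ℂ) (j k : Fin N) :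
    conj (ζ j) * gram ζ a b c j k - gram ζ a b c j k * ζ k = overlap a b c j k := by
  have := conj_sub_ne_zero hζ j k
  simp only [gram, overlap, Matrix.of_apply]
  field_simp

/-- The factor ζ_j* - ζ_k cancels the denominator. The right-hand side has rank at most three, which
is what makes every later computation with the inverse close up. -/
lemma gram_lyapunov {ζ : Fin N → ℂ} (hζ : ∀ k, 0 < (ζ k).im) (a b c : Fin N → ℂ) :
    diagonal (fun j => conj (ζ j)) * gram ζ a b c - gram ζ a b c * diagonal ζ = overlap a b c := by
  ext j k
  rw [Matrix.sub_apply, diagonal_mul, mul_diagonal, gram_mul_sub hζ]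

lemma gram_conj (ζ a b c : Fin N → ℂ) (j k : Fin N) :
    conj (gram ζ a b c j k) = -gram ζ a b c k j := by
  simp only [gram, Matrix.of_apply, map_div₀, map_add, map_mul, map_sub, Complex.conj_conj]
  rw [← div_neg, neg_sub]
  ring

lemma gram_conjTranspose (ζ a b c : Fin N → ℂ) : (gram ζ a b c)ᴴ = -gram ζ a b c := by
  ext j k
  rw [conjTranspose_apply, Matrix.neg_apply, ← gram_conj]
  rfl

lemma gram_inv_conj (ζ a b c : Fin N → ℂ) (j k : Fin N) :
    conj ((gram ζ a b c)⁻¹ j k) = -(gram ζ a b c)⁻¹ k j := by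
  have h : ((gram ζ a b c)⁻¹)ᴴ = -(gram ζ a b c)⁻¹ := by
    rw [conjTranspose_nonsing_inv, gram_conjTranspose]
    by_cases hu : IsUnit (gram ζ a b c).det
    · refine Matrix.inv_eq_left_inv ?_
      rw [neg_mul_neg, Matrix.nonsing_inv_mul _ hu]
    -- For a singular matrix the inverse is zero by convention, so the symmetry needs no
    -- invertibility.
    · rw [Matrix.nonsing_inv_apply_not_isUnit _ hu, Matrix.nonsing_inv_apply_not_isUnit, neg_zero]
      rw [Matrix.det_neg]
      intro h
      exact hu (isUnit_of_mul_isUnit_right h)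
  have := congrFun (congrFun h k) j
  rwa [conjTranspose_apply, Matrix.neg_apply] at this

/-- The kernel of a Cauchy-like Gram matrix is invariant under `diag ζ`, hence trivial if the
`ζ k` are distinct and the vectors do not vanish. -/
theorem isUnit_det_gram {ζ : Fin N → ℂ} (hζ : ∀ k, 0 < (ζ k).im) (hinj : Function.Injective ζ)
    {a b c : Fin N → ℂ} (hne : ∀ k, a k ≠ 0 ∨ b k ≠ 0 ∨ c k ≠ 0) :
    IsUnit (gram ζ a b c).det := by
  set H := gram ζ a b c with hH
  -- As H is skew-Hermitian, Hx = 0 also gives x†H = 0. The Lyapunov identity between x† and x then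
  -- says that |a·x|² + |b·x|² + |c·x|² vanishes, so the overlap matrix kills x and H kills
  -- diag(ζ)x.
  have key : ∀ x : Fin N → ℂ, H *ᵥ x = 0 →
      a ⬝ᵥ x = 0 ∧ b ⬝ᵥ x = 0 ∧ c ⬝ᵥ x = 0 ∧ H *ᵥ (diagonal ζ *ᵥ x) = 0 := by
    intro x hx
    have hov : overlap a b c *ᵥ x = -(H *ᵥ (diagonal ζ *ᵥ x)) := by
      rw [← gram_lyapunov hζ, sub_mulVec, ← mulVec_mulVec, ← mulVec_mulVec, ← hH, hx]
      simp
    have hov' : overlap a b c *ᵥ x = fun j =>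
        conj (a j) * (a ⬝ᵥ x) + conj (b j) * (b ⬝ᵥ x) + conj (c j) * (c ⬝ᵥ x) := by
      ext j
      simp only [mulVec, dotProduct, overlap, Matrix.of_apply, Finset.mul_sum,
        ← Finset.sum_add_distrib]
      exact Finset.sum_congr rfl fun k _ => by ring
    have hx' : star x ᵥ* H = 0 := by
      have h1 : star (H *ᵥ x) = star x ᵥ* Hᴴ := star_mulVec H x
      rw [hx, hH, gram_conjTranspose, vecMul_neg, star_zero] at h1
      exact neg_eq_zero.mp h1.symm
    have h0 : star x ⬝ᵥ (overlap a b c *ᵥ x) = 0 := by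
      rw [hov, dotProduct_neg, dotProduct_mulVec, hx']
      simp
    have h1 : star x ⬝ᵥ (overlap a b c *ᵥ x) =
        ((normSq (a ⬝ᵥ x) + normSq (b ⬝ᵥ x) + normSq (c ⬝ᵥ x) : ℝ) : ℂ) := by
      have hs : ∀ y : Fin N → ℂ, ∑ j, conj (x j) * conj (y j) = conj (y ⬝ᵥ x) := by
        intro y
        simp only [dotProduct, map_sum, map_mul]
        exact Finset.sum_congr rfl fun k _ => by ring
      have : star x ⬝ᵥ (overlap a b c *ᵥ x) = conj (a ⬝ᵥ x) * (a ⬝ᵥ x)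
          + conj (b ⬝ᵥ x) * (b ⬝ᵥ x) + conj (c ⬝ᵥ x) * (c ⬝ᵥ x) := by
        rw [hov', ← hs a, ← hs b, ← hs c, Finset.sum_mul, Finset.sum_mul, Finset.sum_mul,
          ← Finset.sum_add_distrib, ← Finset.sum_add_distrib]
        refine Finset.sum_congr rfl fun k _ => ?_
        simp only [Pi.star_apply, RCLike.star_def]
        ring
      rw [this]
      push_cast
      simp only [normSq_eq_conj_mul_self]
    rw [h0] at h1
    have h2 : normSq (a ⬝ᵥ x) + normSq (b ⬝ᵥ x) + normSq (c ⬝ᵥ x) = 0 := by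
      exact_mod_cast h1.symm
    have ha := normSq_nonneg (a ⬝ᵥ x)
    have hb := normSq_nonneg (b ⬝ᵥ x)
    have hc := normSq_nonneg (c ⬝ᵥ x)
    have ea : a ⬝ᵥ x = 0 := normSq_eq_zero.mp (by linarith)
    have eb : b ⬝ᵥ x = 0 := normSq_eq_zero.mp (by linarith)
    have ec : c ⬝ᵥ x = 0 := normSq_eq_zero.mp (by linarith)
    refine ⟨ea, eb, ec, ?_⟩
    rw [hov', ea, eb, ec] at hov
    have : -(H *ᵥ (diagonal ζ *ᵥ x)) = 0 := by
      rw [← hov]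
      ext j
      simp
    exact neg_eq_zero.mp this
  rw [isUnit_iff_ne_zero]
  intro hdet
  obtain ⟨v, hv0, hv⟩ := Matrix.exists_mulVec_eq_zero_iff.mpr hdet
  -- the kernel contains an eigenvector of `diagonal ζ`
  let E : Submodule ℂ (Fin N → ℂ) := LinearMap.ker (Matrix.toLin' H)
  have hE : ∀ x, x ∈ E ↔ H *ᵥ x = 0 := fun x => by simp [E, LinearMap.mem_ker]
  have hinv : ∀ x ∈ E, Matrix.toLin' (diagonal ζ) x ∈ E := by
    intro x hx
    rw [hE] at hx ⊢
    rw [Matrix.toLin'_apply]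
    exact (key x hx).2.2.2
  have : Nontrivial E := ⟨⟨⟨v, (hE v).2 hv⟩, 0, fun h => hv0 (congrArg Subtype.val h)⟩⟩
  obtain ⟨μ, hμ⟩ := Module.End.exists_eigenvalue ((Matrix.toLin' (diagonal ζ)).restrict hinv)
  obtain ⟨y, hy⟩ := hμ.exists_hasEigenvector
  have hy0 : (y : Fin N → ℂ) ≠ 0 := fun h => hy.2 (Subtype.ext h)
  have hyE : H *ᵥ (y : Fin N → ℂ) = 0 := (hE _).1 y.2
  have hyμ : ∀ k, ζ k * (y : Fin N → ℂ) k = μ * (y : Fin N → ℂ) k := by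
    intro k
    have := congrArg Subtype.val hy.apply_eq_smul
    have := congrFun this k
    simpa [mulVec_diagonal, LinearMap.restrict_apply] using this
  obtain ⟨k, hk⟩ := Function.ne_iff.mp hy0
  have hk' : (y : Fin N → ℂ) k ≠ 0 := hk
  -- The ζ_k are distinct, so an eigenvector of diag ζ is supported on a single index k, where one
  -- of a_k, b_k, c_k is nonzero.
  have hother : ∀ l, l ≠ k → (y : Fin N → ℂ) l = 0 := by
    intro l hl
    by_contra hyl
    have h1 := mul_right_cancel₀ hyl (hyμ l)
    have h2 := mul_right_cancel₀ hk' (hyμ k)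
    exact hl (hinj (h1.trans h2.symm))
  have hdot : ∀ w : Fin N → ℂ, w ⬝ᵥ (y : Fin N → ℂ) = w k * (y : Fin N → ℂ) k := by
    intro w
    rw [dotProduct, Finset.sum_eq_single k]
    · intro l _ hl
      rw [hother l hl, mul_zero]
    · simp
  obtain ⟨ea, eb, ec, -⟩ := key _ hyE
  rw [hdot] at ea eb ec
  rcases hne k with h | h | h
  · exact (mul_ne_zero h hk') ea
  · exact (mul_ne_zero h hk') eb
  · exact (mul_ne_zero h hk') ec

end Gram

/-! ### Inverse matrices depending on a parameter -/

lemma tendsto_matrix_inv {X : Type*} {l : Filter X} {N : ℕ}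
    {H : X → Matrix (Fin N) (Fin N) ℂ} {K : Matrix (Fin N) (Fin N) ℂ} (hK : IsUnit K.det)
    (h : ∀ i j, Tendsto (fun x => H x i j) l (𝓝 (K i j))) (i j : Fin N) :
    Tendsto (fun x => (H x)⁻¹ i j) l (𝓝 (K⁻¹ i j)) := by
  have h1 : Tendsto H l (𝓝 K) :=
    tendsto_pi_nhds.2 fun i => tendsto_pi_nhds.2 fun j => h i j
  have h2 : ContinuousAt Inv.inv K := by
    refine continuousAt_matrix_inv K ?_
    have : (Ring.inverse : ℂ → ℂ) = Inv.inv := by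
      ext x
      simp
    rw [this]
    exact continuousAt_inv₀ hK.ne_zero
  have h3 : Tendsto (fun x => (H x)⁻¹) l (𝓝 K⁻¹) := h2.tendsto.comp h1
  exact tendsto_pi_nhds.1 (tendsto_pi_nhds.1 h3 i) j

section Deriv

attribute [local instance] Matrix.linftyOpNormedRing Matrix.linftyOpNormedAlgebra

lemma hasDerivAt_matrix_inv {N : ℕ} {H : ℝ → Matrix (Fin N) (Fin N) ℂ}
    {H' : Matrix (Fin N) (Fin N) ℂ} {x : ℝ}
    (h : ∀ i j, HasDerivAt (fun y => H y i j) (H' i j) x) (hu : IsUnit (H x).det) (i j : Fin N) :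
    HasDerivAt (fun y => (H y)⁻¹ i j) ((-((H x)⁻¹ * H' * (H x)⁻¹)) i j) x := by
  have h1 : HasDerivAt H H' x := hasDerivAt_pi.2 fun i => hasDerivAt_pi.2 fun j => h i j
  obtain ⟨U, hU⟩ := (Matrix.isUnit_iff_isUnit_det _).2 hu
  have h2 := hasFDerivAt_ringInverse (𝕜 := ℝ) U
  rw [hU] at h2
  have h3 := h2.comp_hasDerivAt x h1
  have hUi : (↑U⁻¹ : Matrix (Fin N) (Fin N) ℂ) = (H x)⁻¹ := by
    rw [← hU, Matrix.coe_units_inv]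
  have e1 : Ring.inverse ∘ H = fun y => (H y)⁻¹ := by
    funext y
    rw [Function.comp_apply, Matrix.nonsing_inv_eq_ringInverse]
  have e2 : (-((ContinuousLinearMap.mulLeftRight ℝ (Matrix (Fin N) (Fin N) ℂ)) ↑U⁻¹) ↑U⁻¹) H' =
      -((H x)⁻¹ * H' * (H x)⁻¹) := by
    simp [hUi]
  rw [e1, e2] at h3
  have h4 : HasDerivAt (fun y => (H y)⁻¹) (-((H x)⁻¹ * H' * (H x)⁻¹)) x := h3
  exact hasDerivAt_pi.1 (hasDerivAt_pi.1 h4 i) j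

end Deriv

/-! ### Manakov solitons -/

section Manakov

variable {N : ℕ}

/-- The exponentials `α_k exp (2 θ_k)`. -/
noncomputable def wave (ζ α : Fin N → ℂ) (x t : ℝ) (k : Fin N) : ℂ :=
  α k * exp (2 * theta (ζ k) x t)

/-- The soliton matrix up to diagonal factors. -/
noncomputable def waveGram (ζ α β : Fin N → ℂ) (x t : ℝ) : Matrix (Fin N) (Fin N) ℂ :=
  gram ζ (wave ζ α x t) (wave ζ β x t) 1

lemma solitonMatrix_eq (ζ α β : Fin N → ℂ) (x t : ℝ) :
    solitonMatrix ζ α β x t = diagonal (fun j => exp (-conj (theta (ζ j) x t))) *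
      waveGram ζ α β x t * diagonal (fun k => exp (-theta (ζ k) x t)) := by
  ext j k
  rw [mul_diagonal, diagonal_mul]
  simp only [solitonMatrix, waveGram, gram, wave, Matrix.of_apply, Pi.one_apply, map_one, map_mul,
    ← Complex.exp_conj, neg_add, Complex.exp_add, two_mul, Complex.exp_neg]
  have h1 := Complex.exp_ne_zero (theta (ζ k) x t)
  have h2 := Complex.exp_ne_zero (conj (theta (ζ j) x t))
  field_simp
  ring

lemma solitonMatrix_inv (ζ α β : Fin N → ℂ) (x t : ℝ) (j k : Fin N) :
    (solitonMatrix ζ α β x t)⁻¹ j k = exp (theta (ζ j) x t) * (waveGram ζ α β x t)⁻¹ j k *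
      exp (conj (theta (ζ k) x t)) := by
  have h : ∀ f : Fin N → ℂ, (diagonal fun j => exp (-f j))⁻¹ = diagonal fun j => exp (f j) := by
    intro f
    refine Matrix.inv_eq_left_inv ?_
    rw [diagonal_mul_diagonal, ← diagonal_one]
    congr 1
    ext j
    rw [← Complex.exp_add, add_neg_cancel, Complex.exp_zero]
  rw [solitonMatrix_eq, Matrix.mul_inv_rev, Matrix.mul_inv_rev, h, h, diagonal_mul, mul_diagonal]
  ring

lemma solitonU_eq (ζ α β : Fin N → ℂ) (x t : ℝ) :
    solitonU ζ α β x t = 2 * I * (wave ζ α x t ⬝ᵥ ((waveGram ζ α β x t)⁻¹ *ᵥ 1)) := by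
  simp only [solitonU, solitonMatrix_inv, dotProduct, mulVec, Pi.one_apply, mul_one, wave,
    Finset.mul_sum]
  refine Finset.sum_congr rfl fun j _ => Finset.sum_congr rfl fun k _ => ?_
  rw [Complex.exp_sub, two_mul (theta _ _ _), Complex.exp_add]
  have h2 := Complex.exp_ne_zero (conj (theta (ζ k) x t))
  field_simp

lemma solitonMatrix_swap (ζ α β : Fin N → ℂ) (x t : ℝ) :
    solitonMatrix ζ α β x t = solitonMatrix ζ β α x t := by
  ext j k
  simp only [solitonMatrix, Matrix.of_apply]
  ring

lemma solitonV_eq_swap (ζ α β : Fin N → ℂ) : solitonV ζ α β = solitonU ζ β α := by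
  ext x t
  simp only [solitonV, solitonU, solitonMatrix_swap ζ β α]

lemma IsSolitonData.swap {ζ α β : Fin N → ℂ} (h : IsSolitonData ζ α β) : IsSolitonData ζ β α :=
  ⟨h.1, h.2.1, fun k hk => h.2.2 k (by simp_all)⟩

lemma isUnit_det_waveGram {ζ α β : Fin N → ℂ} (h : IsSolitonData ζ α β) (x t : ℝ) :
    IsUnit (waveGram ζ α β x t).det :=
  isUnit_det_gram h.1 h.2.1 fun k => Or.inr (Or.inr (by simp))

/-! ### Evolution of the soliton matrix in x and t -/

lemma hasDerivAt_wave_x (ζ α : Fin N → ℂ) (x t : ℝ) (k : Fin N) :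
    HasDerivAt (fun y => wave ζ α y t k) (-2 * I * ζ k * wave ζ α x t k) x := by
  have h : HasDerivAt (fun y : ℝ => 2 * theta (ζ k) y t) (2 * (-I * ζ k)) x := by
    have h1 : HasDerivAt (fun y : ℝ => (y : ℂ)) 1 x := Complex.ofRealCLM.hasDerivAt
    simpa [theta] using ((h1.const_mul (-I * ζ k)).sub_const (2 * I * ζ k ^ 2 * t)).const_mul 2
  refine (h.cexp.const_mul (α k)).congr_deriv ?_
  simp only [wave]
  ring

lemma hasDerivAt_wave_t (ζ α : Fin N → ℂ) (x t : ℝ) (k : Fin N) :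
    HasDerivAt (fun s => wave ζ α x s k) (-4 * I * ζ k ^ 2 * wave ζ α x t k) t := by
  have h : HasDerivAt (fun s : ℝ => 2 * theta (ζ k) x s) (2 * (-(2 * I * ζ k ^ 2))) t := by
    have h1 : HasDerivAt (fun y : ℝ => (y : ℂ)) 1 t := Complex.ofRealCLM.hasDerivAt
    simpa [theta] using ((h1.const_mul (2 * I * ζ k ^ 2)).const_sub (-I * ζ k * x)).const_mul 2
  refine (h.cexp.const_mul (α k)).congr_deriv ?_
  simp only [wave]
  ring

/-- Derivative of the matrix `gram ζ A B 1` if `A' = A Λ` and `B' = B Λ` for a diagonal `Λ`. -/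
lemma hasDerivAt_gram {ζ μ : Fin N → ℂ} {A B : ℝ → Fin N → ℂ} {s : ℝ}
    (hA : ∀ k, HasDerivAt (fun y => A y k) (μ k * A s k) s)
    (hB : ∀ k, HasDerivAt (fun y => B y k) (μ k * B s k) s) (j k : Fin N) :
    HasDerivAt (fun y => gram ζ (A y) (B y) 1 j k)
      ((conj (μ j) + μ k) * overlap (A s) (B s) 0 j k / (conj (ζ j) - ζ k)) s := by
  have hc : ∀ (F : ℝ → ℂ) (F' : ℂ), HasDerivAt F F' s →
      HasDerivAt (fun y => conj (F y)) (conj F') s := fun F F' h => h.star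
  have h1 := ((hc _ _ (hA j)).mul (hA k)).add ((hc _ _ (hB j)).mul (hB k))
  refine ((h1.add_const (conj ((1 : Fin N → ℂ) j) * (1 : Fin N → ℂ) k)).div_const
    (conj (ζ j) - ζ k)).congr_deriv ?_
  simp only [overlap, Matrix.of_apply, map_mul, Pi.zero_apply, map_zero]
  ring

/-- The exponentials contribute the factor 2i(ζ_j* - ζ_k), which cancels the denominator: the
x-derivative has rank at most two. -/
lemma hasDerivAt_waveGram_x {ζ α β : Fin N → ℂ} (hd : IsSolitonData ζ α β) (x t : ℝ)
    (j k : Fin N) :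
    HasDerivAt (fun y => waveGram ζ α β y t j k)
      (((2 * I) • overlap (wave ζ α x t) (wave ζ β x t) 0) j k) x := by
  have := conj_sub_ne_zero hd.1 j k
  refine (hasDerivAt_gram (hasDerivAt_wave_x ζ α x t) (hasDerivAt_wave_x ζ β x t) j k).congr_deriv
    ?_
  simp only [map_mul, map_neg, conj_I, Matrix.smul_apply, smul_eq_mul, Complex.conj_ofNat]
  field_simp
  ring

/-- Now the factor is 4i(ζ_j*² - ζ_k²); one linear factor cancels the denominator and ζ_j* + ζ_k
remains. -/
lemma hasDerivAt_waveGram_t {ζ α β : Fin N → ℂ} (hd : IsSolitonData ζ α β) (x t : ℝ)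
    (j k : Fin N) :
    HasDerivAt (fun s => waveGram ζ α β x s j k)
      (((4 * I) • (diagonal (fun l => conj (ζ l)) * overlap (wave ζ α x t) (wave ζ β x t) 0
        + overlap (wave ζ α x t) (wave ζ β x t) 0 * diagonal ζ)) j k) t := by
  have := conj_sub_ne_zero hd.1 j k
  refine (hasDerivAt_gram (hasDerivAt_wave_t ζ α x t) (hasDerivAt_wave_t ζ β x t) j k).congr_deriv
    ?_
  simp only [map_mul, map_neg, map_pow, conj_I, Matrix.smul_apply, smul_eq_mul, Matrix.add_apply,
    diagonal_mul, mul_diagonal, Complex.conj_ofNat]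
  field_simp
  ring

lemma hasDerivAt_mul_entries {X Y : ℝ → Matrix (Fin N) (Fin N) ℂ}
    {X' Y' : Matrix (Fin N) (Fin N) ℂ} {s : ℝ}
    (hX : ∀ i j, HasDerivAt (fun y => X y i j) (X' i j) s)
    (hY : ∀ i j, HasDerivAt (fun y => Y y i j) (Y' i j) s) (i j : Fin N) :
    HasDerivAt (fun y => (X y * Y y) i j) ((X' * Y s + X s * Y') i j) s := by
  simp only [Matrix.mul_apply, Matrix.add_apply, ← Finset.sum_add_distrib]
  exact HasDerivAt.fun_sum fun k _ => (hX i k).mul (hY k j)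

/-- Derivative of `A X 1` if `A' = A Λ` for a diagonal `Λ`. -/
lemma hasDerivAt_dotProduct_mulVec {μ : Fin N → ℂ} {A : ℝ → Fin N → ℂ}
    {X : ℝ → Matrix (Fin N) (Fin N) ℂ} {X' : Matrix (Fin N) (Fin N) ℂ} {s : ℝ}
    (hA : ∀ k, HasDerivAt (fun y => A y k) (μ k * A s k) s)
    (hX : ∀ i j, HasDerivAt (fun y => X y i j) (X' i j) s) (w : Fin N → ℂ) :
    HasDerivAt (fun y => A y ⬝ᵥ (X y *ᵥ w)) (A s ⬝ᵥ ((X' + diagonal μ * X s) *ᵥ w)) s := by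
  simp only [dotProduct, mulVec]
  refine (HasDerivAt.fun_sum fun i _ => (hA i).mul (HasDerivAt.fun_sum fun j _ =>
    (hX i j).mul_const (w j))).congr_deriv ?_
  refine Finset.sum_congr rfl fun i _ => ?_
  simp only [Matrix.add_apply, diagonal_mul, add_mul, Finset.sum_add_distrib, mul_add]
  simp only [mul_assoc, ← Finset.mul_sum]
  ring

lemma overlap_mulVec (a b c y : Fin N → ℂ) : overlap a b c *ᵥ y =
    (a ⬝ᵥ y) • (star a) + (b ⬝ᵥ y) • (star b) + (c ⬝ᵥ y) • (star c) := by
  ext j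
  simp only [mulVec, dotProduct, overlap, Matrix.of_apply, Pi.add_apply, Pi.smul_apply,
    smul_eq_mul, Finset.sum_mul, ← Finset.sum_add_distrib, Pi.star_apply, RCLike.star_def]
  exact Finset.sum_congr rfl fun k _ => by ring

lemma overlap_one (a b : Fin N → ℂ) : overlap a b 1 = overlap 0 0 1 + overlap a b 0 := by
  ext j k
  simp only [overlap, Matrix.of_apply, Matrix.add_apply, Pi.zero_apply, map_zero]
  ring

lemma dotProduct_gram_inv_star (ζ a b c y z : Fin N → ℂ) :
    y ⬝ᵥ ((gram ζ a b c)⁻¹ *ᵥ star z) = -conj (z ⬝ᵥ ((gram ζ a b c)⁻¹ *ᵥ star y)) := by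
  simp only [dotProduct, mulVec, Finset.mul_sum, map_sum, map_mul, gram_inv_conj, Pi.star_apply,
    RCLike.star_def, Complex.conj_conj, ← Finset.sum_neg_distrib]
  rw [Finset.sum_comm]
  exact Finset.sum_congr rfl fun j _ => Finset.sum_congr rfl fun k _ => by ring

/-- The Lyapunov identity multiplied by the inverse on both sides. It moves diag ζ across the
inverse, at the cost of a constant part `overlap 0 0 1` and the part that appears in the
derivatives. -/
lemma diagonal_mul_waveGram_inv {ζ α β : Fin N → ℂ} (hd : IsSolitonData ζ α β) (x t : ℝ) :
    diagonal ζ * (waveGram ζ α β x t)⁻¹ =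
      (waveGram ζ α β x t)⁻¹ * diagonal (fun j => conj (ζ j)) - (waveGram ζ α β x t)⁻¹ *
        (overlap 0 0 1 + overlap (wave ζ α x t) (wave ζ β x t) 0) * (waveGram ζ α β x t)⁻¹ := by
  have hu := isUnit_det_waveGram hd x t
  rw [← overlap_one, ← gram_lyapunov hd.1]
  change _ = _ - (waveGram ζ α β x t)⁻¹ * (_ * waveGram ζ α β x t - waveGram ζ α β x t * _) * _
  rw [mul_sub, sub_mul, mul_assoc _ (_ * waveGram ζ α β x t), mul_assoc (diagonal _),
    Matrix.mul_nonsing_inv _ hu, ← mul_assoc _ (waveGram ζ α β x t),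
    Matrix.nonsing_inv_mul _ hu]
  simp

/-- The noncommutative identity behind the Manakov equation. -/
lemma manakov_ring_identity {R : Type*} [Ring R] {h Z Zs p r : R}
    (e : Z * h = h * Zs - h * (p + r) * h) :
    (-(h * r * h * Zs) + h * r * h * p * h + h * p * h * r * h - Z * (h * Zs - h * p * h))
      + (h * (Zs * r + r * Z) * h + Z * Z * h) = 2 * (h * p * h * r * h) := by
  have e' : ∀ y, Z * (h * y) = h * Zs * y - h * (p + r) * h * y := by
    intro y
    rw [← mul_assoc, e, sub_mul]
  simp only [mul_sub, e', mul_assoc, e, mul_add, add_mul]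
  noncomm_ring

/-- Here p = 1·1ᵀ and r = A*Aᵀ + B*Bᵀ, so the product splits into scalars. Skew-Hermiticity of the
inverse h turns 1·hA* into -(A·h1)*, and likewise for B: this is the origin of |u|² + |v|². -/
lemma wave_dotProduct_cubic (ζ α β : Fin N → ℂ) (x t : ℝ) :
    wave ζ α x t ⬝ᵥ (((waveGram ζ α β x t)⁻¹ * overlap 0 0 1 * (waveGram ζ α β x t)⁻¹ *
        overlap (wave ζ α x t) (wave ζ β x t) 0 * (waveGram ζ α β x t)⁻¹) *ᵥ 1) =
      -((normSq (wave ζ α x t ⬝ᵥ ((waveGram ζ α β x t)⁻¹ *ᵥ 1)) +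
        normSq (wave ζ β x t ⬝ᵥ ((waveGram ζ α β x t)⁻¹ *ᵥ 1)) : ℝ) : ℂ) *
        (wave ζ α x t ⬝ᵥ ((waveGram ζ α β x t)⁻¹ *ᵥ 1)) := by
  have h1 : ∀ z, (1 : Fin N → ℂ) ⬝ᵥ ((waveGram ζ α β x t)⁻¹ *ᵥ star z) =
      -conj (z ⬝ᵥ ((waveGram ζ α β x t)⁻¹ *ᵥ 1)) := by
    intro z
    have := dotProduct_gram_inv_star ζ (wave ζ α x t) (wave ζ β x t) 1 1 z
    rwa [star_one] at this
  have h2 : star (1 : Fin N → ℂ) = 1 := star_one _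
  simp only [← mulVec_mulVec, overlap_mulVec, zero_dotProduct, zero_smul, zero_add, add_zero,
    mulVec_smul, mulVec_add, dotProduct_add, dotProduct_smul, h1, h2, smul_eq_mul]
  push_cast
  simp only [normSq_eq_conj_mul_self]
  ring

/-- Every Manakov soliton solves the Manakov system. -/
theorem solitonU_manakov {ζ α β : Fin N → ℂ} (hd : IsSolitonData ζ α β) :
    ∃ ut ux uxx : ℝ → ℝ → ℂ,
      (∀ x t, HasDerivAt (fun s => solitonU ζ α β x s) (ut x t) t) ∧
      (∀ x t, HasDerivAt (fun y => solitonU ζ α β y t) (ux x t) x) ∧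
      (∀ x t, HasDerivAt (fun y => ux y t) (uxx x t) x) ∧
      ∀ x t, I * ut x t + uxx x t + 2 * (((‖solitonU ζ α β x t‖ ^ 2
        + ‖solitonV ζ α β x t‖ ^ 2 : ℝ)) : ℂ) * solitonU ζ α β x t = 0 := by
  set A := fun x t => wave ζ α x t with hA
  set r := fun x t => overlap (wave ζ α x t) (wave ζ β x t) 0 with hr
  set p : Matrix (Fin N) (Fin N) ℂ := overlap 0 0 1 with hp
  set h := fun x t => (waveGram ζ α β x t)⁻¹ with hh
  set Z := diagonal ζ with hZ
  set Zs := diagonal (fun j => conj (ζ j)) with hZs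
  have e : ∀ x t, Z * h x t = h x t * Zs - h x t * (p + r x t) * h x t :=
    fun x t => diagonal_mul_waveGram_inv hd x t
  have hx : ∀ x t i j, HasDerivAt (fun y => h y t i j)
      ((-(h x t * ((2 * I) • r x t) * h x t)) i j) x := fun x t =>
    hasDerivAt_matrix_inv (hasDerivAt_waveGram_x hd x t) (isUnit_det_waveGram hd x t)
  have ht : ∀ x t i j, HasDerivAt (fun s => h x s i j)
      ((-(h x t * ((4 * I) • (Zs * r x t + r x t * Z)) * h x t)) i j) t := fun x t =>
    hasDerivAt_matrix_inv (hasDerivAt_waveGram_t hd x t) (isUnit_det_waveGram hd x t)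
  have dx : (diagonal fun k => -2 * I * ζ k) = (-2 * I) • Z := by
    rw [hZ, ← diagonal_smul]
    rfl
  have dt : (diagonal fun k => -4 * I * ζ k ^ 2) = (-4 * I) • (Z * Z) := by
    rw [hZ, diagonal_mul_diagonal, ← diagonal_smul]
    congr 1
    ext k
    simp [sq]
  -- This is u_x up to the factor 4 and the pairing with A and 1: the terms containing r cancel by
  -- the Lyapunov identity.
  let X := fun x t => h x t * Zs - h x t * p * h x t
  let X' := fun x t => -(h x t * ((2 * I) • r x t) * h x t) * Zs
    - (-(h x t * ((2 * I) • r x t) * h x t) * p * h x t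
      + h x t * p * -(h x t * ((2 * I) • r x t) * h x t))
  have hX : ∀ x t i j, HasDerivAt (fun y => X y t i j) (X' x t i j) x := by
    intro x t i j
    have h1 : ∀ i j, HasDerivAt (fun _ : ℝ => Zs i j) ((0 : Matrix (Fin N) (Fin N) ℂ) i j) x :=
      fun i j => hasDerivAt_const x _
    have h2 : ∀ i j, HasDerivAt (fun _ : ℝ => p i j) ((0 : Matrix (Fin N) (Fin N) ℂ) i j) x :=
      fun i j => hasDerivAt_const x _
    have h3 := hasDerivAt_mul_entries (hx x t) h1 i j
    have h4 := hasDerivAt_mul_entries (hasDerivAt_mul_entries (hx x t) h2) (hx x t) i j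
    refine (h3.sub h4).congr_deriv ?_
    simp only [mul_zero, add_zero, X', Matrix.sub_apply]
  refine ⟨fun x t => 2 * I * (A x t ⬝ᵥ ((-(h x t * ((4 * I) • (Zs * r x t + r x t * Z)) * h x t)
      + (-4 * I) • (Z * Z) * h x t) *ᵥ 1)),
    fun x t => 4 * (A x t ⬝ᵥ (X x t *ᵥ 1)),
    fun x t => 4 * (A x t ⬝ᵥ ((X' x t + (-2 * I) • Z * X x t) *ᵥ 1)), ?_, ?_, ?_, ?_⟩
  · intro x t
    simp only [solitonU_eq]
    refine ((hasDerivAt_dotProduct_mulVec (hasDerivAt_wave_t ζ α x t) (ht x t) 1).const_mul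
      (2 * I)).congr_deriv ?_
    rw [dt]
  · intro x t
    simp only [solitonU_eq]
    refine ((hasDerivAt_dotProduct_mulVec (hasDerivAt_wave_x ζ α x t) (hx x t) 1).const_mul
      (2 * I)).congr_deriv ?_
    rw [dx]
    change 2 * I * (A x t ⬝ᵥ ((_ + (-2 * I) • Z * h x t) *ᵥ 1)) = 4 * (A x t ⬝ᵥ (X x t *ᵥ 1))
    have : -(h x t * ((2 * I) • r x t) * h x t) + (-2 * I) • Z * h x t = (-2 * I) • X x t := by
      simp only [smul_mul_assoc, mul_smul_comm, X, e x t, mul_add, add_mul]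
      module
    rw [this, smul_mulVec, dotProduct_smul, smul_eq_mul]
    linear_combination (-4 * (A x t ⬝ᵥ (X x t *ᵥ 1))) * I_mul_I
  · intro x t
    refine ((hasDerivAt_dotProduct_mulVec (hasDerivAt_wave_x ζ α x t) (hX x t) 1).const_mul
      4).congr_deriv ?_
    rw [dx]
  · intro x t
    have h1 : X' x t + (-2 * I) • Z * X x t = (2 * I) • (-(h x t * r x t * h x t * Zs)
        + h x t * r x t * h x t * p * h x t + h x t * p * h x t * r x t * h x t
        - Z * (h x t * Zs - h x t * p * h x t)) := by
      simp only [X', X, smul_mul_assoc, mul_smul_comm, neg_mul, mul_neg, mul_assoc]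
      module
    have h2 : -(h x t * ((4 * I) • (Zs * r x t + r x t * Z)) * h x t)
        + (-4 * I) • (Z * Z) * h x t = (-4 * I) • (h x t * (Zs * r x t + r x t * Z) * h x t
          + Z * Z * h x t) := by
      simp only [smul_mul_assoc, mul_smul_comm]
      module
    -- Both u_xx and i u_t carry the common factor 8i, so the ring identity turns their sum into the
    -- cubic term.
    have h3 := congrArg (fun Y => A x t ⬝ᵥ (Y *ᵥ (1 : Fin N → ℂ)))
      (manakov_ring_identity (e x t))
    have h4 : A x t ⬝ᵥ ((2 * (h x t * p * h x t * r x t * h x t)) *ᵥ 1) =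
        2 * (A x t ⬝ᵥ ((h x t * p * h x t * r x t * h x t) *ᵥ 1)) := by
      rw [two_mul, add_mulVec, dotProduct_add, two_mul]
    have h5 := wave_dotProduct_cubic ζ α β x t
    simp only [add_mulVec (_ - _), dotProduct_add, h4] at h3
    rw [solitonV_eq_swap]
    simp only [h1, h2, smul_mulVec, dotProduct_smul, smul_eq_mul, Complex.sq_norm]
    have hs : waveGram ζ β α x t = waveGram ζ α β x t := gram_swap _ _ _ _
    simp only [solitonU_eq, hs, map_mul, normSq_I, Complex.normSq_ofNat] at *
    set W := A x t ⬝ᵥ ((h x t * p * h x t * r x t * h x t) *ᵥ 1) with hW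
    change W = _ at h5
    push_cast at h5 ⊢
    linear_combination (8 * I) * h3 + 16 * I * h5 - 8 * I * (A x t ⬝ᵥ
      ((h x t * (Zs * r x t + r x t * Z) * h x t + Z * Z * h x t) *ᵥ 1)) * I_mul_I

/-- Solitons with `v(x,t) = u(-x,t)` solve the nonlocal NLS equation. -/
theorem solvesNonlocalNLS_of_reduction {ζ α β : Fin N → ℂ} (hd : IsSolitonData ζ α β)
    (h : SatisfiesReduction ζ α β) : SolvesNonlocalNLS (solitonU ζ α β) := by
  obtain ⟨ut, ux, uxx, h1, h2, h3, h4⟩ := solitonU_manakov hd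
  refine ⟨ut, ux, uxx, h1, h2, h3, fun x t => ?_⟩
  rw [← h x t]
  exact h4 x t

end Manakov

/-! ### The conjugate scattering problem -/

/-- Solutions of the scattering problem with potential `(u, v)`, complex conjugated. -/
structure IsJost (u v : ℝ → ℂ) (l : ℂ) (r₁ r₂ p : ℝ → ℂ) : Prop where
  fst : ∀ x, HasDerivAt r₁ (2 * I * l * r₁ x + conj (u x) * p x) x
  snd : ∀ x, HasDerivAt r₂ (2 * I * l * r₂ x + conj (v x) * p x) x
  trd : ∀ x, HasDerivAt p (-(u x * r₁ x) - v x * r₂ x) x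

namespace IsJost

variable {u v r₁ r₂ p s₁ s₂ q : ℝ → ℂ} {l : ℂ}

lemma add_const_mul (h : IsJost u v l r₁ r₂ p) (h' : IsJost u v l s₁ s₂ q) (c : ℂ) :
    IsJost u v l (fun x => r₁ x + c * s₁ x) (fun x => r₂ x + c * s₂ x)
      (fun x => p x + c * q x) where
  fst x := ((h.fst x).add ((h'.fst x).const_mul c)).congr_deriv (by ring)
  snd x := ((h.snd x).add ((h'.snd x).const_mul c)).congr_deriv (by ring)
  trd x := ((h.trd x).add ((h'.trd x).const_mul c)).congr_deriv (by ring)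

/-- Reflection `x ↦ -x` for a potential with `v(x) = u(-x)`. -/
lemma reflect (h : IsJost u v l r₁ r₂ p) (huv : ∀ x, v x = u (-x)) :
    IsJost u v (-l) (fun x => r₂ (-x)) (fun x => r₁ (-x)) (fun x => -p (-x)) where
  fst x := by
    refine ((h.snd (-x)).scomp x (hasDerivAt_neg x)).congr_deriv ?_
    rw [huv, neg_neg]
    simp
  snd x := by
    refine ((h.fst (-x)).scomp x (hasDerivAt_neg x)).congr_deriv ?_
    rw [huv]
    simp
  trd x := by
    refine ((h.trd (-x)).scomp x (hasDerivAt_neg x)).neg.congr_deriv ?_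
    rw [huv x, huv (-x), neg_neg]
    simp
    ring

/-- The potential enters through a skew-Hermitian matrix, and the spectral terms cancel because the
two parameters are conjugate. -/
lemma pairing_const (h : IsJost u v l r₁ r₂ p) (h' : IsJost u v (conj l) s₁ s₂ q) (x y : ℝ) :
    conj (s₁ x) * r₁ x + conj (s₂ x) * r₂ x + conj (q x) * p x =
      conj (s₁ y) * r₁ y + conj (s₂ y) * r₂ y + conj (q y) * p y := by
  have key : ∀ x, HasDerivAt (fun x => conj (s₁ x) * r₁ x + conj (s₂ x) * r₂ x + conj (q x) * p x)
      0 x := by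
    intro x
    refine ((((h'.fst x).star.mul (h.fst x)).add ((h'.snd x).star.mul (h.snd x))).add
      ((h'.trd x).star.mul (h.trd x))).congr_deriv ?_
    simp only [RCLike.star_def, map_add, map_sub, map_neg, map_mul, conj_I, Complex.conj_conj,
      Complex.conj_ofNat]
    ring
  exact is_const_of_deriv_eq_zero (fun x => (key x).differentiableAt) (fun x => (key x).deriv) x y

/-- For `Im l < 0`, a solution that decays at `+∞` vanishes. -/
lemma eq_zero_of_tendsto (h : IsJost u v l r₁ r₂ p) (hl : l.im ≤ 0) (h₁ : Tendsto r₁ atTop (𝓝 0))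
    (h₂ : Tendsto r₂ atTop (𝓝 0)) (h₃ : Tendsto p atTop (𝓝 0)) (x : ℝ) :
    r₁ x = 0 ∧ r₂ x = 0 ∧ p x = 0 := by
  have hn : ∀ {f : ℝ → ℂ} {f' : ℂ} {x : ℝ}, HasDerivAt f f' x →
      HasDerivAt (fun y => normSq (f y)) (2 * (conj (f x) * f').re) x := by
    intro f f' x hf
    have h1 : HasDerivAt (fun y => (conj (f y) * f y).re) (conj f' * f x + conj (f x) * f').re x :=
      Complex.reCLM.hasFDerivAt.comp_hasDerivAt x (hf.star.mul hf)
    have h2 : (fun y => (conj (f y) * f y).re) = fun y => normSq (f y) := by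
      ext y
      rw [← normSq_eq_conj_mul_self, ofReal_re]
    rw [h2] at h1
    refine h1.congr_deriv ?_
    simp only [add_re, mul_re, conj_re, conj_im]
    ring
  -- The skew-Hermitian potential drops out of E'. What is left is nonnegative, so E is
  -- nondecreasing with limit 0 at +∞ and hence E ≤ 0.
  let E := fun y => normSq (r₁ y) + normSq (r₂ y) + normSq (p y)
  have hE : ∀ y, HasDerivAt E (-4 * l.im * (normSq (r₁ y) + normSq (r₂ y))) y := by
    intro y
    refine (((hn (h.fst y)).add (hn (h.snd y))).add (hn (h.trd y))).congr_deriv ?_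
    simp only [normSq_apply, mul_re, mul_im, add_re, add_im, sub_re, sub_im, neg_re, neg_im, conj_re,
      conj_im, I_re, I_im, re_ofNat, im_ofNat]
    ring
  have hmono : Monotone E := by
    refine monotone_of_deriv_nonneg (fun y => (hE y).differentiableAt) fun y => ?_
    rw [(hE y).deriv]
    have := normSq_nonneg (r₁ y)
    have := normSq_nonneg (r₂ y)
    nlinarith
  have hlim : Tendsto E atTop (𝓝 0) := by
    have hc : ∀ {f : ℝ → ℂ}, Tendsto f atTop (𝓝 0) → Tendsto (fun y => normSq (f y)) atTop (𝓝 0) := by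
      intro f hf
      simpa [Function.comp_def] using (continuous_normSq.tendsto 0).comp hf
    simpa using ((hc h₁).add (hc h₂)).add (hc h₃)
  have hle : E x ≤ 0 := hmono.ge_of_tendsto hlim x
  have ha := normSq_nonneg (r₁ x)
  have hb := normSq_nonneg (r₂ x)
  have hc := normSq_nonneg (p x)
  simp only [E] at hle
  exact ⟨normSq_eq_zero.mp (by linarith), normSq_eq_zero.mp (by linarith),
    normSq_eq_zero.mp (by linarith)⟩

end IsJost

/-! ### Eigenfunctions of solitons -/

section Eigenfunctions

variable {N : ℕ}

/-- The third components of the eigenfunctions. -/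
noncomputable def pVec (ζ α β : Fin N → ℂ) (x t : ℝ) : Fin N → ℂ := (waveGram ζ α β x t)⁻¹ *ᵥ 1

/-- The first components of the eigenfunctions; exchanging `α` and `β` gives the second ones. -/
noncomputable def rVec (ζ α β : Fin N → ℂ) (x t : ℝ) : Fin N → ℂ :=
  (waveGram ζ α β x t)⁻¹ *ᵥ star (wave ζ α x t)

lemma waveGram_swap (ζ α β : Fin N → ℂ) : waveGram ζ α β = waveGram ζ β α := by
  ext1 x
  ext1 t
  exact gram_swap _ _ _ _

lemma pVec_swap (ζ α β : Fin N → ℂ) : pVec ζ α β = pVec ζ β α := by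
  ext1 x
  ext1 t
  rw [pVec, waveGram_swap, pVec]

/-- Skew-Hermiticity of the inverse rewrites A·h1 through 1·hA*. This sum rule is what lets the
eigenfunctions satisfy closed equations. -/
lemma conj_solitonU (ζ α β : Fin N → ℂ) (x t : ℝ) :
    conj (solitonU ζ α β x t) = 2 * I * ∑ k, rVec ζ α β x t k := by
  have h := dotProduct_gram_inv_star ζ (wave ζ α x t) (wave ζ β x t) 1 1 (wave ζ α x t)
  rw [star_one, one_dotProduct] at h
  rw [solitonU_eq, rVec, waveGram, h, map_mul, map_mul, conj_I, Complex.conj_ofNat]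
  ring

lemma hasDerivAt_pVec {ζ α β : Fin N → ℂ} (hd : IsSolitonData ζ α β) (x t : ℝ) (k : Fin N) :
    HasDerivAt (fun y => pVec ζ α β y t k) (-(solitonU ζ α β x t * rVec ζ α β x t k)
      - solitonV ζ α β x t * rVec ζ β α x t k) x := by
  have h := hasDerivAt_matrix_inv (hasDerivAt_waveGram_x hd x t) (isUnit_det_waveGram hd x t)
  simp only [pVec, mulVec, dotProduct, Pi.one_apply, mul_one]
  refine (HasDerivAt.fun_sum fun j _ => h k j).congr_deriv ?_
  have h1 : ∀ M : Matrix (Fin N) (Fin N) ℂ, ∑ j, M k j = (M *ᵥ 1) k := by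
    intro M
    simp [mulVec, dotProduct]
  rw [h1, neg_mulVec, mul_smul_comm, smul_mul_assoc, smul_mulVec, ← mulVec_mulVec, ← mulVec_mulVec,
    overlap_mulVec, solitonV_eq_swap, solitonU_eq, solitonU_eq, rVec, rVec, waveGram_swap ζ β α]
  simp only [zero_dotProduct, zero_smul, add_zero, mulVec_add, mulVec_smul, Pi.neg_apply,
    Pi.smul_apply, Pi.add_apply, smul_eq_mul]
  ring

/-- Differentiation gives 2i(hZ* - hrh)A*, which by the Lyapunov identity equals 2i(Zh + hph)A*. The
first term is the spectral one; in the second, p = 1·1ᵀ and 2i(1·hA*) = u* produce the coupling to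
`pVec`. -/
lemma hasDerivAt_rVec {ζ α β : Fin N → ℂ} (hd : IsSolitonData ζ α β) (x t : ℝ) (k : Fin N) :
    HasDerivAt (fun y => rVec ζ α β y t k) (2 * I * ζ k * rVec ζ α β x t k
      + conj (solitonU ζ α β x t) * pVec ζ α β x t k) x := by
  have h := hasDerivAt_matrix_inv (hasDerivAt_waveGram_x hd x t) (isUnit_det_waveGram hd x t)
  have e := diagonal_mul_waveGram_inv hd x t
  have hA := fun j => (hasDerivAt_wave_x ζ α x t j).star
  have h0 : HasDerivAt (fun y => rVec ζ α β y t k)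
      (((-((waveGram ζ α β x t)⁻¹ * ((2 * I) • overlap (wave ζ α x t) (wave ζ β x t) 0) *
        (waveGram ζ α β x t)⁻¹) + (2 * I) • ((waveGram ζ α β x t)⁻¹ *
          diagonal (fun j => conj (ζ j)))) *ᵥ star (wave ζ α x t)) k) x := by
    simp only [rVec, mulVec, dotProduct, Pi.star_apply]
    refine (HasDerivAt.fun_sum fun j _ => (h k j).mul (hA j)).congr_deriv ?_
    refine Finset.sum_congr rfl fun j _ => ?_
    simp only [Matrix.add_apply, Matrix.smul_apply, mul_diagonal, smul_eq_mul, RCLike.star_def,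
      map_mul, map_neg, conj_I, Complex.conj_ofNat]
    ring
  refine h0.congr_deriv ?_
  have e1 : -((waveGram ζ α β x t)⁻¹ * ((2 * I) • overlap (wave ζ α x t) (wave ζ β x t) 0) *
        (waveGram ζ α β x t)⁻¹) + (2 * I) • ((waveGram ζ α β x t)⁻¹ *
          diagonal (fun j => conj (ζ j))) = (2 * I) • (diagonal ζ * (waveGram ζ α β x t)⁻¹ +
          (waveGram ζ α β x t)⁻¹ * overlap 0 0 1 * (waveGram ζ α β x t)⁻¹) := by
    rw [e]
    simp only [smul_mul_assoc, mul_smul_comm, mul_add, add_mul]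
    module
  rw [e1, smul_mulVec, add_mulVec, ← mulVec_mulVec, ← mulVec_mulVec, ← mulVec_mulVec,
    overlap_mulVec, conj_solitonU, ← rVec, pVec]
  simp only [mulVec_smul, zero_dotProduct, zero_smul, zero_add, one_dotProduct, star_one,
    Pi.smul_apply, Pi.add_apply, smul_eq_mul, mulVec_diagonal]
  ring

lemma isJost_vec {ζ α β : Fin N → ℂ} (hd : IsSolitonData ζ α β) (t : ℝ) (k : Fin N) :
    IsJost (fun x => solitonU ζ α β x t) (fun x => solitonV ζ α β x t) (ζ k)
      (fun x => rVec ζ α β x t k) (fun x => rVec ζ β α x t k) (fun x => pVec ζ α β x t k) where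
  fst x := hasDerivAt_rVec hd x t k
  snd x := by
    rw [solitonV_eq_swap, pVec_swap]
    exact hasDerivAt_rVec hd.swap x t k
  trd x := hasDerivAt_pVec hd x t k

/-- The solution of the scattering problem at a regular point `l`. -/
lemma isJost_resolvent {ζ α β : Fin N → ℂ} (hd : IsSolitonData ζ α β) (t : ℝ) {l : ℂ}
    (hl : ∀ k, ζ k - l ≠ 0) :
    IsJost (fun x => solitonU ζ α β x t) (fun x => solitonV ζ α β x t) l
      (fun x => ∑ k, rVec ζ α β x t k / (ζ k - l)) (fun x => ∑ k, rVec ζ β α x t k / (ζ k - l))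
      (fun x => 1 + ∑ k, pVec ζ α β x t k / (ζ k - l)) := by
  have key : ∀ {ζ α β : Fin N → ℂ}, IsSolitonData ζ α β → (∀ k, ζ k - l ≠ 0) → ∀ x,
      HasDerivAt (fun x => ∑ k, rVec ζ α β x t k / (ζ k - l))
      (2 * I * l * ∑ k, rVec ζ α β x t k / (ζ k - l)
        + conj (solitonU ζ α β x t) * (1 + ∑ k, pVec ζ α β x t k / (ζ k - l))) x := by
    intro ζ α β hd hl x
    refine (HasDerivAt.fun_sum fun k _ => (hasDerivAt_rVec hd x t k).div_const _).congr_deriv ?_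
    -- Writing ζ_k = l + (ζ_k - l) leaves the excess 2i Σ r_k = u*, which is exactly the forcing by
    -- the constant 1 in the third component.
    rw [mul_add, mul_one]
    nth_rewrite 2 [conj_solitonU]
    rw [Finset.mul_sum, Finset.mul_sum, Finset.mul_sum, ← Finset.sum_add_distrib,
      ← Finset.sum_add_distrib]
    refine Finset.sum_congr rfl fun k _ => ?_
    have := hl k
    field_simp
    ring
  refine ⟨key hd hl, fun x => ?_, fun x => ?_⟩
  · rw [solitonV_eq_swap, pVec_swap]
    exact key hd.swap hl x
  · refine ((HasDerivAt.fun_sum fun k _ => (hasDerivAt_pVec hd x t k).div_const _).const_add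
      1).congr_deriv ?_
    rw [Finset.mul_sum, Finset.mul_sum, ← Finset.sum_neg_distrib, ← Finset.sum_sub_distrib]
    exact Finset.sum_congr rfl fun k _ => by ring

/-! ### Limits -/

lemma tendsto_exp_theta_atBot {z : ℂ} (hz : 0 < z.im) (t : ℝ) :
    Tendsto (fun x => exp (2 * theta z x t)) atBot (𝓝 0) := by
  refine (Complex.tendsto_exp_nhds_zero_iff).2 ?_
  have : (fun x : ℝ => (2 * theta z x t).re) = fun x => 2 * z.im * x + (-(4 * I * z ^ 2 * t)).re := by
    ext x
    simp [theta]
    ring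
  rw [this]
  exact tendsto_atBot_add_const_right _ _ (tendsto_id.const_mul_atBot (by positivity))

lemma tendsto_exp_neg_theta_atTop {z : ℂ} (hz : 0 < z.im) (t : ℝ) :
    Tendsto (fun x => exp (-(2 * theta z x t))) atTop (𝓝 0) := by
  refine (Complex.tendsto_exp_nhds_zero_iff).2 ?_
  have : (fun x : ℝ => (-(2 * theta z x t)).re) =
      fun x => -(2 * z.im * x) + (4 * I * z ^ 2 * t).re := by
    ext x
    simp [theta]
    ring
  rw [this]
  exact tendsto_atBot_add_const_right _ _
    (tendsto_neg_atTop_atBot.comp (tendsto_id.const_mul_atTop (by positivity)))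

lemma tendsto_gram {X : Type*} {l : Filter X} {ζ a b c : Fin N → ℂ} {A B C : X → Fin N → ℂ}
    (ha : ∀ k, Tendsto (fun x => A x k) l (𝓝 (a k)))
    (hb : ∀ k, Tendsto (fun x => B x k) l (𝓝 (b k)))
    (hc : ∀ k, Tendsto (fun x => C x k) l (𝓝 (c k))) (j k : Fin N) :
    Tendsto (fun x => gram ζ (A x) (B x) (C x) j k) l (𝓝 (gram ζ a b c j k)) := by
  have hs : ∀ {f : X → ℂ} {z : ℂ}, Tendsto f l (𝓝 z) →
      Tendsto (fun x => conj (f x)) l (𝓝 (conj z)) := fun h =>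
    (Complex.continuous_conj.tendsto _).comp h
  exact ((((hs (ha j)).mul (ha k)).add ((hs (hb j)).mul (hb k))).add
    ((hs (hc j)).mul (hc k))).div_const _

lemma tendsto_mulVec {X : Type*} {l : Filter X} {M : X → Matrix (Fin N) (Fin N) ℂ}
    {M₀ : Matrix (Fin N) (Fin N) ℂ} {w : X → Fin N → ℂ} {w₀ : Fin N → ℂ}
    (hM : ∀ j k, Tendsto (fun x => M x j k) l (𝓝 (M₀ j k)))
    (hw : ∀ k, Tendsto (fun x => w x k) l (𝓝 (w₀ k))) (j : Fin N) :
    Tendsto (fun x => (M x *ᵥ w x) j) l (𝓝 ((M₀ *ᵥ w₀) j)) := by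
  simp only [mulVec, dotProduct]
  exact tendsto_finsetSum _ fun k _ => (hM j k).mul (hw k)

lemma tendsto_wave_atBot {ζ : Fin N → ℂ} (hζ : ∀ k, 0 < (ζ k).im) (α : Fin N → ℂ) (t : ℝ)
    (k : Fin N) : Tendsto (fun x => wave ζ α x t k) atBot (𝓝 ((0 : Fin N → ℂ) k)) := by
  simpa [wave] using (tendsto_exp_theta_atBot (hζ k) t).const_mul (α k)

lemma isUnit_det_cauchy {ζ α β : Fin N → ℂ} (hd : IsSolitonData ζ α β) :
    IsUnit (gram ζ 0 0 1).det :=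
  isUnit_det_gram hd.1 hd.2.1 fun k => Or.inr (Or.inr (by simp))

lemma isUnit_det_polar {ζ α β : Fin N → ℂ} (hd : IsSolitonData ζ α β) :
    IsUnit (gram ζ α β 0).det :=
  isUnit_det_gram hd.1 hd.2.1 fun k => by
    have := hd.2.2 k
    rw [Ne, Prod.mk.injEq, not_and_or] at this
    tauto

lemma tendsto_waveGram_inv_atBot {ζ α β : Fin N → ℂ} (hd : IsSolitonData ζ α β) (t : ℝ)
    (j k : Fin N) : Tendsto (fun x => (waveGram ζ α β x t)⁻¹ j k) atBot
      (𝓝 ((gram ζ 0 0 1)⁻¹ j k)) :=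
  tendsto_matrix_inv (isUnit_det_cauchy hd) (tendsto_gram (tendsto_wave_atBot hd.1 α t)
    (tendsto_wave_atBot hd.1 β t) fun _ => tendsto_const_nhds) j k

lemma tendsto_pVec_atBot {ζ α β : Fin N → ℂ} (hd : IsSolitonData ζ α β) (t : ℝ) (k : Fin N) :
    Tendsto (fun x => pVec ζ α β x t k) atBot (𝓝 (((gram ζ 0 0 1)⁻¹ *ᵥ 1) k)) :=
  tendsto_mulVec (tendsto_waveGram_inv_atBot hd t) (fun _ => tendsto_const_nhds) k

lemma tendsto_rVec_atBot {ζ α β : Fin N → ℂ} (hd : IsSolitonData ζ α β) (t : ℝ) (k : Fin N) :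
    Tendsto (fun x => rVec ζ α β x t k) atBot (𝓝 0) := by
  have h : ∀ j, Tendsto (fun x => star (wave ζ α x t) j) atBot (𝓝 ((0 : Fin N → ℂ) j)) := by
    intro j
    simpa [Function.comp_def] using
      (continuous_star.tendsto _).comp (tendsto_wave_atBot hd.1 α t j)
  have h' := tendsto_mulVec (tendsto_waveGram_inv_atBot hd t) h k
  rw [mulVec_zero] at h'
  exact h'

/-- The soliton matrix in coordinates adapted to `x → +∞`. -/
noncomputable def waveGramTop (ζ α β : Fin N → ℂ) (x t : ℝ) : Matrix (Fin N) (Fin N) ℂ :=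
  gram ζ α β fun k => exp (-(2 * theta (ζ k) x t))

/-- The entries blow up as x → +∞. Once the exponentials are factored out, the matrix tends to `gram
ζ α β 0`, which is invertible because no (α_k, β_k) vanishes. -/
lemma waveGram_eq_top (ζ α β : Fin N → ℂ) (x t : ℝ) : waveGram ζ α β x t =
    diagonal (fun j => conj (exp (2 * theta (ζ j) x t))) * waveGramTop ζ α β x t *
      diagonal (fun k => exp (2 * theta (ζ k) x t)) := by
  ext j k
  rw [mul_diagonal, diagonal_mul]
  simp only [waveGram, waveGramTop, gram, wave, Matrix.of_apply, Pi.one_apply, map_one, map_mul,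
    Complex.exp_neg, map_inv₀]
  have h1 := Complex.exp_ne_zero (2 * theta (ζ k) x t)
  have h2 : conj (exp (2 * theta (ζ j) x t)) ≠ 0 := by simp
  field_simp

lemma waveGram_inv_eq_top (ζ α β : Fin N → ℂ) (x t : ℝ) (j k : Fin N) :
    (waveGram ζ α β x t)⁻¹ j k = exp (-(2 * theta (ζ j) x t)) * (waveGramTop ζ α β x t)⁻¹ j k *
      conj (exp (-(2 * theta (ζ k) x t))) := by
  have h : ∀ f : Fin N → ℂ, (∀ k, f k ≠ 0) → (diagonal f)⁻¹ = diagonal fun j => (f j)⁻¹ := by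
    intro f hf
    refine Matrix.inv_eq_left_inv ?_
    rw [diagonal_mul_diagonal, ← diagonal_one]
    congr 1
    ext j
    exact inv_mul_cancel₀ (hf j)
  rw [waveGram_eq_top, Matrix.mul_inv_rev, Matrix.mul_inv_rev, h _ (fun k => by simp),
    h _ (fun k => by simp), diagonal_mul, mul_diagonal, Complex.exp_neg, Complex.exp_neg, map_inv₀]
  ring

lemma tendsto_waveGramTop_inv_atTop {ζ α β : Fin N → ℂ} (hd : IsSolitonData ζ α β) (t : ℝ)
    (j k : Fin N) : Tendsto (fun x => (waveGramTop ζ α β x t)⁻¹ j k) atTop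
      (𝓝 ((gram ζ α β 0)⁻¹ j k)) :=
  tendsto_matrix_inv (isUnit_det_polar hd) (tendsto_gram (fun _ => tendsto_const_nhds)
    (fun _ => tendsto_const_nhds) fun k => tendsto_exp_neg_theta_atTop (hd.1 k) t) j k

lemma exp_mul_rVec (ζ α β : Fin N → ℂ) (x t : ℝ) (k : Fin N) :
    exp (2 * theta (ζ k) x t) * rVec ζ α β x t k =
      ((waveGramTop ζ α β x t)⁻¹ *ᵥ star α) k := by
  simp only [rVec, mulVec, dotProduct, waveGram_inv_eq_top, Finset.mul_sum, wave, Pi.star_apply,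
    RCLike.star_def, map_mul, Complex.exp_neg, map_inv₀]
  refine Finset.sum_congr rfl fun j _ => ?_
  have h1 := Complex.exp_ne_zero (2 * theta (ζ k) x t)
  have h2 : conj (exp (2 * theta (ζ j) x t)) ≠ 0 := by simp
  field_simp

lemma tendsto_exp_mul_rVec_atTop {ζ α β : Fin N → ℂ} (hd : IsSolitonData ζ α β) (t : ℝ)
    (k : Fin N) : Tendsto (fun x => exp (2 * theta (ζ k) x t) * rVec ζ α β x t k) atTop
      (𝓝 (((gram ζ α β 0)⁻¹ *ᵥ star α) k)) := by
  simp only [exp_mul_rVec]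
  exact tendsto_mulVec (w := fun _ => star α) (tendsto_waveGramTop_inv_atTop hd t)
    (fun _ => tendsto_const_nhds) k

lemma tendsto_rVec_atTop {ζ α β : Fin N → ℂ} (hd : IsSolitonData ζ α β) (t : ℝ) (k : Fin N) :
    Tendsto (fun x => rVec ζ α β x t k) atTop (𝓝 0) := by
  have h := (tendsto_exp_neg_theta_atTop (hd.1 k) t).mul (tendsto_exp_mul_rVec_atTop hd t k)
  rw [zero_mul] at h
  refine h.congr fun x => ?_
  rw [← mul_assoc, ← Complex.exp_add, neg_add_cancel, Complex.exp_zero, one_mul]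

lemma tendsto_pVec_atTop {ζ α β : Fin N → ℂ} (hd : IsSolitonData ζ α β) (t : ℝ) (k : Fin N) :
    Tendsto (fun x => pVec ζ α β x t k) atTop (𝓝 0) := by
  simp only [pVec, mulVec, dotProduct, Pi.one_apply, mul_one, waveGram_inv_eq_top]
  have h0 : (0 : ℂ) = ∑ _j : Fin N, (0 : ℂ) := by simp
  rw [h0]
  refine tendsto_finsetSum _ fun j _ => ?_
  have h := ((tendsto_exp_neg_theta_atTop (hd.1 k) t).mul
    (tendsto_waveGramTop_inv_atTop hd t k j)).mul
    ((Complex.continuous_conj.tendsto _).comp (tendsto_exp_neg_theta_atTop (hd.1 j) t))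
  simpa [Function.comp_def] using h

end Eigenfunctions

/-! ### The reduction `v(x,t) = u(-x,t)` in terms of the data -/

section Reduction

variable {N : ℕ}

lemma SatisfiesReduction.swap {ζ α β : Fin N → ℂ} (h : SatisfiesReduction ζ α β) :
    SatisfiesReduction ζ β α := by
  intro x t
  have := h (-x) t
  rw [solitonV_eq_swap] at this ⊢
  rw [this, neg_neg]

/-- In K⁻¹Z* - ZK⁻¹ = (K⁻¹1)(1ᵀK⁻¹), a zero k-th entry of K⁻¹1 kills row k on the right. As ζ_l* ≠
ζ_k, row k of K⁻¹ would vanish. -/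
lemma cauchy_inv_one_ne_zero {ζ α β : Fin N → ℂ} (hd : IsSolitonData ζ α β) (k : Fin N) :
    ((gram ζ 0 0 1)⁻¹ *ᵥ 1) k ≠ 0 := by
  have hu := isUnit_det_cauchy hd
  set K := gram ζ 0 0 1 with hK
  intro h0
  have hrow : ∀ l, K⁻¹ k l = 0 := by
    intro l
    have e := gram_lyapunov hd.1 0 0 1
    have e1 : K⁻¹ * diagonal (fun j => conj (ζ j)) - diagonal ζ * K⁻¹ =
        K⁻¹ * (overlap 0 0 1 * K⁻¹) := by
      rw [← e, ← hK, sub_mul, mul_sub, mul_assoc K, ← mul_assoc K⁻¹ K, Matrix.nonsing_inv_mul _ hu,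
        one_mul, mul_assoc _ K, Matrix.mul_nonsing_inv _ hu, mul_one]
    have e2 := congrFun (congrFun e1 k) l
    rw [Matrix.sub_apply, mul_diagonal, diagonal_mul, Matrix.mul_apply] at e2
    have e3 : ∀ j, (overlap (0 : Fin N → ℂ) 0 1 * K⁻¹) j l = ∑ m, K⁻¹ m l := by
      intro j
      simp [Matrix.mul_apply, overlap]
    simp only [e3, ← Finset.sum_mul] at e2
    have e4 : ∑ j, K⁻¹ k j = 0 := by
      rw [← h0]
      simp [mulVec, dotProduct]
    rw [e4, zero_mul] at e2
    have e5 : (conj (ζ l) - ζ k) * K⁻¹ k l = 0 := by linear_combination e2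
    exact (mul_eq_zero.mp e5).resolve_left (conj_sub_ne_zero hd.1 l k)
  have h1 := congrFun (congrFun (Matrix.nonsing_inv_mul K hu) k) k
  rw [Matrix.mul_apply] at h1
  simp [hrow] at h1

/-- If the reduction holds, then the eigenvalues are symmetric about the imaginary axis. -/
theorem exists_eigenvalue_eq_neg_conj {ζ α β : Fin N → ℂ} (hd : IsSolitonData ζ α β)
    (hr : SatisfiesReduction ζ α β) (k : Fin N) : ∃ j, ζ j = -conj (ζ k) := by
  by_contra! hne
  -- If -ζ_k* is not an eigenvalue, the regular solution exists there and pairs with the reflected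
  -- k-th eigenfunction to a constant. At -∞ that eigenfunction vanishes, so the constant is 0; at
  -- +∞ only the third components survive, giving the conjugate of -(K⁻¹1)_k, which is nonzero.
  have hX := isJost_resolvent hd 0 (l := -conj (ζ k)) fun j => sub_ne_zero.2 (hne j)
  have hY := (isJost_vec hd 0 k).reflect fun x => hr x 0
  have hl : -ζ k = conj (-conj (ζ k)) := by simp
  rw [hl] at hY
  have hF := fun x => hX.pairing_const hY x 0
  set F := fun x : ℝ => conj (rVec ζ β α (-x) 0 k) * ∑ j, rVec ζ α β x 0 j / (ζ j - -conj (ζ k))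
    + conj (rVec ζ α β (-x) 0 k) * ∑ j, rVec ζ β α x 0 j / (ζ j - -conj (ζ k))
    + conj (-pVec ζ α β (-x) 0 k) * (1 + ∑ j, pVec ζ α β x 0 j / (ζ j - -conj (ζ k))) with hFdef
  have hF' : F = fun _ => F 0 := funext hF
  have hs : ∀ {l : Filter ℝ} {f : ℝ → ℂ} {z : ℂ}, Tendsto f l (𝓝 z) →
      Tendsto (fun x => conj (f x)) l (𝓝 (conj z)) := fun h =>
    (Complex.continuous_conj.tendsto _).comp h
  have hsum : ∀ {l : Filter ℝ} {f : ℝ → Fin N → ℂ} {z : Fin N → ℂ},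
      (∀ j, Tendsto (fun x => f x j) l (𝓝 (z j))) →
      Tendsto (fun x => ∑ j, f x j / (ζ j - -conj (ζ k))) l
        (𝓝 (∑ j, z j / (ζ j - -conj (ζ k)))) := fun h =>
    tendsto_finsetSum _ fun j _ => (h j).div_const _
  have hbot : Tendsto F atBot (𝓝 0) := by
    have h1 := hs ((tendsto_rVec_atTop hd.swap 0 k).comp tendsto_neg_atBot_atTop)
    have h2 := hs ((tendsto_rVec_atTop hd 0 k).comp tendsto_neg_atBot_atTop)
    have h3 := hs ((tendsto_pVec_atTop hd 0 k).comp tendsto_neg_atBot_atTop).neg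
    have := ((h1.mul (hsum fun j => tendsto_rVec_atBot hd 0 j)).add
      (h2.mul (hsum fun j => tendsto_rVec_atBot hd.swap 0 j))).add
      (h3.mul ((hsum fun j => tendsto_pVec_atBot hd 0 j).const_add 1))
    simpa [Function.comp_def, hFdef] using this
  have htop : Tendsto F atTop (𝓝 (conj (-((gram ζ 0 0 1)⁻¹ *ᵥ 1) k))) := by
    have h1 := hs ((tendsto_rVec_atBot hd.swap 0 k).comp tendsto_neg_atTop_atBot)
    have h2 := hs ((tendsto_rVec_atBot hd 0 k).comp tendsto_neg_atTop_atBot)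
    have h3 := hs ((tendsto_pVec_atBot hd 0 k).comp tendsto_neg_atTop_atBot).neg
    have := ((h1.mul (hsum fun j => tendsto_rVec_atTop hd 0 j)).add
      (h2.mul (hsum fun j => tendsto_rVec_atTop hd.swap 0 j))).add
      (h3.mul ((hsum fun j => tendsto_pVec_atTop hd 0 j).const_add 1))
    simpa [Function.comp_def, hFdef] using this
  rw [hF'] at hbot htop
  have h1 := tendsto_nhds_unique hbot tendsto_const_nhds
  have h2 := tendsto_nhds_unique htop tendsto_const_nhds
  rw [← h1] at h2
  have h3 : ((gram ζ 0 0 1)⁻¹ *ᵥ 1) k = 0 := by simpa using h2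
  exact cauchy_inv_one_ne_zero hd k h3

lemma theta_neg {z w : ℂ} (h : w = -conj z) (x t : ℝ) : theta z (-x) t = -conj (theta w x t) := by
  subst h
  simp only [theta, map_sub, map_mul, map_neg, conj_I, Complex.conj_conj, Complex.conj_ofReal,
    map_pow, Complex.conj_ofNat, ofReal_neg]
  ring

lemma waveGram_mulVec_rVec {ζ α β : Fin N → ℂ} (hd : IsSolitonData ζ α β) (x t : ℝ) :
    waveGram ζ α β x t *ᵥ rVec ζ α β x t = star (wave ζ α x t) := by
  rw [rVec, mulVec_mulVec, Matrix.mul_nonsing_inv _ (isUnit_det_waveGram hd x t), one_mulVec]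

/-- The Cauchy matrix applied to an eigenfunction. -/
lemma cauchy_mulVec_rVec {ζ α β : Fin N → ℂ} (hd : IsSolitonData ζ α β) (x t : ℝ) (j : Fin N) :
    ∑ l, gram ζ 0 0 1 j l * rVec ζ α β x t l = conj (exp (2 * theta (ζ j) x t)) *
      (conj (α j) - ∑ l, gram ζ α β 0 j l * (exp (2 * theta (ζ l) x t) * rVec ζ α β x t l)) := by
  have h := congrFun (waveGram_mulVec_rVec hd x t) j
  simp only [mulVec, dotProduct, Pi.star_apply, RCLike.star_def, wave, map_mul] at h
  rw [mul_sub, mul_comm _ (conj (α j)), ← h, Finset.mul_sum, ← Finset.sum_sub_distrib]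
  refine Finset.sum_congr rfl fun l _ => ?_
  simp only [waveGram, gram, Matrix.of_apply, wave, Pi.zero_apply, Pi.one_apply, map_mul, map_zero,
    map_one]
  ring

/-- If the reduction holds, then the polarizations for `x → -∞` and for `x → +∞` are related. -/
theorem polar_inv_mulVec_of_reduction {ζ α β : Fin N → ℂ} (hd : IsSolitonData ζ α β)
    (hr : SatisfiesReduction ζ α β) {j k : Fin N} (hjk : ζ j = -conj (ζ k)) :
    ((gram ζ α β 0)⁻¹ *ᵥ star β) k = ((gram ζ 0 0 1)⁻¹ *ᵥ 1) k * conj (α j) := by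
  set κ := ((gram ζ 0 0 1)⁻¹ *ᵥ 1) k with hκ
  have hne : ∀ l, ζ l - conj (ζ j) ≠ 0 := fun l h =>
    conj_sub_ne_zero hd.1 j l (by linear_combination -h)
  have hX := isJost_resolvent hd 0 hne
  have hY := (isJost_vec hd 0 k).reflect fun x => hr x 0
  have hl : -ζ k = conj (ζ j) := by simp [hjk]
  rw [hl] at hY
  -- The reflected third component tends to -κ at +∞ and the regular one to 1, so this combination
  -- decays there. Its parameter ζ_j* lies in the lower half plane, hence it vanishes identically.
  have hZ := hY.add_const_mul hX κ
  have hsum : ∀ {f : ℝ → Fin N → ℂ},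
      (∀ j, Tendsto (fun x => f x j) atTop (𝓝 0)) →
      Tendsto (fun x => ∑ l, f x l / (ζ l - conj (ζ j))) atTop (𝓝 0) := by
    intro f h
    have : Tendsto (fun x => ∑ l, f x l / (ζ l - conj (ζ j))) atTop
        (𝓝 (∑ l, 0 / (ζ l - conj (ζ j)))) :=
      tendsto_finsetSum _ fun j _ => (h j).div_const _
    simpa using this
  have h0 : ∀ x, rVec ζ β α (-x) 0 k + κ * ∑ l, rVec ζ α β x 0 l / (ζ l - conj (ζ j)) = 0 := by
    intro x
    refine (hZ.eq_zero_of_tendsto ?_ ?_ ?_ ?_ x).1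
    · simp only [conj_im]
      linarith [hd.1 j]
    · simpa [Function.comp_def] using
        ((tendsto_rVec_atBot hd.swap 0 k).comp tendsto_neg_atTop_atBot).add
        ((hsum fun l => tendsto_rVec_atTop hd 0 l).const_mul κ)
    · simpa [Function.comp_def] using
        ((tendsto_rVec_atBot hd 0 k).comp tendsto_neg_atTop_atBot).add
        ((hsum fun l => tendsto_rVec_atTop hd.swap 0 l).const_mul κ)
    · have h1 := ((tendsto_pVec_atBot hd 0 k).comp tendsto_neg_atTop_atBot).neg
      have h2 := ((hsum fun l => tendsto_pVec_atTop hd 0 l).const_add 1).const_mul κ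
      rw [← hκ] at h1
      simpa [Function.comp_def] using h1.add h2
  have h1 : ∀ x, exp (2 * theta (ζ k) (-x) 0) * rVec ζ β α (-x) 0 k = κ * (conj (α j) -
      ∑ l, gram ζ α β 0 j l * (exp (2 * theta (ζ l) x 0) * rVec ζ α β x 0 l)) := by
    intro x
    have h2 : ∑ l, rVec ζ α β x 0 l / (ζ l - conj (ζ j)) =
        -∑ l, gram ζ 0 0 1 j l * rVec ζ α β x 0 l := by
      rw [← Finset.sum_neg_distrib]
      refine Finset.sum_congr rfl fun l _ => ?_
      simp only [gram, Matrix.of_apply, Pi.zero_apply, Pi.one_apply, map_zero, map_one]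
      rw [← neg_sub (conj (ζ j)), div_neg]
      ring
    have h3 := h0 x
    rw [h2, cauchy_mulVec_rVec hd] at h3
    have h4 : exp (2 * theta (ζ k) (-x) 0) * conj (exp (2 * theta (ζ j) x 0)) = 1 := by
      rw [theta_neg hjk, ← Complex.exp_conj, ← Complex.exp_add]
      simp [Complex.conj_ofNat]
    linear_combination exp (2 * theta (ζ k) (-x) 0) * h3 + κ * (conj (α j) -
      ∑ l, gram ζ α β 0 j l * (exp (2 * theta (ζ l) x 0) * rVec ζ α β x 0 l)) * h4
  -- Now x → -∞. The left side approaches the leading coefficient of the eigenfunction at +∞; on the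
  -- right the sum dies out and κ α_j* remains.
  have h2 := (tendsto_exp_mul_rVec_atTop hd.swap 0 k).comp tendsto_neg_atBot_atTop
  have h3 : Tendsto (fun x : ℝ => κ * (conj (α j) -
      ∑ l, gram ζ α β 0 j l * (exp (2 * theta (ζ l) x 0) * rVec ζ α β x 0 l))) atBot
      (𝓝 (κ * (conj (α j) - ∑ l, gram ζ α β 0 j l * (0 * 0)))) :=
    ((tendsto_finsetSum _ fun l _ => ((tendsto_exp_theta_atBot (hd.1 l) 0).mul
      (tendsto_rVec_atBot hd 0 l)).const_mul _).const_sub _).const_mul _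
  have h4 := tendsto_nhds_unique (h2.congr h1) h3
  rw [gram_swap, h4]
  simp

/-! ### Sufficiency -/

/-- Conjugating Kκ = 1 and reindexing by π shows that -κ* ∘ π solves the same system; K is
invertible. -/
lemma reflected_residue {ζ κ : Fin N → ℂ} (hζ : ∀ k, 0 < (ζ k).im)
    (hinj : Function.Injective ζ) {π : Fin N → Fin N}
    (hπ : ∀ k, ζ (π k) = -conj (ζ k)) (hκ : ∀ j, ∑ l, gram ζ 0 0 1 j l * κ l = 1) (k : Fin N) :
    κ (π k) = -conj (κ k) := by
  have hππ : Function.Involutive π := fun k => hinj (by rw [hπ, hπ]; simp)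
  have hu : IsUnit (gram ζ 0 0 1).det :=
    isUnit_det_gram hζ hinj fun k => Or.inr (Or.inr (by simp))
  have hinjK := Matrix.mulVec_injective_iff_isUnit.2 ((Matrix.isUnit_iff_isUnit_det _).2 hu)
  have h : κ = fun k => -conj (κ (π k)) := by
    apply hinjK
    ext j
    simp only [mulVec, dotProduct]
    rw [hκ, ← Equiv.sum_comp hππ.toPerm]
    have h1 := congrArg conj (hκ (π j))
    rw [map_one, map_sum] at h1
    rw [← h1]
    refine Finset.sum_congr rfl fun l _ => ?_
    simp only [gram, Matrix.of_apply, Pi.zero_apply, Pi.one_apply, map_zero, map_one, map_mul,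
      map_div₀, map_sub, Complex.conj_conj, hπ, Function.Involutive.coe_toPerm, map_neg, map_add]
    rw [hππ l, ← neg_sub_neg, ← neg_sub]
    simp only [neg_neg, div_neg]
    ring
  have := congrFun h (π k)
  rwa [hππ k] at this

/-- A matrix identity equivalent to the symmetry of the soliton under reflection. -/
lemma sum_gram_reflected {ζ κ : Fin N → ℂ} (hζ : ∀ k, 0 < (ζ k).im)
    (hinj : Function.Injective ζ) {π : Fin N → Fin N} (hπ : ∀ k, ζ (π k) = -conj (ζ k))
    (hκπ : ∀ k, κ (π k) = -conj (κ k)) {a b c : Fin N → ℂ}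
    (ha : ∀ j, ∑ l, gram ζ a b c j l * κ l * conj (a (π l)) = conj (b j))
    (hb : ∀ j, ∑ l, gram ζ a b c j l * κ l * conj (b (π l)) = conj (a j))
    (hc : ∀ j, ∑ l, gram ζ a b c j l * κ l * conj (c (π l)) = conj (c j))
    (hne : ∀ k, a k ≠ 0 ∨ b k ≠ 0 ∨ c k ≠ 0) (j k : Fin N) :
    (∑ l, gram ζ a b c j l * κ l * gram ζ a b c (π l) k) * κ k = if k = π j then 1 else 0 := by
  have hππ : Function.Involutive π := fun k => hinj (by rw [hπ, hπ]; simp)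
  set G := gram ζ a b c with hG
  set X : Fin N → Fin N → ℂ := fun j k => ∑ l, G j l * κ l * G (π l) k with hX
  -- Conjugating and reindexing by π transposes the hypotheses, so that they can be used from the
  -- left as well.
  have hdual : ∀ {y z : Fin N → ℂ}, (∀ j, ∑ l, G j l * κ l * conj (y (π l)) = conj (z j)) →
      ∀ k, ∑ l, y l * κ l * G (π l) k = z k := by
    intro y z h k
    rw [← Equiv.sum_comp hππ.toPerm, ← Complex.conj_conj (z k), ← h k, map_sum]
    refine Finset.sum_congr rfl fun l _ => ?_
    simp only [Function.Involutive.coe_toPerm, hππ l, hκπ, map_mul, Complex.conj_conj, hG,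
      gram_conj]
    ring
  -- Applying the Lyapunov identity to each of the two Gram factors leaves two sums. By the
  -- hypotheses both equal a_j* b_k + b_j* a_k + c_j* c_k, so X_jk vanishes unless ζ_k = -ζ_j*.
  have hoff : ∀ j k, (conj (ζ j) + ζ k) * X j k = 0 := by
    intro j k
    have h1 : (conj (ζ j) + ζ k) * X j k =
        ∑ l, (overlap a b c j l * κ l * G (π l) k - G j l * κ l * overlap a b c (π l) k) := by
      rw [hX, Finset.mul_sum]
      refine Finset.sum_congr rfl fun l _ => ?_
      rw [← gram_mul_sub hζ a b c, ← gram_mul_sub hζ a b c, hπ]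
      simp only [map_neg, Complex.conj_conj]
      ring
    have h2 : ∑ l, overlap a b c j l * κ l * G (π l) k =
        conj (a j) * ∑ l, a l * κ l * G (π l) k + conj (b j) * ∑ l, b l * κ l * G (π l) k
          + conj (c j) * ∑ l, c l * κ l * G (π l) k := by
      simp only [Finset.mul_sum, ← Finset.sum_add_distrib, overlap, Matrix.of_apply]
      exact Finset.sum_congr rfl fun l _ => by ring
    have h3 : ∑ l, G j l * κ l * overlap a b c (π l) k =
        (∑ l, G j l * κ l * conj (a (π l))) * a k + (∑ l, G j l * κ l * conj (b (π l))) * b k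
          + (∑ l, G j l * κ l * conj (c (π l))) * c k := by
      simp only [Finset.sum_mul, ← Finset.sum_add_distrib, overlap, Matrix.of_apply]
      exact Finset.sum_congr rfl fun l _ => by ring
    rw [h1, Finset.sum_sub_distrib, h2, h3, hdual ha, hdual hb, hdual hc, ha, hb, hc]
    ring
  have hzero : ∀ j k, k ≠ π j → X j k = 0 := by
    intro j k hk
    refine (mul_eq_zero.mp (hoff j k)).resolve_left fun h => hk (hinj ?_)
    rw [hπ]
    linear_combination h
  -- Using the hypotheses for y and then for z maps y* back to itself, and only the term k = π j of
  -- X contributes. A nonzero y_j then fixes X at (j, π j).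
  have hdiag : ∀ {y z : Fin N → ℂ}, (∀ j, ∑ l, G j l * κ l * conj (y (π l)) = conj (z j)) →
      (∀ j, ∑ l, G j l * κ l * conj (z (π l)) = conj (y j)) → ∀ j,
      X j (π j) * κ (π j) * conj (y j) = conj (y j) := by
    intro y z hy hz j
    have h1 : ∑ k, X j k * κ k * conj (y (π k)) = X j (π j) * κ (π j) * conj (y j) := by
      rw [Finset.sum_eq_single (π j)]
      · rw [hππ j]
      · intro k _ hk
        rw [hzero j k hk, zero_mul, zero_mul]
      · simp
    rw [← h1, ← hz j]
    simp only [hX, Finset.sum_mul]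
    rw [Finset.sum_comm]
    refine Finset.sum_congr rfl fun l _ => ?_
    rw [← hy (π l), Finset.mul_sum]
    exact Finset.sum_congr rfl fun k _ => by ring
  change X j k * κ k = _
  split_ifs with hk
  · subst hk
    have hcan : ∀ {y z : Fin N → ℂ}, (∀ j, ∑ l, G j l * κ l * conj (y (π l)) = conj (z j)) →
        (∀ j, ∑ l, G j l * κ l * conj (z (π l)) = conj (y j)) → y j ≠ 0 →
        X j (π j) * κ (π j) = 1 := fun hy hz h0 =>
      mul_right_cancel₀ ((map_ne_zero conj).2 h0) (by rw [one_mul]; exact hdiag hy hz j)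
    rcases hne j with h | h | h
    · exact hcan ha hb h
    · exact hcan hb ha h
    · exact hcan hc hc h
  · rw [hzero j k hk, zero_mul]

/-- The necessity argument predicts the reflected eigenfunctions as multiples of Kr. It remains to
check that this candidate solves the linear system defining `rVec ζ β α (-x) t`, and that its
entries have the same sum as those of r. -/
lemma solitonV_neg_of_polar {ζ α β κ : Fin N → ℂ} (hd : IsSolitonData ζ α β)
    {π : Fin N → Fin N} (hπ : ∀ k, ζ (π k) = -conj (ζ k))
    (hκ : ∀ j, ∑ l, gram ζ 0 0 1 j l * κ l = 1)
    (ha : ∀ j, ∑ l, gram ζ α β 0 j l * κ l * conj (α (π l)) = conj (β j))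
    (hb : ∀ j, ∑ l, gram ζ α β 0 j l * κ l * conj (β (π l)) = conj (α j)) (x t : ℝ) :
    solitonV ζ α β (-x) t = solitonU ζ α β x t := by
  have hππ : Function.Involutive π := fun k => hd.2.1 (by rw [hπ, hπ]; simp)
  have hκπ := reflected_residue hd.1 hd.2.1 hπ hκ
  have hK := sum_gram_reflected hd.1 hd.2.1 hπ hκπ (a := 0) (b := 0) (c := 1) (by simp) (by simp)
    (by simpa using hκ) (by simp)
  have hG := sum_gram_reflected hd.1 hd.2.1 hπ hκπ ha hb (c := 0) (by simp) (fun k => by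
    have := hd.2.2 k
    rw [Ne, Prod.mk.injEq, not_and_or] at this
    tauto)
  have hκ0 : ∀ k, κ k ≠ 0 := by
    intro k h0
    have := hK (π k) k
    rw [h0, mul_zero, hππ k] at this
    simp at this
  have hpick : ∀ (c w : Fin N → ℂ) (j : Fin N), (∀ k, c k * κ k = if k = π j then 1 else 0) →
      ∑ k, c k * w k = w (π j) / κ (π j) := by
    intro c w j h
    rw [Finset.sum_eq_single (π j)]
    · have := h (π j)
      rw [if_pos rfl] at this
      rw [eq_div_iff (hκ0 _)]
      linear_combination w (π j) * this
    · intro k _ hk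
      have := h k
      rw [if_neg hk] at this
      rw [(mul_eq_zero.mp this).resolve_right (hκ0 k), zero_mul]
    · simp
  set r := rVec ζ α β x t with hr
  set d := fun k => exp (2 * theta (ζ k) x t) with hdd
  have hd0 : ∀ k, d k ≠ 0 := fun k => Complex.exp_ne_zero _
  have hdneg : ∀ k, exp (2 * theta (ζ k) (-x) t) = (conj (d (π k)))⁻¹ := by
    intro k
    rw [hdd, theta_neg (hπ k), ← Complex.exp_conj, ← Complex.exp_neg]
    simp [Complex.conj_ofNat]
  set q := fun m => κ m * ∑ l, gram ζ 0 0 1 (π m) l * r l with hq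
  have hqr : q = rVec ζ β α (-x) t := by
    have hu := isUnit_det_waveGram hd.swap (-x) t
    have h1 : waveGram ζ β α (-x) t *ᵥ q = star (wave ζ β (-x) t) := by
      ext j
      have h2 : ∀ m, waveGram ζ β α (-x) t j m * q m =
          ∑ l, gram ζ 0 0 1 j m * κ m * gram ζ 0 0 1 (π m) l * r l +
          ((d (π j))⁻¹ * (gram ζ α β 0 j m * κ m * conj (α (π m))) - (d (π j))⁻¹ *
            ∑ l, gram ζ α β 0 j m * κ m * gram ζ α β 0 (π m) l * (d l * r l)) := by
        intro m
        -- Reflection inverts and conjugates the exponentials and permutes their indices by π.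
        have h3 : waveGram ζ β α (-x) t j m = gram ζ 0 0 1 j m +
            (d (π j))⁻¹ * gram ζ α β 0 j m * (conj (d (π m)))⁻¹ := by
          simp only [waveGram, gram, wave, Matrix.of_apply, hdneg, map_mul, map_inv₀,
            Complex.conj_conj, Pi.zero_apply, Pi.one_apply, map_zero, map_one]
          ring
        have h4 : (conj (d (π m)))⁻¹ * q m = κ m * (conj (α (π m)) -
            ∑ l, gram ζ α β 0 (π m) l * (d l * r l)) := by
          have := cauchy_mulVec_rVec hd x t (π m)
          have h5 : conj (d (π m)) ≠ 0 := (map_ne_zero conj).2 (hd0 _)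
          rw [hq]
          simp only [hr, this]
          change (conj (d (π m)))⁻¹ * (κ m * (conj (d (π m)) * _)) = _
          field_simp
          rfl
        have h6 : ∑ l, gram ζ 0 0 1 j m * κ m * gram ζ 0 0 1 (π m) l * r l =
            gram ζ 0 0 1 j m * q m := by
          rw [hq]
          simp only [Finset.mul_sum]
          exact Finset.sum_congr rfl fun l _ => by ring
        have h7 : ∑ l, gram ζ α β 0 j m * κ m * gram ζ α β 0 (π m) l * (d l * r l) =
            gram ζ α β 0 j m * κ m * ∑ l, gram ζ α β 0 (π m) l * (d l * r l) := by
          rw [Finset.mul_sum]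
          exact Finset.sum_congr rfl fun l _ => by ring
        rw [h3, h6, h7]
        linear_combination (d (π j))⁻¹ * gram ζ α β 0 j m * h4
      simp only [mulVec, dotProduct, h2, Finset.sum_add_distrib, Finset.sum_sub_distrib,
        ← Finset.mul_sum]
      rw [Finset.sum_comm, Finset.sum_comm (f := fun m l =>
        gram ζ α β 0 j m * κ m * gram ζ α β 0 (π m) l * (d l * r l)), ha]
      simp only [← Finset.sum_mul]
      -- The Cauchy part and the polarization part both produce r_{π j} / κ_{π j}, with opposite
      -- signs. What survives is β_j* times the required exponential.
      rw [hpick _ _ j (hK j), hpick _ (fun l => d l * r l) j (hG j)]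
      simp only [Pi.star_apply, RCLike.star_def, wave, hdneg, map_mul, map_inv₀, Complex.conj_conj]
      have := hd0 (π j)
      have := hκ0 (π j)
      field_simp
      ring
    rw [rVec, ← h1, mulVec_mulVec, Matrix.nonsing_inv_mul _ hu, one_mulVec]
  have hsum : ∀ l, ∑ m, κ m * gram ζ 0 0 1 (π m) l = 1 := by
    intro l
    have h1 := congrArg conj (hκ l)
    rw [map_one, map_sum] at h1
    rw [← h1, ← Equiv.sum_comp hππ.toPerm]
    refine Finset.sum_congr rfl fun m _ => ?_
    simp only [Function.Involutive.coe_toPerm, hππ m, hκπ, map_mul, gram_conj]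
    ring
  apply (starRingEnd ℂ).injective
  rw [solitonV_eq_swap, conj_solitonU, conj_solitonU, ← hqr]
  congr 1
  simp only [hq, Finset.mul_sum]
  rw [Finset.sum_comm]
  refine Finset.sum_congr rfl fun l _ => ?_
  have := hsum l
  simp only [← mul_assoc, ← Finset.sum_mul, this, one_mul]
  rfl

/-- The reduction in terms of the eigenvectors. The numbers `κ l` are determined by the
eigenvalues. -/
theorem satisfiesReduction_iff {ζ α β κ : Fin N → ℂ} (hd : IsSolitonData ζ α β)
    {π : Fin N → Fin N} (hπ : ∀ k, ζ (π k) = -conj (ζ k))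
    (hκ : ∀ j, ∑ l, gram ζ 0 0 1 j l * κ l = 1) :
    SatisfiesReduction ζ α β ↔
      (∀ j, ∑ l, gram ζ α β 0 j l * κ l * conj (α (π l)) = conj (β j)) ∧
      (∀ j, ∑ l, gram ζ α β 0 j l * κ l * conj (β (π l)) = conj (α j)) := by
  constructor
  · intro hr
    have hκ' : (gram ζ 0 0 1)⁻¹ *ᵥ 1 = κ := by
      have h1 : gram ζ 0 0 1 *ᵥ κ = 1 := funext hκ
      have h2 : (gram ζ 0 0 1)⁻¹ *ᵥ (gram ζ 0 0 1 *ᵥ κ) = κ := by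
        rw [mulVec_mulVec, Matrix.nonsing_inv_mul _ (isUnit_det_cauchy hd), one_mulVec]
      rwa [h1] at h2
    have key : ∀ {ζ α β : Fin N → ℂ}, IsSolitonData ζ α β → SatisfiesReduction ζ α β →
        (∀ k, ζ (π k) = -conj (ζ k)) → (gram ζ 0 0 1)⁻¹ *ᵥ 1 = κ →
        ∀ j, ∑ l, gram ζ α β 0 j l * κ l * conj (α (π l)) = conj (β j) := by
      intro ζ α β hd hr hπ hκ' j
      have h1 : (gram ζ α β 0)⁻¹ *ᵥ star β = fun k => κ k * conj (α (π k)) := by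
        ext k
        rw [polar_inv_mulVec_of_reduction hd hr (hπ k), hκ']
      have h2 : (gram ζ α β 0 *ᵥ ((gram ζ α β 0)⁻¹ *ᵥ star β)) j =
          (gram ζ α β 0 *ᵥ fun k => κ k * conj (α (π k))) j := by
        rw [h1]
      rw [mulVec_mulVec, Matrix.mul_nonsing_inv _ (isUnit_det_polar hd), one_mulVec] at h2
      simp only [mulVec, dotProduct, ← mul_assoc] at h2
      exact h2.symm
    refine ⟨key hd hr hπ hκ', ?_⟩
    rw [gram_swap]
    exact key hd.swap hr.swap hπ hκ'
  · rintro ⟨ha, hb⟩ x t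
    have := solitonV_neg_of_polar hd hπ hκ ha hb (-x) t
    rwa [neg_neg] at this

end Reduction

/-! ### One-solitons -/

lemma re_eq_zero_of_eq_neg_conj {z : ℂ} (h : z = -conj z) : z.re = 0 := by
  have := congrArg Complex.re h
  simp at this
  linarith

lemma eq_I_mul_of_re_eq_zero {z : ℂ} (h : z.re = 0) : z = I * (z.im : ℂ) := by
  apply Complex.ext <;> simp [h]

/-- With n = |α|² + |β|², the criterion says that n times (α*, β*) is the same vector with its
components exchanged. Exchanging twice gives n² = 1, so n = 1 and α = β. -/
theorem oneSoliton_iff (ζ α β : Fin 1 → ℂ) :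
    (IsSolitonData ζ α β ∧ SatisfiesReduction ζ α β) ↔
      (∃ η : ℝ, 0 < η ∧ ζ 0 = I * η) ∧
      ∃ γ : ℝ, eigenvector α β 0 =
        ![((Real.sqrt 2)⁻¹ : ℝ) * exp (I * γ), ((Real.sqrt 2)⁻¹ : ℝ) * exp (I * γ), 1] := by
  have hcrit : IsSolitonData ζ α β → ζ 0 = -conj (ζ 0) → (SatisfiesReduction ζ α β ↔
      (((‖α 0‖ ^ 2 + ‖β 0‖ ^ 2 : ℝ) : ℂ) * conj (α 0) = conj (β 0) ∧
        ((‖α 0‖ ^ 2 + ‖β 0‖ ^ 2 : ℝ) : ℂ) * conj (β 0) = conj (α 0))) := by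
    intro hd h
    have h0 := conj_sub_ne_zero hd.1 0 0
    rw [satisfiesReduction_iff hd (π := id) (κ := fun _ => conj (ζ 0) - ζ 0)]
    · simp only [Fin.forall_fin_one, Fin.sum_univ_one, gram, Matrix.of_apply, Pi.zero_apply,
        map_zero, mul_zero, add_zero, id, div_mul_cancel₀ _ h0]
      push_cast
      simp only [Complex.conj_mul']
    · intro k
      rw [Subsingleton.elim k 0]
      exact h
    · intro j
      rw [Subsingleton.elim j 0]
      simp [gram, h0]
  constructor
  · rintro ⟨hd, hr⟩
    obtain ⟨j, hj⟩ := exists_eigenvalue_eq_neg_conj hd hr 0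
    rw [Subsingleton.elim j 0] at hj
    refine ⟨⟨(ζ 0).im, hd.1 0, eq_I_mul_of_re_eq_zero (re_eq_zero_of_eq_neg_conj hj)⟩, ?_⟩
    obtain ⟨e1, e2⟩ := (hcrit hd hj).1 hr
    set n : ℝ := ‖α 0‖ ^ 2 + ‖β 0‖ ^ 2 with hn
    have e3 : ((n : ℂ) ^ 2 - 1) * conj (α 0) = 0 := by
      linear_combination (n : ℂ) * e1 + e2
    have e4 : ((n : ℂ) ^ 2 - 1) * conj (β 0) = 0 := by
      linear_combination e1 + (n : ℂ) * e2
    have hn0 : 0 ≤ n := by positivity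
    have hn1 : n = 1 := by
      by_contra hne
      have h5 : (n : ℂ) ^ 2 - 1 ≠ 0 := by
        intro h
        have h6 : n ^ 2 - 1 = 0 := by exact_mod_cast h
        exact hne (by nlinarith)
      have ha := (mul_eq_zero.mp e3).resolve_left h5
      have hb := (mul_eq_zero.mp e4).resolve_left h5
      rw [map_eq_zero] at ha hb
      exact hd.2.2 0 (by rw [ha, hb])
    have hab : α 0 = β 0 := by
      rw [hn1, ofReal_one, one_mul] at e1
      exact (starRingEnd ℂ).injective e1
    have hnorm : ‖α 0‖ = (Real.sqrt 2)⁻¹ := by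
      rw [← hab] at hn
      rw [eq_comm, ← Real.sqrt_inv, Real.sqrt_eq_iff_mul_self_eq (by norm_num) (norm_nonneg _)]
      nlinarith
    refine ⟨(α 0).arg, ?_⟩
    have h6 : α 0 = ((Real.sqrt 2)⁻¹ : ℝ) * exp (I * (α 0).arg) := by
      rw [← hnorm, mul_comm I, Complex.norm_mul_exp_arg_mul_I]
    rw [← h6, eigenvector, hab]
  · rintro ⟨⟨η, hη, hζ⟩, γ, hv⟩
    have ha : α 0 = ((Real.sqrt 2)⁻¹ : ℝ) * exp (I * γ) := congrFun hv 0
    have hb : β 0 = ((Real.sqrt 2)⁻¹ : ℝ) * exp (I * γ) := congrFun hv 1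
    have hab : β 0 = α 0 := hb.trans ha.symm
    have hnorm : ‖α 0‖ ^ 2 = 1 / 2 := by
      rw [ha, norm_mul, mul_comm I, Complex.norm_exp_ofReal_mul_I, mul_one, Complex.norm_real,
        Real.norm_eq_abs, sq_abs, inv_pow, Real.sq_sqrt (by norm_num)]
      norm_num
    have hd : IsSolitonData ζ α β := by
      refine ⟨fun k => ?_, fun j k _ => Subsingleton.elim j k, fun k h => ?_⟩
      · rw [Subsingleton.elim k 0, hζ]
        simpa using hη
      · rw [Subsingleton.elim k 0, Prod.mk.injEq] at h
        rw [h.1] at hnorm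
        norm_num at hnorm
    refine ⟨hd, (hcrit hd (by rw [hζ]; simp)).2 ?_⟩
    rw [hab, hnorm]
    norm_num

/-! ### Two-solitons -/

/-- The map ζ ↦ -ζ* is an involution of the two eigenvalues: it fixes both or exchanges them. -/
theorem twoSoliton_eigenvalues {ζ α β : Fin 2 → ℂ} (hd : IsSolitonData ζ α β)
    (hr : SatisfiesReduction ζ α β) :
    ((ζ 0).re = 0 ∧ (ζ 1).re = 0) ∨ ζ 1 = -conj (ζ 0) := by
  obtain ⟨j, hj⟩ := exists_eigenvalue_eq_neg_conj hd hr 0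
  obtain ⟨k, hk⟩ := exists_eigenvalue_eq_neg_conj hd hr 1
  fin_cases j
  · fin_cases k
    · right
      have := congrArg conj (show ζ 0 = _ from hk)
      simp only [map_neg, Complex.conj_conj] at this
      rw [this, neg_neg]
    · exact Or.inl ⟨re_eq_zero_of_eq_neg_conj hj, re_eq_zero_of_eq_neg_conj hk⟩
  · exact Or.inr hj

/-- The relation `σ w₁ = -g n₁ w₁ + (1+g) q* w₂`, `σ w₂ = (1-g) q w₁ + g n₂ w₂`, where `σ`
exchanges the two components of a vector. -/
def ImaginarySwapRelations (g : ℝ) (α β : Fin 2 → ℂ) : Prop :=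
  β 0 = -(g * ((‖α 0‖ ^ 2 + ‖β 0‖ ^ 2 : ℝ) : ℂ) * α 0)
    + (1 + g) * (α 0 * conj (α 1) + β 0 * conj (β 1)) * α 1 ∧
  α 0 = -(g * ((‖α 0‖ ^ 2 + ‖β 0‖ ^ 2 : ℝ) : ℂ) * β 0)
    + (1 + g) * (α 0 * conj (α 1) + β 0 * conj (β 1)) * β 1 ∧
  β 1 = g * ((‖α 1‖ ^ 2 + ‖β 1‖ ^ 2 : ℝ) : ℂ) * α 1
    + (1 - g) * (conj (α 0) * α 1 + conj (β 0) * β 1) * α 0 ∧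
  α 1 = g * ((‖α 1‖ ^ 2 + ‖β 1‖ ^ 2 : ℝ) : ℂ) * β 1
    + (1 - g) * (conj (α 0) * α 1 + conj (β 0) * β 1) * β 0

lemma isSolitonData_imaginary {η₁ η₂ : ℝ} (h₁ : 0 < η₁) (h₂ : 0 < η₂) (h : η₁ ≠ η₂)
    {α β : Fin 2 → ℂ} : IsSolitonData ![I * η₁, I * η₂] α β ↔ ∀ k, (α k, β k) ≠ (0, 0) := by
  refine ⟨fun hd => hd.2.2, fun hne => ⟨?_, ?_, hne⟩⟩
  · simp [Fin.forall_fin_two, h₁, h₂]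
  · intro j k hjk
    fin_cases j <;> fin_cases k <;> simp_all

lemma satisfiesReduction_imaginary_iff {η₁ η₂ : ℝ} (h₁ : 0 < η₁) (h₂ : 0 < η₂) (h : η₁ ≠ η₂)
    {α β : Fin 2 → ℂ} (hd : IsSolitonData ![I * η₁, I * η₂] α β) :
    SatisfiesReduction ![I * η₁, I * η₂] α β ↔ ImaginarySwapRelations (gPar η₁ η₂) α β := by
  have e₁ : (η₁ : ℂ) ≠ 0 := by exact_mod_cast h₁.ne'
  have e₂ : (η₂ : ℂ) ≠ 0 := by exact_mod_cast h₂.ne'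
  have e₃ : (η₁ : ℂ) + η₂ ≠ 0 := by exact_mod_cast (add_pos h₁ h₂).ne'
  have e₄ : (η₂ : ℂ) - η₁ ≠ 0 := by exact_mod_cast sub_ne_zero.2 h.symm
  have hI := I_ne_zero
  have k00 : -(I * (η₁ : ℂ)) - I * η₁ ≠ 0 := by
    have : -(I * (η₁ : ℂ)) - I * η₁ = -2 * I * η₁ := by ring
    rw [this]
    simp [e₁]
  have k01 : -(I * (η₁ : ℂ)) - I * η₂ ≠ 0 := by
    have : -(I * (η₁ : ℂ)) - I * η₂ = -I * (η₁ + η₂) := by ring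
    rw [this]
    simp [e₃]
  have k10 : -(I * (η₂ : ℂ)) - I * η₁ ≠ 0 := by
    have : -(I * (η₂ : ℂ)) - I * η₁ = -I * (η₁ + η₂) := by ring
    rw [this]
    simp [e₃]
  have k11 : -(I * (η₂ : ℂ)) - I * η₂ ≠ 0 := by
    have : -(I * (η₂ : ℂ)) - I * η₂ = -2 * I * η₂ := by ring
    rw [this]
    simp [e₂]
  have hg : ((gPar η₁ η₂ : ℝ) : ℂ) = (η₁ + η₂) / (η₂ - η₁) := by simp [gPar]
  set g : ℂ := ((gPar η₁ η₂ : ℝ) : ℂ) with hgdef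
  have c00 : ∀ X : ℂ, X / (-(I * (η₁ : ℂ)) - I * η₁) * (2 * I * η₁ * g) = -(g * X) := by
    intro X
    rw [div_mul_eq_mul_div, div_eq_iff k00]
    ring
  have c01 : ∀ X : ℂ, X / (-(I * (η₁ : ℂ)) - I * η₂) * (-(2 * I * η₂ * g)) = (1 + g) * X := by
    intro X
    rw [div_mul_eq_mul_div, div_eq_iff k01, hg]
    field_simp
    ring
  have c10 : ∀ X : ℂ, X / (-(I * (η₂ : ℂ)) - I * η₁) * (2 * I * η₁ * g) = (1 - g) * X := by
    intro X
    rw [div_mul_eq_mul_div, div_eq_iff k10, hg]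
    field_simp
    ring
  have c11 : ∀ X : ℂ, X / (-(I * (η₂ : ℂ)) - I * η₂) * (-(2 * I * η₂ * g)) = g * X := by
    intro X
    rw [div_mul_eq_mul_div, div_eq_iff k11]
    ring
  -- Both eigenvalues are fixed by ζ ↦ -ζ*, so π is the identity. The rows of the Cauchy system for
  -- this κ read -g + (1+g) = 1 and (1-g) + g = 1.
  rw [satisfiesReduction_iff hd (π := id) (κ := ![2 * I * η₁ * g, -(2 * I * η₂ * g)])]
  · simp only [Fin.forall_fin_two, Fin.sum_univ_two, gram, Matrix.of_apply, Pi.zero_apply,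
      map_zero, mul_zero, add_zero, id, Matrix.cons_val_zero, Matrix.cons_val_one, map_mul, conj_I,
      Complex.conj_ofReal, neg_mul, c00, c01, c10, c11]
    have hc : ∀ {z w : ℂ}, z = conj w ↔ w = conj z := fun {z w} =>
      ⟨fun h => by rw [h, Complex.conj_conj], fun h => by rw [h, Complex.conj_conj]⟩
    rw [hc (w := β 0), hc (w := β 1), hc (w := α 0), hc (w := α 1)]
    have hgc : conj g = g := Complex.conj_ofReal _
    simp only [map_add, map_mul, map_neg, map_sub, map_one, hgc, Complex.conj_conj,
      ImaginarySwapRelations, ← hgdef]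
    push_cast
    simp only [← Complex.conj_mul']
    constructor
    · rintro ⟨⟨p1, p2⟩, p3, p4⟩
      refine ⟨p1.trans ?_, p3.trans ?_, p2.trans ?_, p4.trans ?_⟩ <;> ring
    · rintro ⟨p1, p3, p2, p4⟩
      refine ⟨⟨p1.trans ?_, p2.trans ?_⟩, p3.trans ?_, p4.trans ?_⟩ <;> ring
  · simp [Fin.forall_fin_two]
  · simp only [Fin.forall_fin_two, Fin.sum_univ_two, gram, Matrix.of_apply, Pi.zero_apply,
      Pi.one_apply, map_zero, map_one, mul_zero, mul_one, zero_add, Matrix.cons_val_zero,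
      Matrix.cons_val_one, map_mul, conj_I, Complex.conj_ofReal, neg_mul, c00, c01, c10, c11]
    constructor <;> ring

lemma one_lt_gPar_sq {η₁ η₂ : ℝ} (h₁ : 0 < η₁) (h₂ : 0 < η₂) (h : η₁ ≠ η₂) :
    1 < gPar η₁ η₂ ^ 2 := by
  have h3 : 0 < (η₂ - η₁) ^ 2 := by
    have := sub_ne_zero.2 h.symm
    positivity
  rw [gPar, div_pow, lt_div_iff₀ h3]
  nlinarith [mul_pos h₁ h₂]

lemma norm_sq_add_eq_zero {a b : ℂ} (h : ‖a‖ ^ 2 + ‖b‖ ^ 2 = 0) : a = 0 ∧ b = 0 := by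
  have ha : ‖a‖ ^ 2 = 0 := by nlinarith [sq_nonneg ‖a‖, sq_nonneg ‖b‖]
  have hb : ‖b‖ ^ 2 = 0 := by nlinarith [sq_nonneg ‖a‖, sq_nonneg ‖b‖]
  exact ⟨norm_eq_zero.1 (pow_eq_zero_iff two_ne_zero |>.1 ha),
    norm_eq_zero.1 (pow_eq_zero_iff two_ne_zero |>.1 hb)⟩

/-- The coefficient matrix expressing σw₁, σw₂ through w₁, w₂ is traceless once n₁ = n₂ = n, so its
square is the scalar g²n² + (1-g²)|q|². Since σ² = 1 this scalar must be 1, which is the second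
relation. Conversely, when it is 1, the remaining components follow by applying the relations twice.
-/
lemma imaginaryRelations_iff {g : ℝ} (hg : 1 < g ^ 2) {α β : Fin 2 → ℂ} :
    ((∀ k, (α k, β k) ≠ (0, 0)) ∧ ImaginarySwapRelations g α β) ↔ ImaginaryRelations g α β := by
  have hqc : α 0 * conj (α 1) + β 0 * conj (β 1) =
      conj (conj (α 0) * α 1 + conj (β 0) * β 1) := by simp
  unfold ImaginarySwapRelations ImaginaryRelations
  rw [hqc]
  set n₁ : ℝ := ‖α 0‖ ^ 2 + ‖β 0‖ ^ 2 with hn₁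
  set n₂ : ℝ := ‖α 1‖ ^ 2 + ‖β 1‖ ^ 2 with hn₂
  set q : ℂ := conj (α 0) * α 1 + conj (β 0) * β 1 with hq
  have hn₁' : (n₁ : ℂ) = conj (α 0) * α 0 + conj (β 0) * β 0 := by
    rw [hn₁]
    push_cast
    simp only [Complex.conj_mul']
  have hn₂' : (n₂ : ℂ) = conj (α 1) * α 1 + conj (β 1) * β 1 := by
    rw [hn₂]
    push_cast
    simp only [Complex.conj_mul']
  have hQ : ((‖q‖ ^ 2 : ℝ) : ℂ) = conj q * q := by
    push_cast
    rw [Complex.conj_mul']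
  constructor
  · rintro ⟨hne, r1, r2, r3, r4⟩
    have hpos₁ : 0 < n₁ := lt_of_le_of_ne (by positivity) fun h => hne 0 (by
      obtain ⟨ha, hb⟩ := norm_sq_add_eq_zero h.symm
      rw [ha, hb])
    have hpos₂ : 0 < n₂ := lt_of_le_of_ne (by positivity) fun h => hne 1 (by
      obtain ⟨ha, hb⟩ := norm_sq_add_eq_zero h.symm
      rw [ha, hb])
    -- Comparing ⟨σw₁, w₂⟩ with ⟨w₁, σw₂⟩ gives q(n₂ - n₁) = 0.
    have hn : n₁ = n₂ := by
      have c1 := congrArg conj r1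
      have c2 := congrArg conj r2
      simp only [map_add, map_mul, map_neg, map_one, Complex.conj_ofReal, Complex.conj_conj] at c1 c2
      have h0 : q * ((n₂ : ℂ) - n₁) = 0 := by
        have hm : conj (β 0) * α 1 + conj (α 0) * β 1 = conj (α 0) * β 1 + conj (β 0) * α 1 := by
          ring
        have l1 : conj (β 0) * α 1 + conj (α 0) * β 1 = -(g * n₁ * q) + (1 + g) * q * n₂ := by
          rw [hn₂']
          linear_combination α 1 * c1 + β 1 * c2 - g * n₁ * hq
        have l2 : conj (α 0) * β 1 + conj (β 0) * α 1 = (1 - g) * q * n₁ + g * n₂ * q := by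
          rw [hn₁']
          linear_combination conj (α 0) * r3 + conj (β 0) * r4 - g * n₂ * hq
        linear_combination hm - l1 + l2
      rcases mul_eq_zero.mp h0 with h | h
      · rw [h] at r1 r2 r3 r4
        simp only [map_zero, mul_zero, zero_mul, add_zero] at r1 r2 r3 r4
        -- For q = 0 each w_k is an eigenvector of the isometry σ, with eigenvalue ±g n_k, hence
        -- g²n_k² = 1.
        have key : ∀ {a b : ℂ} {n c : ℝ}, 0 < n → (n : ℂ) = conj a * a + conj b * b →
            b = c * n * a → a = c * n * b → c ^ 2 * n ^ 2 = 1 := by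
          intro a b n c hn hn' hb ha
          have ca := congrArg conj ha
          have cb := congrArg conj hb
          simp only [map_mul, Complex.conj_ofReal] at ca cb
          have : (n : ℂ) * (c ^ 2 * n ^ 2) = n * 1 := by
            linear_combination (-1 : ℂ) * hn' + c ^ 2 * n ^ 2 * hn' - conj b * hb
              - c * n * a * cb - conj a * ha - c * n * b * ca
          have h2 := mul_left_cancel₀ (by exact_mod_cast hn.ne') this
          exact_mod_cast h2
        have k1 : (-g) ^ 2 * n₁ ^ 2 = 1 := key hpos₁ hn₁' (by push_cast; linear_combination r1)
          (by push_cast; linear_combination r2)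
        have k2 := key (c := g) hpos₂ hn₂' r3 r4
        have h3 : n₁ ^ 2 = n₂ ^ 2 := by
          have : g ^ 2 ≠ 0 := by positivity
          exact mul_left_cancel₀ this (by rw [k2]; linarith)
        exact (pow_left_inj₀ hpos₁.le hpos₂.le two_ne_zero).1 h3
      · have : n₂ - n₁ = 0 := by exact_mod_cast h
        linarith
    refine ⟨hn, ?_, ?_, ?_⟩
    · have t1 : ((g ^ 2 * n₁ ^ 2 + (1 - g ^ 2) * ‖q‖ ^ 2 - 1 : ℝ) : ℂ) * α 0 = 0 := by
        rw [hn] at r2 ⊢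
        rw [hn] at r1
        rw [ofReal_sub, ofReal_add, ofReal_mul _ (‖q‖ ^ 2), hQ]
        push_cast
        linear_combination -r2 + g * n₂ * r1 - (1 + g) * conj q * r3
      have t2 : ((g ^ 2 * n₁ ^ 2 + (1 - g ^ 2) * ‖q‖ ^ 2 - 1 : ℝ) : ℂ) * β 0 = 0 := by
        rw [hn] at r1 ⊢
        rw [hn] at r2
        rw [ofReal_sub, ofReal_add, ofReal_mul _ (‖q‖ ^ 2), hQ]
        push_cast
        linear_combination -r1 + g * n₂ * r2 - (1 + g) * conj q * r4
      have t3 : g ^ 2 * n₁ ^ 2 + (1 - g ^ 2) * ‖q‖ ^ 2 - 1 = 0 := by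
        by_contra hT
        have hT' := (ofReal_ne_zero (z := g ^ 2 * n₁ ^ 2 + (1 - g ^ 2) * ‖q‖ ^ 2 - 1)).2 hT
        exact hne 0 (by
          rw [(mul_eq_zero.mp t1).resolve_left hT', (mul_eq_zero.mp t2).resolve_left hT'])
      linear_combination t3
    · rw [← hn]
      linear_combination r1
    · rw [hn]
      linear_combination r3
  · rintro ⟨hn, hT, r3, r4⟩
    have hT' : (g : ℂ) ^ 2 * n₂ ^ 2 + (1 - g ^ 2) * (conj q * q) = 1 := by
      rw [← hQ, ← hn]
      have : g ^ 2 * n₁ ^ 2 + (1 - g ^ 2) * ‖q‖ ^ 2 = 1 := by linear_combination hT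
      exact_mod_cast this
    have hn0 : n₂ ≠ 0 := by
      intro h0
      have h1 : q = 0 := by
        obtain ⟨ha, hb⟩ := norm_sq_add_eq_zero (a := α 1) (b := β 1) h0
        rw [hq, ha, hb]
        simp
      rw [h0, h1] at hT'
      simp at hT'
    rw [hn] at r4 ⊢
    refine ⟨?_, ?_, ?_, ?_, ?_⟩
    · intro k hk
      rw [Prod.mk.injEq] at hk
      apply hn0
      fin_cases k
      · rw [← hn, hn₁]
        simp only [Fin.zero_eta] at hk
        rw [hk.1, hk.2]
        simp
      · rw [hn₂]
        simp only [Fin.mk_one] at hk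
        rw [hk.1, hk.2]
        simp
    · linear_combination r3
    · linear_combination -(α 0) * hT' + g * n₂ * r3 - (1 + g) * conj q * r4
    · linear_combination r4
    · linear_combination -(α 1) * hT' - (1 - g) * q * r3 - g * n₂ * r4

theorem imaginary_iff {η₁ η₂ : ℝ} (h₁ : 0 < η₁) (h₂ : 0 < η₂) (h : η₁ ≠ η₂) (α β : Fin 2 → ℂ) :
    (IsSolitonData ![I * η₁, I * η₂] α β ∧ SatisfiesReduction ![I * η₁, I * η₂] α β) ↔
      ImaginaryRelations (gPar η₁ η₂) α β := by
  rw [← imaginaryRelations_iff (one_lt_gPar_sq h₁ h₂ h)]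
  constructor
  · rintro ⟨hd, hr⟩
    exact ⟨hd.2.2, (satisfiesReduction_imaginary_iff h₁ h₂ h hd).1 hr⟩
  · rintro ⟨hne, hr⟩
    have hd := (isSolitonData_imaginary h₁ h₂ h).2 hne
    exact ⟨hd, (satisfiesReduction_imaginary_iff h₁ h₂ h hd).2 hr⟩

/-! ### Pairs of eigenvalues -/

lemma pairMatrix_det {ζ : ℂ} (hi : 0 < ζ.im) (a b : ℂ) :
    (pairMatrix ζ a b).det = -(((‖a‖ ^ 2 + ‖b‖ ^ 2 : ℝ) : ℂ) ^ 2 *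
      (1 / (conj ζ - ζ) - 1 / (2 * conj ζ)) / (conj ζ - ζ)) := by
  have h1 : conj ζ - ζ ≠ 0 := conj_sub_ne_zero (ζ := fun _ : Fin 1 => ζ) (fun _ => hi) 0 0
  have h2 : conj ζ ≠ 0 := by
    rw [Ne, map_eq_zero]
    rintro rfl
    simp at hi
  rw [pairMatrix, Matrix.det_fin_two_of]
  push_cast
  simp only [← Complex.conj_mul']
  field_simp
  ring

lemma pair_coeff {ζ : ℂ} (hi : 0 < ζ.im) (hr : ζ.re ≠ 0) :
    conj ζ - ζ ≠ 0 ∧ conj ζ ≠ 0 ∧ ζ ≠ 0 ∧ ζ + conj ζ ≠ 0 ∧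
      1 / (conj ζ - ζ) - 1 / (2 * conj ζ) = (ζ + conj ζ) / (2 * conj ζ * (conj ζ - ζ)) := by
  have h1 : conj ζ - ζ ≠ 0 := conj_sub_ne_zero (ζ := fun _ : Fin 1 => ζ) (fun _ => hi) 0 0
  have h0 : ζ ≠ 0 := by
    rintro rfl
    simp at hi
  have h2 : conj ζ ≠ 0 := by rwa [Ne, map_eq_zero]
  refine ⟨h1, h2, h0, ?_, ?_⟩
  · rw [Complex.add_conj]
    simpa using hr
  · field_simp
    ring

theorem isUnit_det_pairMatrix {ζ : ℂ} (hi : 0 < ζ.im) (hr : ζ.re ≠ 0) {a b : ℂ}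
    (hab : (a, b) ≠ (0, 0)) : IsUnit (pairMatrix ζ a b).det := by
  obtain ⟨h1, h2, h0, h3, h4⟩ := pair_coeff hi hr
  rw [pairMatrix_det hi, isUnit_iff_ne_zero, h4, neg_ne_zero]
  have h5 : ((‖a‖ ^ 2 + ‖b‖ ^ 2 : ℝ) : ℂ) ≠ 0 := by
    rw [Ne, ofReal_eq_zero]
    intro h
    obtain ⟨ha, hb⟩ := norm_sq_add_eq_zero h
    exact hab (by rw [ha, hb])
  exact div_ne_zero (mul_ne_zero (pow_ne_zero 2 h5) (div_ne_zero h3 (mul_ne_zero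
    (mul_ne_zero two_ne_zero h2) h1))) h1

lemma satisfiesReduction_pair_iff {ζ : ℂ} (hi : 0 < ζ.im) (hre : ζ.re ≠ 0) {α β : Fin 2 → ℂ}
    (hd : IsSolitonData ![ζ, -conj ζ] α β) :
    SatisfiesReduction ![ζ, -conj ζ] α β ↔
      ((2 * conj ζ * ((‖α 0‖ ^ 2 + ‖β 0‖ ^ 2 : ℝ) : ℂ) * α 1
        - (conj ζ - ζ) * (α 0 * conj (α 1) + β 0 * conj (β 1)) * α 0 = (ζ + conj ζ) * β 0 ∧
      2 * conj ζ * ((‖α 0‖ ^ 2 + ‖β 0‖ ^ 2 : ℝ) : ℂ) * β 1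
        - (conj ζ - ζ) * (α 0 * conj (α 1) + β 0 * conj (β 1)) * β 0 = (ζ + conj ζ) * α 0) ∧
      ((conj ζ - ζ) * (conj (α 0) * α 1 + conj (β 0) * β 1) * α 1
        + 2 * ζ * ((‖α 1‖ ^ 2 + ‖β 1‖ ^ 2 : ℝ) : ℂ) * α 0 = (ζ + conj ζ) * β 1 ∧
      (conj ζ - ζ) * (conj (α 0) * α 1 + conj (β 0) * β 1) * β 1
        + 2 * ζ * ((‖α 1‖ ^ 2 + ‖β 1‖ ^ 2 : ℝ) : ℂ) * β 0 = (ζ + conj ζ) * α 1)) := by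
  obtain ⟨h1, h2, h0, h3, h4⟩ := pair_coeff hi hre
  have k01 : conj ζ - -conj ζ ≠ 0 := by
    rw [sub_neg_eq_add, ← two_mul]
    exact mul_ne_zero two_ne_zero h2
  have k10 : -ζ - ζ ≠ 0 := by
    rw [← neg_add', neg_ne_zero, ← two_mul]
    exact mul_ne_zero two_ne_zero h0
  have k11 : -ζ - -conj ζ ≠ 0 := by
    rwa [neg_sub_neg]
  -- The solution of the Cauchy system for the eigenvalues ζ and -ζ*, which π exchanges.
  set κ : Fin 2 → ℂ := ![2 * ζ * (conj ζ - ζ) / (ζ + conj ζ),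
    2 * conj ζ * (conj ζ - ζ) / (ζ + conj ζ)] with hκ
  have c00 : ∀ X : ℂ, X / (conj ζ - ζ) * (2 * ζ * (conj ζ - ζ) / (ζ + conj ζ)) =
      2 * ζ * X / (ζ + conj ζ) := by
    intro X
    field_simp
  have c01 : ∀ X : ℂ, X / (conj ζ - -conj ζ) * (2 * conj ζ * (conj ζ - ζ) / (ζ + conj ζ)) =
      (conj ζ - ζ) * X / (ζ + conj ζ) := by
    intro X
    rw [sub_neg_eq_add, ← two_mul]
    field_simp
  have c10 : ∀ X : ℂ, X / (-ζ - ζ) * (2 * ζ * (conj ζ - ζ) / (ζ + conj ζ)) =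
      -((conj ζ - ζ) * X) / (ζ + conj ζ) := by
    intro X
    rw [← neg_add', ← two_mul]
    field_simp
  have c11 : ∀ X : ℂ, X / (-ζ - -conj ζ) * (2 * conj ζ * (conj ζ - ζ) / (ζ + conj ζ)) =
      2 * conj ζ * X / (ζ + conj ζ) := by
    intro X
    rw [neg_sub_neg]
    field_simp
  rw [satisfiesReduction_iff hd (π := ![1, 0]) (κ := κ)]
  · simp only [Fin.forall_fin_two, Fin.sum_univ_two, gram, Matrix.of_apply, Pi.zero_apply,
      map_zero, mul_zero, add_zero, Matrix.cons_val_zero, Matrix.cons_val_one, map_neg,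
      Complex.conj_conj, hκ, c00, c01, c10, c11]
    have hc : ∀ {z w : ℂ}, z = conj w ↔ conj z = w := fun {z w} =>
      ⟨fun h => by rw [h, Complex.conj_conj], fun h => by rw [← h, Complex.conj_conj]⟩
    have h3' : conj ζ + ζ ≠ 0 := by rwa [add_comm]
    rw [hc (w := β 0), hc (w := β 1), hc (w := α 0), hc (w := α 1)]
    simp only [div_mul_eq_mul_div, ← add_div, map_div₀, map_add, map_mul, map_neg, map_sub,
      Complex.conj_conj, div_eq_iff h3', Complex.conj_ofNat]
    push_cast
    simp only [← Complex.conj_mul']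
    constructor
    · rintro ⟨⟨p1, p2⟩, p3, p4⟩
      refine ⟨⟨?_, ?_⟩, ?_, ?_⟩
      · linear_combination p1
      · linear_combination p3
      · linear_combination p2
      · linear_combination p4
    · rintro ⟨⟨p1, p3⟩, p2, p4⟩
      refine ⟨⟨?_, ?_⟩, ?_, ?_⟩
      · linear_combination p1
      · linear_combination p2
      · linear_combination p3
      · linear_combination p4
  · simp [Fin.forall_fin_two]
  · simp only [Fin.forall_fin_two, Fin.sum_univ_two, gram, Matrix.of_apply, Pi.zero_apply,
      Pi.one_apply, map_zero, map_one, mul_zero, mul_one, zero_add, Matrix.cons_val_zero,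
      Matrix.cons_val_one, map_neg, Complex.conj_conj, hκ, c00, c01, c10, c11]
    constructor <;> field_simp <;> ring

/-- The right-hand system is linear in w₂ because it contains q = ⟨w₁, w₂⟩. The reduction has q* in
its place; the two agree once q is known to be real. -/
lemma pairMatrix_mulVec_iff {ζ : ℂ} (hi : 0 < ζ.im) (hre : ζ.re ≠ 0) (α β : Fin 2 → ℂ)
    (hne : (α 0, β 0) ≠ (0, 0)) :
    ![α 1, β 1] = S ζ (α 0) (β 0) *ᵥ ![α 0, β 0] ↔
      (2 * conj ζ * ((‖α 0‖ ^ 2 + ‖β 0‖ ^ 2 : ℝ) : ℂ) * α 1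
        - (conj ζ - ζ) * (conj (α 0) * α 1 + conj (β 0) * β 1) * α 0 = (ζ + conj ζ) * β 0 ∧
      2 * conj ζ * ((‖α 0‖ ^ 2 + ‖β 0‖ ^ 2 : ℝ) : ℂ) * β 1
        - (conj ζ - ζ) * (conj (α 0) * α 1 + conj (β 0) * β 1) * β 0 = (ζ + conj ζ) * α 0) := by
  obtain ⟨h1, h2, h0, h3, h4⟩ := pair_coeff hi hre
  have hu := isUnit_det_pairMatrix hi hre hne
  have e1 : ![α 1, β 1] = S ζ (α 0) (β 0) *ᵥ ![α 0, β 0] ↔ pairMatrix ζ (α 0) (β 0) *ᵥ ![α 1, β 1] =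
      ((ζ + conj ζ) / (2 * conj ζ * (conj ζ - ζ))) • ![α 0, β 0] := by
    rw [S, h4, smul_mulVec]
    constructor
    · intro h
      rw [h, mulVec_smul, mulVec_mulVec, Matrix.mul_nonsing_inv _ hu, one_mulVec]
    · intro h
      rw [← mulVec_smul, ← h, mulVec_mulVec, Matrix.nonsing_inv_mul _ hu, one_mulVec]
  rw [e1, funext_iff, Fin.forall_fin_two]
  simp only [pairMatrix, mulVec, dotProduct, Fin.sum_univ_two, Matrix.of_apply,
    Matrix.cons_val_zero, Matrix.cons_val_one, Pi.smul_apply, smul_eq_mul]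
  push_cast
  simp only [← Complex.conj_mul']
  have h5 : 2 * conj ζ * (conj ζ - ζ) ≠ 0 := by simp [h1, h0]
  constructor
  · rintro ⟨p1, p2⟩
    field_simp at p1 p2
    constructor
    · linear_combination p2
    · linear_combination p1
  · rintro ⟨p1, p2⟩
    constructor
    · field_simp
      linear_combination p2
    · field_simp
      linear_combination p1

/-- On either side q is real. The first two equations then determine w₂, and the other two follow
from them through the formula for n₁n₂. -/
theorem pair_iff {ζ : ℂ} (hi : 0 < ζ.im) (hre : ζ.re ≠ 0) (α β : Fin 2 → ℂ) :
    (IsSolitonData ![ζ, -conj ζ] α β ∧ SatisfiesReduction ![ζ, -conj ζ] α β) ↔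
      (α 0, β 0) ≠ (0, 0) ∧ ![α 1, β 1] = S ζ (α 0) (β 0) *ᵥ ![α 0, β 0] := by
  obtain ⟨h1, h2, h0, h3, -⟩ := pair_coeff hi hre
  set q : ℂ := conj (α 0) * α 1 + conj (β 0) * β 1 with hq
  set n₁ : ℝ := ‖α 0‖ ^ 2 + ‖β 0‖ ^ 2 with hn₁
  set n₂ : ℝ := ‖α 1‖ ^ 2 + ‖β 1‖ ^ 2 with hn₂
  have hqc : α 0 * conj (α 1) + β 0 * conj (β 1) = conj q := by simp [hq]
  have hn₁' : (n₁ : ℂ) = conj (α 0) * α 0 + conj (β 0) * β 0 := by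
    rw [hn₁]
    push_cast
    simp only [Complex.conj_mul']
  have hn₂' : (n₂ : ℂ) = conj (α 1) * α 1 + conj (β 1) * β 1 := by
    rw [hn₂]
    push_cast
    simp only [Complex.conj_mul']
  have hn0 : (α 0, β 0) ≠ (0, 0) → (n₁ : ℂ) ≠ 0 := by
    intro hne h
    rw [ofReal_eq_zero] at h
    obtain ⟨ha, hb⟩ := norm_sq_add_eq_zero h
    exact hne (by rw [ha, hb])
  constructor
  · rintro ⟨hd, hr⟩
    have hne := hd.2.2 0
    refine ⟨hne, (pairMatrix_mulVec_iff hi hre α β hne).2 ?_⟩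
    obtain ⟨⟨c1, c2⟩, -⟩ := (satisfiesReduction_pair_iff hi hre hd).1 hr
    rw [hqc] at c1 c2
    -- Pairing with w₁ makes the right-hand side real; subtracting the conjugate equation leaves
    -- n₁(ζ + ζ*)(q* - q) = 0.
    have hreal : conj q = q := by
      have k1 : 2 * conj ζ * n₁ * q - (conj ζ - ζ) * conj q * n₁ =
          (ζ + conj ζ) * (conj (α 0) * β 0 + conj (β 0) * α 0) := by
        linear_combination conj (α 0) * c1 + conj (β 0) * c2 + 2 * conj ζ * n₁ * hq
          - (conj ζ - ζ) * conj q * hn₁'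
      have k2 := congrArg conj k1
      simp only [map_sub, map_add, map_mul, Complex.conj_conj, Complex.conj_ofReal,
        Complex.conj_ofNat] at k2
      have k3 : (n₁ * (ζ + conj ζ)) * (conj q - q) = 0 := by linear_combination k2 - k1
      exact sub_eq_zero.mp ((mul_eq_zero.mp k3).resolve_left (mul_ne_zero (hn0 hne) h3))
    rw [hreal] at c1 c2
    exact ⟨c1, c2⟩
  · rintro ⟨hne, hS⟩
    obtain ⟨c1, c2⟩ := (pairMatrix_mulVec_iff hi hre α β hne).1 hS
    rw [← hq] at c1 c2
    have hn := hn0 hne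
    have hreal : conj q = q := by
      have k1 : n₁ * q = conj (α 0) * β 0 + conj (β 0) * α 0 := by
        refine mul_left_cancel₀ h3 ?_
        linear_combination conj (α 0) * c1 + conj (β 0) * c2 + 2 * conj ζ * n₁ * hq
          - (conj ζ - ζ) * q * hn₁'
      have k2 := congrArg conj k1
      simp only [map_add, map_mul, Complex.conj_conj, Complex.conj_ofReal] at k2
      refine mul_left_cancel₀ hn ?_
      linear_combination k2 - k1
    have d1 := congrArg conj c1
    have d2 := congrArg conj c2
    simp only [map_add, map_sub, map_mul, Complex.conj_conj, Complex.conj_ofReal,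
      Complex.conj_ofNat, hreal] at d1 d2
    -- The squared norm of 2ζ*n₁w₂ = (ζ + ζ*)σw₁ + (ζ* - ζ)qw₁. As ζ + ζ* is real and (ζ* - ζ)q is
    -- imaginary, the cross terms cancel.
    have hnn : 4 * ζ * conj ζ * n₁ * n₂ = (ζ + conj ζ) ^ 2 - (conj ζ - ζ) ^ 2 * q ^ 2 := by
      refine mul_left_cancel₀ hn ?_
      have k1 : (n₁ : ℂ) * (4 * ζ * conj ζ * n₁ * n₂) =
          (2 * ζ * n₁ * conj (α 1)) * (2 * conj ζ * n₁ * α 1)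
          + (2 * ζ * n₁ * conj (β 1)) * (2 * conj ζ * n₁ * β 1) := by
        rw [hn₂']
        ring
      have k2 : 2 * ζ * n₁ * conj (α 1) = (conj ζ + ζ) * conj (β 0)
          + (ζ - conj ζ) * q * conj (α 0) := by linear_combination d1
      have k3 : 2 * ζ * n₁ * conj (β 1) = (conj ζ + ζ) * conj (α 0)
          + (ζ - conj ζ) * q * conj (β 0) := by linear_combination d2
      have k4 : 2 * conj ζ * n₁ * α 1 = (ζ + conj ζ) * β 0 + (conj ζ - ζ) * q * α 0 := by
        linear_combination c1
      have k5 : 2 * conj ζ * n₁ * β 1 = (ζ + conj ζ) * α 0 + (conj ζ - ζ) * q * β 0 := by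
        linear_combination c2
      rw [k1, k2, k3, k4, k5, hn₁']
      ring
    -- If w₂ = 0 then also q = 0, and `hnn` would give (ζ + ζ*)² = 0.
    have hne2 : (α 1, β 1) ≠ (0, 0) := by
      intro h
      rw [Prod.mk.injEq] at h
      have k1 : (ζ + conj ζ) ^ 2 - (conj ζ - ζ) ^ 2 * q ^ 2 = 0 := by
        rw [← hnn, hn₂, h.1, h.2]
        simp
      have hq0 : q = 0 := by rw [hq, h.1, h.2]; simp
      rw [hq0] at k1
      exact (pow_ne_zero 2 h3) (by linear_combination k1)
    have hd : IsSolitonData ![ζ, -conj ζ] α β := by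
      refine ⟨by simp [Fin.forall_fin_two, hi], ?_, fun k => ?_⟩
      · have h5 : ζ ≠ -conj ζ := fun h => hre (re_eq_zero_of_eq_neg_conj h)
        intro j k hjk
        fin_cases j <;> fin_cases k
        · rfl
        · exact absurd hjk h5
        · exact absurd hjk.symm h5
        · rfl
      · fin_cases k
        · exact hne
        · exact hne2
    refine ⟨hd, (satisfiesReduction_pair_iff hi hre hd).2 ?_⟩
    rw [hqc, hreal]
    have hz : 2 * conj ζ * n₁ ≠ 0 := mul_ne_zero (mul_ne_zero two_ne_zero h2) hn
    refine ⟨⟨c1, c2⟩, mul_left_cancel₀ hz ?_, mul_left_cancel₀ hz ?_⟩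
    · linear_combination (conj ζ - ζ) * q * c1 + α 0 * hnn - (ζ + conj ζ) * c2
    · linear_combination (conj ζ - ζ) * q * c2 + β 0 * hnn - (ζ + conj ζ) * c1

/-! ### Charts of embedded submanifolds -/

section Charts

variable {d : ℕ} {E F : Type*} [NormedAddCommGroup E] [NormedSpace ℝ E] [NormedAddCommGroup F]
  [NormedSpace ℝ F]

/-- `S` is an embedded submanifold of dimension `d` near `p`. -/
def HasChart (d : ℕ) (S : Set E) (p : E) : Prop :=
  ∃ (U : Set (EuclideanSpace ℝ (Fin d))) (W : Set E)
    (φ : EuclideanSpace ℝ (Fin d) → E) (ψ : E → EuclideanSpace ℝ (Fin d)),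
    IsOpen U ∧ IsOpen W ∧ p ∈ W ∧
    ContDiffOn ℝ ∞ φ U ∧ (∀ x ∈ U, Function.Injective (fderiv ℝ φ x)) ∧
    φ '' U = S ∩ W ∧ ContinuousOn ψ (S ∩ W) ∧ ∀ x ∈ U, ψ (φ x) = x

lemma injective_fderiv_of_comp {G : Type*} [NormedAddCommGroup G] [NormedSpace ℝ G] {φ : G → E}
    {ψ : E → F} {x : G} (hφ : DifferentiableAt ℝ φ x) (hψ : DifferentiableAt ℝ ψ (φ x))
    (h : Function.Injective (fderiv ℝ (fun y => ψ (φ y)) x)) :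
    Function.Injective (fderiv ℝ φ x) := by
  have : fderiv ℝ (fun y => ψ (φ y)) x = (fderiv ℝ ψ (φ x)).comp (fderiv ℝ φ x) :=
    fderiv_comp x hψ hφ
  rw [this] at h
  exact Function.Injective.of_comp (f := fderiv ℝ ψ (φ x)) h

/-- Images under smooth maps with a smooth left inverse. -/
lemma HasChart.image {A : Set F} {Ψ : F → E} {Λ : E → F} (hΨ : ContDiff ℝ ∞ Ψ)
    (hΛ : ContDiff ℝ ∞ Λ) (hinv : ∀ a ∈ A, Λ (Ψ a) = a) {a : F} (ha : a ∈ A)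
    (h : HasChart d A a) : HasChart d (Ψ '' A) (Ψ a) := by
  obtain ⟨U, W, φ, ψ, hU, hW, haW, hφ, hinj, himg, hψ, hleft⟩ := h
  have hmem : ∀ x ∈ U, φ x ∈ A ∩ W := fun x hx => himg ▸ Set.mem_image_of_mem φ hx
  refine ⟨U, Λ ⁻¹' W, fun x => Ψ (φ x), fun p => ψ (Λ p), hU, hW.preimage hΛ.continuous, ?_,
    hΨ.comp_contDiffOn hφ, ?_, ?_, ?_, ?_⟩
  · rwa [Set.mem_preimage, hinv a ha]
  · intro x hx
    have hφx : DifferentiableAt ℝ φ x :=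
      (hφ.contDiffAt (hU.mem_nhds hx)).differentiableAt (by simp)
    refine injective_fderiv_of_comp (ψ := Λ) ((hΨ.differentiable (by simp)).differentiableAt.comp x
      hφx) (hΛ.differentiable (by simp)).differentiableAt ?_
    have : (fun y => Λ (Ψ (φ y))) =ᶠ[𝓝 x] φ := by
      filter_upwards [hU.mem_nhds hx] with y hy
      exact hinv _ (hmem y hy).1
    rw [this.fderiv_eq]
    exact hinj x hx
  · ext p
    constructor
    · rintro ⟨x, hx, rfl⟩
      refine ⟨⟨φ x, (hmem x hx).1, rfl⟩, ?_⟩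
      rw [Set.mem_preimage, hinv _ (hmem x hx).1]
      exact (hmem x hx).2
    · rintro ⟨⟨b, hb, rfl⟩, hbW⟩
      rw [Set.mem_preimage, hinv b hb] at hbW
      have : b ∈ φ '' U := himg ▸ ⟨hb, hbW⟩
      obtain ⟨x, hx, rfl⟩ := this
      exact ⟨x, hx, rfl⟩
  · refine hψ.comp hΛ.continuous.continuousOn ?_
    rintro p ⟨⟨b, hb, rfl⟩, hbW⟩
    rw [Set.mem_preimage] at hbW
    rw [hinv b hb] at hbW ⊢
    exact ⟨hb, hbW⟩
  · intro x hx
    simp only [hinv _ (hmem x hx).1, hleft x hx]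

end Charts

/-! ### The product of a three-sphere and a circle -/

/-- The product of the unit sphere of `ℂ²` and the unit circle. -/
def sphereCircle : Set (ℂ × ℂ × ℂ) := {v | ‖v.1‖ ^ 2 + ‖v.2.1‖ ^ 2 = 1 ∧ ‖v.2.2‖ = 1}

lemma arg_mul_exp {r s : ℝ} (hr : 0 < r) (h₁ : -Real.pi < s) (h₂ : s ≤ Real.pi) :
    arg (r * exp (s * I)) = s := by
  rw [Complex.arg_real_mul _ hr, Complex.arg_exp_mul_I, toIocMod_eq_self]
  exact ⟨h₁, by linarith⟩

lemma mul_exp_mem_slitPlane {r s : ℝ} (hr : 0 < r) (h₁ : -Real.pi < s) (h₂ : s < Real.pi) :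
    (r * exp (s * I) : ℂ) ∈ slitPlane := by
  rw [mem_slitPlane_iff_arg, arg_mul_exp hr h₁ h₂.le]
  refine ⟨h₂.ne, mul_ne_zero (by exact_mod_cast hr.ne') (exp_ne_zero _)⟩

lemma arg_mem_Ioo_of_mem_slitPlane {z : ℂ} (hz : z ∈ slitPlane) :
    -Real.pi < arg z ∧ arg z < Real.pi :=
  ⟨neg_pi_lt_arg z, lt_of_le_of_ne (arg_le_pi z) (mem_slitPlane_iff_arg.1 hz).1⟩

lemma differentiableAt_arg {z : ℂ} (hz : z ∈ slitPlane) : DifferentiableAt ℝ arg z := by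
  have h1 : DifferentiableAt ℝ Complex.log z :=
    (differentiableAt_log hz).restrictScalars ℝ
  have h2 := Complex.imCLM.differentiableAt.comp z h1
  refine h2.congr_of_eventuallyEq (Eventually.of_forall fun w => ?_)
  simp [Complex.log_im]

/-- The coordinates are q in the open unit disk and the phases of the other two entries relative to
the base point. The modulus of z is determined by q. Dividing by the phases of the base point keeps
the arguments off the branch cut. -/
lemma hasChart_sphereCircle_of_ne {v : ℂ × ℂ × ℂ} (hv : v ∈ sphereCircle) (hz : v.2.1 ≠ 0) :
    HasChart 4 sphereCircle v := by
  obtain ⟨q₀, z₀, e₀⟩ := v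
  simp only [sphereCircle, Set.mem_ofPred_eq] at hv hz
  set c : ℂ := z₀ / ‖z₀‖ with hc
  have hz₀ : 0 < ‖z₀‖ := norm_pos_iff.2 hz
  have hc1 : ‖c‖ = 1 := by
    rw [hc, norm_div, Complex.norm_real, norm_norm, div_self hz₀.ne']
  have hc0 : c ≠ 0 := norm_ne_zero_iff.1 (by rw [hc1]; exact one_ne_zero)
  have he0 : e₀ ≠ 0 := norm_ne_zero_iff.1 (by rw [hv.2]; exact one_ne_zero)
  let U : Set (EuclideanSpace ℝ (Fin 4)) :=
    {s | s 0 ^ 2 + s 1 ^ 2 < 1 ∧ -Real.pi < s 2 ∧ s 2 < Real.pi ∧ -Real.pi < s 3 ∧ s 3 < Real.pi}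
  let W : Set (ℂ × ℂ × ℂ) := {v | v.2.1 / c ∈ slitPlane ∧ v.2.2 / e₀ ∈ slitPlane}
  let φ : EuclideanSpace ℝ (Fin 4) → ℂ × ℂ × ℂ := fun s =>
    (s 0 + s 1 * I, (Real.sqrt (1 - (s 0 ^ 2 + s 1 ^ 2)) : ℝ) * exp (s 2 * I) * c,
      exp (s 3 * I) * e₀)
  let ψ : ℂ × ℂ × ℂ → EuclideanSpace ℝ (Fin 4) := fun v =>
    !₂[v.1.re, v.1.im, arg (v.2.1 / c), arg (v.2.2 / e₀)]
  have hpr : ∀ i : Fin 4, ContDiff ℝ ∞ fun s : EuclideanSpace ℝ (Fin 4) => s i := fun i =>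
    (EuclideanSpace.proj i : EuclideanSpace ℝ (Fin 4) →L[ℝ] ℝ).contDiff
  have hcont : ∀ i : Fin 4, Continuous fun s : EuclideanSpace ℝ (Fin 4) => s i := fun i =>
    (hpr i).continuous
  have hprc : ∀ i : Fin 4, ContDiff ℝ ∞ fun s : EuclideanSpace ℝ (Fin 4) => ((s i : ℝ) : ℂ) :=
    fun i => Complex.ofRealCLM.contDiff.comp (hpr i)
  have hU : IsOpen U := by
    refine (isOpen_lt (((hcont 0).pow 2).add ((hcont 1).pow 2)) continuous_const).inter ?_
    refine (isOpen_lt continuous_const (hcont 2)).inter ?_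
    refine (isOpen_lt (hcont 2) continuous_const).inter ?_
    exact (isOpen_lt continuous_const (hcont 3)).inter (isOpen_lt (hcont 3) continuous_const)
  have hWo : IsOpen W := by
    refine (isOpen_slitPlane.preimage (f := fun v : ℂ × ℂ × ℂ => v.2.1 / c) ?_).inter
      (isOpen_slitPlane.preimage (f := fun v : ℂ × ℂ × ℂ => v.2.2 / e₀) ?_)
    · exact (continuous_fst.comp continuous_snd).div_const c
    · exact (continuous_snd.comp continuous_snd).div_const e₀
  have hφ : ContDiffOn ℝ ∞ φ U := by
    refine (ContDiff.contDiffOn ?_).prodMk (ContDiffOn.prodMk ?_ (ContDiff.contDiffOn ?_))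
    · exact (hprc 0).add ((hprc 1).mul contDiff_const)
    · refine ContDiffOn.mul (ContDiffOn.mul ?_ (ContDiff.contDiffOn ?_)) contDiffOn_const
      · refine Complex.ofRealCLM.contDiff.comp_contDiffOn (ContDiffOn.sqrt ?_ ?_)
        · exact (contDiff_const.sub (((hpr 0).pow 2).add ((hpr 1).pow 2))).contDiffOn
        · intro s hs
          have := hs.1
          exact (sub_pos.2 this).ne'
      · exact ((hprc 2).mul contDiff_const).cexp
    · exact ((hprc 3).mul contDiff_const).cexp.mul contDiff_const
  have hψφ : ∀ s ∈ U, ψ (φ s) = s := by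
    intro s hs
    have hr : 0 < Real.sqrt (1 - (s 0 ^ 2 + s 1 ^ 2)) := Real.sqrt_pos.2 (sub_pos.2 hs.1)
    have h2 : arg ((Real.sqrt (1 - (s 0 ^ 2 + s 1 ^ 2)) : ℝ) * exp (s 2 * I) * c / c) = s 2 := by
      rw [mul_div_cancel_right₀ _ hc0]
      exact arg_mul_exp hr hs.2.1 hs.2.2.1.le
    have h3 : arg (exp (s 3 * I) * e₀ / e₀) = s 3 := by
      rw [mul_div_cancel_right₀ _ he0]
      have := arg_mul_exp one_pos hs.2.2.2.1 hs.2.2.2.2.le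
      rwa [ofReal_one, one_mul] at this
    ext i
    fin_cases i
    · simp [ψ, φ]
    · simp [ψ, φ]
    · exact h2
    · exact h3
  have hφW : ∀ s ∈ U, φ s ∈ sphereCircle ∩ W := by
    intro s hs
    have hr : 0 < Real.sqrt (1 - (s 0 ^ 2 + s 1 ^ 2)) := Real.sqrt_pos.2 (sub_pos.2 hs.1)
    refine ⟨⟨?_, ?_⟩, ?_, ?_⟩
    · simp only [φ, norm_mul, hc1, Complex.norm_exp_ofReal_mul_I, mul_one, Complex.norm_real,
        Real.norm_eq_abs, sq_abs]
      rw [Real.sq_sqrt (sub_pos.2 hs.1).le, Complex.sq_norm, Complex.normSq_add_mul_I]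
      ring
    · simp only [φ, norm_mul, hv.2, Complex.norm_exp_ofReal_mul_I, mul_one]
    · simp only [φ, mul_div_cancel_right₀ _ hc0]
      exact mul_exp_mem_slitPlane hr hs.2.1 hs.2.2.1
    · simp only [φ, mul_div_cancel_right₀ _ he0]
      have := mul_exp_mem_slitPlane one_pos hs.2.2.2.1 hs.2.2.2.2
      rwa [ofReal_one, one_mul] at this
  have hψd : ∀ v ∈ W, DifferentiableAt ℝ ψ v := by
    intro v hvW
    have hd1 : DifferentiableAt ℝ (fun v : ℂ × ℂ × ℂ => v.2.1 / c) v := by fun_prop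
    have hd2 : DifferentiableAt ℝ (fun v : ℂ × ℂ × ℂ => v.2.2 / e₀) v := by fun_prop
    rw [differentiableAt_piLp]
    intro i
    fin_cases i
    · exact Complex.reCLM.differentiableAt.comp v differentiableAt_fst
    · exact Complex.imCLM.differentiableAt.comp v differentiableAt_fst
    · exact (differentiableAt_arg hvW.1).comp v hd1
    · exact (differentiableAt_arg hvW.2).comp v hd2
  refine ⟨U, W, φ, ψ, hU, hWo, ?_, hφ, ?_, ?_, ?_, hψφ⟩
  · constructor
    · have : z₀ / c = (‖z₀‖ : ℝ) := by
        rw [hc]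
        have : (‖z₀‖ : ℂ) ≠ 0 := by exact_mod_cast hz₀.ne'
        field_simp
      change z₀ / c ∈ slitPlane
      rw [this]
      exact ofReal_mem_slitPlane.2 hz₀
    · change e₀ / e₀ ∈ slitPlane
      rw [div_self he0]
      exact one_mem_slitPlane
  · intro s hs
    refine injective_fderiv_of_comp (ψ := ψ)
      ((hφ.contDiffAt (hU.mem_nhds hs)).differentiableAt (by simp)) (hψd _ (hφW s hs).2) ?_
    have : (fun y => ψ (φ y)) =ᶠ[𝓝 s] id := by
      filter_upwards [hU.mem_nhds hs] with y hy
      exact hψφ y hy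
    rw [this.fderiv_eq, fderiv_id]
    exact Function.injective_id
  · apply Set.Subset.antisymm
    · rintro _ ⟨s, hs, rfl⟩
      exact hφW s hs
    · rintro ⟨q, z, e⟩ ⟨⟨h1, h2⟩, h3, h4⟩
      simp only at h1 h2 h3 h4
      have hz0 : z ≠ 0 := by
        rintro rfl
        rw [zero_div] at h3
        exact zero_notMem_slitPlane h3
      have hzn : 0 < ‖z‖ := norm_pos_iff.2 hz0
      have hq : q.re ^ 2 + q.im ^ 2 = ‖q‖ ^ 2 := by
        rw [Complex.sq_norm, Complex.normSq_apply]
        ring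
      obtain ⟨a1, a2⟩ := arg_mem_Ioo_of_mem_slitPlane h3
      obtain ⟨a3, a4⟩ := arg_mem_Ioo_of_mem_slitPlane h4
      refine ⟨!₂[q.re, q.im, arg (z / c), arg (e / e₀)], ⟨?_, a1, a2, a3, a4⟩, ?_⟩
      · change q.re ^ 2 + q.im ^ 2 < 1
        rw [hq]
        nlinarith
      · have hz1 : ‖z / c‖ = ‖z‖ := by rw [norm_div, hc1, div_one]
        have he1 : ‖e / e₀‖ = 1 := by rw [norm_div, h2, hv.2, div_one]
        have k1 : Real.sqrt (1 - (q.re ^ 2 + q.im ^ 2)) = ‖z / c‖ := by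
          rw [hq, hz1, show 1 - ‖q‖ ^ 2 = ‖z‖ ^ 2 by linarith, Real.sqrt_sq hzn.le]
        have k2 : exp (arg (e / e₀) * I) = e / e₀ := by
          have := Complex.norm_mul_exp_arg_mul_I (e / e₀)
          rwa [he1, ofReal_one, one_mul] at this
        change ((q.re : ℂ) + q.im * I, (Real.sqrt (1 - (q.re ^ 2 + q.im ^ 2)) : ℝ) *
          exp (arg (z / c) * I) * c, exp (arg (e / e₀) * I) * e₀) = (q, z, e)
        rw [k1, Complex.norm_mul_exp_arg_mul_I, k2, div_mul_cancel₀ _ hc0, div_mul_cancel₀ _ he0,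
          Complex.re_add_im]
  · exact fun v hvW => (hψd v hvW.2).continuousAt.continuousWithinAt

lemma hasFreeRealParameters_sphereCircle : HasFreeRealParameters 4 sphereCircle := by
  intro v hv
  by_cases hz : v.2.1 = 0
  -- Where z = 0 the first entry has modulus one, so exchanging the two entries of the three-sphere
  -- leads back to the previous chart.
  · let σ : ℂ × ℂ × ℂ → ℂ × ℂ × ℂ := fun v => (v.2.1, v.1, v.2.2)
    have hσ : ContDiff ℝ ∞ σ := by
      refine (contDiff_fst.comp contDiff_snd).prodMk (contDiff_fst.prodMk
        (contDiff_snd.comp contDiff_snd))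
    have hσσ : ∀ v, σ (σ v) = v := fun v => rfl
    have hmem : ∀ v ∈ sphereCircle, σ v ∈ sphereCircle := fun v hv =>
      ⟨by rw [add_comm]; exact hv.1, hv.2⟩
    have himg : σ '' sphereCircle = sphereCircle := by
      apply Set.Subset.antisymm
      · rintro _ ⟨v, hv, rfl⟩
        exact hmem v hv
      · exact fun v hv => ⟨σ v, hmem v hv, hσσ v⟩
    have h1 : HasChart 4 sphereCircle (σ v) := by
      refine hasChart_sphereCircle_of_ne (hmem v hv) fun h => ?_
      have h2 := hv.1
      have h3 : v.1 = 0 := h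
      rw [h3, hz] at h2
      norm_num at h2
    have h2 := h1.image hσ hσ (fun a _ => hσσ a) (hmem v hv)
    rw [himg, hσσ] at h2
    exact h2
  · exact hasChart_sphereCircle_of_ne hv hz

/-! ### Parametrization of the solutions of the four relations -/

section Parametrization

/-- The common value of `|α_k|² + |β_k|²` in terms of `q = α₁* α₂ + β₁* β₂`. -/
noncomputable def polarNorm (g : ℝ) (q : ℂ) : ℝ := Real.sqrt (1 + (g ^ 2 - 1) * ‖q‖ ^ 2) / g

/-- The modulus of `(α₂ + β₂) / √2` for a solution. -/
noncomputable def evenAmplitude (g : ℝ) (q : ℂ) : ℝ :=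
  Real.sqrt ((1 + g * polarNorm g q) * (1 + polarNorm g q) / (2 * (1 + g)))

/-- The ratio of the modulus of `(α₁ - β₁) / √2` and `√(1 - |q|²)` for a solution. -/
noncomputable def oddAmplitude (g : ℝ) (q : ℂ) : ℝ :=
  Real.sqrt ((g + 1) * (1 + g * polarNorm g q) / (2 * g ^ 2 * (1 + polarNorm g q)))

/-- Vectors `(α, β)` from their even and odd parts `x` and `y`. -/
noncomputable def ofParts (x y : Fin 2 → ℂ) : (Fin 2 → ℂ) × (Fin 2 → ℂ) :=
  (fun k => (x k + y k) * (Real.sqrt 2 : ℝ) / 2, fun k => (x k - y k) * (Real.sqrt 2 : ℝ) / 2)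

/-- The parametrization of the solutions by the product of a three-sphere and a circle. -/
noncomputable def solutionOf (g : ℝ) (v : ℂ × ℂ × ℂ) : (Fin 2 → ℂ) × (Fin 2 → ℂ) :=
  ofParts ![(1 + g) * conj v.1 * (evenAmplitude g v.1 * v.2.2) / (1 + g * polarNorm g v.1 : ℝ),
      evenAmplitude g v.1 * v.2.2]
    ![oddAmplitude g v.1 * v.2.1,
      (g - 1) * v.1 * (oddAmplitude g v.1 * v.2.1) / (1 + g * polarNorm g v.1 : ℝ)]

/-- The inverse of `solutionOf`. -/
noncomputable def parameterOf (g : ℝ) (p : (Fin 2 → ℂ) × (Fin 2 → ℂ)) : ℂ × ℂ × ℂ :=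
  (conj (p.1 0) * p.1 1 + conj (p.2 0) * p.2 1,
    (p.1 0 - p.2 0) * (Real.sqrt 2 : ℝ) / 2 /
      (oddAmplitude g (conj (p.1 0) * p.1 1 + conj (p.2 0) * p.2 1) : ℝ),
    (p.1 1 + p.2 1) * (Real.sqrt 2 : ℝ) / 2 /
      (evenAmplitude g (conj (p.1 0) * p.1 1 + conj (p.2 0) * p.2 1) : ℝ))

variable {g : ℝ}

lemma discriminant_pos (hg : 1 < g) (q : ℂ) : 0 < 1 + (g ^ 2 - 1) * ‖q‖ ^ 2 := by
  have : 0 ≤ (g ^ 2 - 1) * ‖q‖ ^ 2 := mul_nonneg (by nlinarith) (sq_nonneg _)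
  linarith

lemma polarNorm_pos (hg : 1 < g) (q : ℂ) : 0 < polarNorm g q :=
  div_pos (Real.sqrt_pos.2 (discriminant_pos hg q)) (by linarith)

lemma polarNorm_sq (hg : 1 < g) (q : ℂ) :
    g ^ 2 * polarNorm g q ^ 2 = 1 + (g ^ 2 - 1) * ‖q‖ ^ 2 := by
  have : g ≠ 0 := by linarith
  rw [polarNorm, div_pow, Real.sq_sqrt (discriminant_pos hg q).le]
  field_simp

lemma evenAmplitude_arg_pos (hg : 1 < g) (q : ℂ) :
    0 < (1 + g * polarNorm g q) * (1 + polarNorm g q) / (2 * (1 + g)) := by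
  have := polarNorm_pos hg q
  positivity

lemma oddAmplitude_arg_pos (hg : 1 < g) (q : ℂ) :
    0 < (g + 1) * (1 + g * polarNorm g q) / (2 * g ^ 2 * (1 + polarNorm g q)) := by
  have := polarNorm_pos hg q
  positivity

lemma evenAmplitude_pos (hg : 1 < g) (q : ℂ) : 0 < evenAmplitude g q :=
  Real.sqrt_pos.2 (evenAmplitude_arg_pos hg q)

lemma oddAmplitude_pos (hg : 1 < g) (q : ℂ) : 0 < oddAmplitude g q :=
  Real.sqrt_pos.2 (oddAmplitude_arg_pos hg q)

lemma evenAmplitude_sq (hg : 1 < g) (q : ℂ) : evenAmplitude g q ^ 2 =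
    (1 + g * polarNorm g q) * (1 + polarNorm g q) / (2 * (1 + g)) :=
  Real.sq_sqrt (evenAmplitude_arg_pos hg q).le

lemma oddAmplitude_sq (hg : 1 < g) (q : ℂ) : oddAmplitude g q ^ 2 =
    (g + 1) * (1 + g * polarNorm g q) / (2 * g ^ 2 * (1 + polarNorm g q)) :=
  Real.sq_sqrt (oddAmplitude_arg_pos hg q).le

lemma contDiff_polarNorm (hg : 1 < g) : ContDiff ℝ ∞ (polarNorm g) := by
  refine ContDiff.div_const (ContDiff.sqrt ?_ fun q => (discriminant_pos hg q).ne') g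
  exact contDiff_const.add (contDiff_const.mul (contDiff_norm_sq ℝ))

lemma contDiff_evenAmplitude (hg : 1 < g) : ContDiff ℝ ∞ (evenAmplitude g) := by
  have h := contDiff_polarNorm hg
  exact ContDiff.sqrt (((contDiff_const.add (contDiff_const.mul h)).mul
    (contDiff_const.add h)).div_const _) fun q => (evenAmplitude_arg_pos hg q).ne'

lemma contDiff_oddAmplitude (hg : 1 < g) : ContDiff ℝ ∞ (oddAmplitude g) := by
  have h := contDiff_polarNorm hg
  refine ContDiff.sqrt (ContDiff.div (contDiff_const.mul (contDiff_const.add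
    (contDiff_const.mul h))) (contDiff_const.mul (contDiff_const.add h)) fun q => ?_)
    fun q => (oddAmplitude_arg_pos hg q).ne'
  have := polarNorm_pos hg q
  positivity

lemma contDiff_conj : ContDiff ℝ ∞ (fun z : ℂ => conj z) := Complex.conjCLE.contDiff

lemma contDiff_div_complex {E : Type*} [NormedAddCommGroup E] [NormedSpace ℝ E] {f h : E → ℂ}
    (hf : ContDiff ℝ ∞ f) (hh : ContDiff ℝ ∞ h) (h0 : ∀ x, h x ≠ 0) :
    ContDiff ℝ ∞ fun x => f x / h x := by
  simp only [div_eq_mul_inv]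
  exact hf.mul (hh.inv h0)

lemma contDiff_solutionOf (hg : 1 < g) : ContDiff ℝ ∞ (solutionOf g) := by
  have h1 : ContDiff ℝ ∞ fun v : ℂ × ℂ × ℂ => v.1 := contDiff_fst
  have h2 : ContDiff ℝ ∞ fun v : ℂ × ℂ × ℂ => v.2.1 := contDiff_fst.comp contDiff_snd
  have h3 : ContDiff ℝ ∞ fun v : ℂ × ℂ × ℂ => v.2.2 := contDiff_snd.comp contDiff_snd
  have hE : ContDiff ℝ ∞ fun v : ℂ × ℂ × ℂ => (evenAmplitude g v.1 : ℂ) :=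
    Complex.ofRealCLM.contDiff.comp ((contDiff_evenAmplitude hg).comp h1)
  have hO : ContDiff ℝ ∞ fun v : ℂ × ℂ × ℂ => (oddAmplitude g v.1 : ℂ) :=
    Complex.ofRealCLM.contDiff.comp ((contDiff_oddAmplitude hg).comp h1)
  have hN : ContDiff ℝ ∞ fun v : ℂ × ℂ × ℂ => ((1 + g * polarNorm g v.1 : ℝ) : ℂ) :=
    Complex.ofRealCLM.contDiff.comp (contDiff_const.add (contDiff_const.mul
      ((contDiff_polarNorm hg).comp h1)))
  have hN0 : ∀ v : ℂ × ℂ × ℂ, ((1 + g * polarNorm g v.1 : ℝ) : ℂ) ≠ 0 := by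
    intro v
    have := polarNorm_pos hg v.1
    exact ofReal_ne_zero.2 (by positivity)
  have hx : ContDiff ℝ ∞ fun v : ℂ × ℂ × ℂ =>
      (1 + g) * conj v.1 * (evenAmplitude g v.1 * v.2.2) / ((1 + g * polarNorm g v.1 : ℝ) : ℂ) :=
    contDiff_div_complex ((contDiff_const.mul (contDiff_conj.comp h1)).mul (hE.mul h3)) hN hN0
  have hy : ContDiff ℝ ∞ fun v : ℂ × ℂ × ℂ =>
      (g - 1) * v.1 * (oddAmplitude g v.1 * v.2.1) / ((1 + g * polarNorm g v.1 : ℝ) : ℂ) :=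
    contDiff_div_complex ((contDiff_const.mul h1).mul (hO.mul h2)) hN hN0
  refine ContDiff.prodMk (contDiff_pi.2 fun k => ?_) (contDiff_pi.2 fun k => ?_)
  · fin_cases k
    · exact ((hx.add (hO.mul h2)).mul contDiff_const).div_const _
    · exact (((hE.mul h3).add hy).mul contDiff_const).div_const _
  · fin_cases k
    · exact ((hx.sub (hO.mul h2)).mul contDiff_const).div_const _
    · exact (((hE.mul h3).sub hy).mul contDiff_const).div_const _

lemma contDiff_parameterOf (hg : 1 < g) : ContDiff ℝ ∞ (parameterOf g) := by
  have ha : ∀ k, ContDiff ℝ ∞ fun p : (Fin 2 → ℂ) × (Fin 2 → ℂ) => p.1 k := fun k =>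
    (contDiff_apply ℝ ℂ k).comp contDiff_fst
  have hb : ∀ k, ContDiff ℝ ∞ fun p : (Fin 2 → ℂ) × (Fin 2 → ℂ) => p.2 k := fun k =>
    (contDiff_apply ℝ ℂ k).comp contDiff_snd
  have hq : ContDiff ℝ ∞ fun p : (Fin 2 → ℂ) × (Fin 2 → ℂ) =>
      conj (p.1 0) * p.1 1 + conj (p.2 0) * p.2 1 :=
    ((contDiff_conj.comp (ha 0)).mul (ha 1)).add ((contDiff_conj.comp (hb 0)).mul (hb 1))
  refine hq.prodMk (ContDiff.prodMk ?_ ?_)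
  · refine contDiff_div_complex ((((ha 0).sub (hb 0)).mul contDiff_const).div_const _)
      (Complex.ofRealCLM.contDiff.comp ((contDiff_oddAmplitude hg).comp hq)) fun p => ?_
    exact ofReal_ne_zero.2 (oddAmplitude_pos hg _).ne'
  · refine contDiff_div_complex ((((ha 1).add (hb 1)).mul contDiff_const).div_const _)
      (Complex.ofRealCLM.contDiff.comp ((contDiff_evenAmplitude hg).comp hq)) fun p => ?_
    exact ofReal_ne_zero.2 (evenAmplitude_pos hg _).ne'

lemma sqrt_two_mul_self : ((Real.sqrt 2 : ℝ) : ℂ) * (Real.sqrt 2 : ℝ) = 2 := by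
  rw [← ofReal_mul, Real.mul_self_sqrt (by norm_num)]
  norm_num

lemma ofParts_overlap (x y : Fin 2 → ℂ) (j k : Fin 2) :
    conj ((ofParts x y).1 j) * (ofParts x y).1 k + conj ((ofParts x y).2 j) * (ofParts x y).2 k =
      conj (x j) * x k + conj (y j) * y k := by
  simp only [ofParts, map_div₀, map_mul, map_add, map_sub, Complex.conj_ofReal, Complex.conj_ofNat]
  linear_combination (conj (x j) * x k + conj (y j) * y k) / 2 * sqrt_two_mul_self

lemma norm_sq_add_norm_sq (a b : ℂ) :
    ((‖a‖ ^ 2 + ‖b‖ ^ 2 : ℝ) : ℂ) = conj a * a + conj b * b := by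
  push_cast
  simp only [Complex.conj_mul']

lemma ofParts_norm (x y : Fin 2 → ℂ) (k : Fin 2) :
    ‖(ofParts x y).1 k‖ ^ 2 + ‖(ofParts x y).2 k‖ ^ 2 = ‖x k‖ ^ 2 + ‖y k‖ ^ 2 := by
  have : ((‖(ofParts x y).1 k‖ ^ 2 + ‖(ofParts x y).2 k‖ ^ 2 : ℝ) : ℂ) =
      ((‖x k‖ ^ 2 + ‖y k‖ ^ 2 : ℝ) : ℂ) := by
    rw [norm_sq_add_norm_sq, norm_sq_add_norm_sq, ofParts_overlap]
  exact_mod_cast this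

/-- The relations in terms of even and odd parts. -/
lemma solutionOf_spec (hg : 1 < g) {v : ℂ × ℂ × ℂ} (hv : v ∈ sphereCircle) :
    ImaginaryRelations g (solutionOf g v).1 (solutionOf g v).2 ∧
      conj ((solutionOf g v).1 0) * (solutionOf g v).1 1
        + conj ((solutionOf g v).2 0) * (solutionOf g v).2 1 = v.1 := by
  obtain ⟨q, z, e⟩ := v
  obtain ⟨hqz, he⟩ := hv
  simp only at hqz he
  have hN0 := polarNorm_pos hg q
  have hN2 := polarNorm_sq hg q
  have hE2 := evenAmplitude_sq hg q
  have hO2 := oddAmplitude_sq hg q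
  have hsol : solutionOf g (q, z, e) = ofParts
    ![(1 + g) * conj q * (evenAmplitude g q * e) / (1 + g * polarNorm g q : ℝ),
      evenAmplitude g q * e]
    ![oddAmplitude g q * z,
      (g - 1) * q * (oddAmplitude g q * z) / (1 + g * polarNorm g q : ℝ)] := rfl
  set n := polarNorm g q with hn
  set ρ := evenAmplitude g q
  set τ := oddAmplitude g q
  set x : Fin 2 → ℂ := ![(1 + g) * conj q * (ρ * e) / (1 + g * n : ℝ), ρ * e] with hx
  set y : Fin 2 → ℂ := ![τ * z, (g - 1) * q * (τ * z) / (1 + g * n : ℝ)] with hy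
  have hgn : 0 < 1 + g * n := by positivity
  have hgnc : ((1 + g * n : ℝ) : ℂ) ≠ 0 := ofReal_ne_zero.2 hgn.ne'
  have hg1 : g - 1 ≠ 0 := by linarith
  have hg2 : 1 + g ≠ 0 := by linarith
  have hQ : ‖q‖ ^ 2 = (g * n - 1) * (g * n + 1) / ((g - 1) * (g + 1)) := by
    rw [eq_div_iff (mul_ne_zero hg1 (by linarith))]
    linear_combination -hN2
  have X2 : ‖x 1‖ ^ 2 = (1 + g * n) * (1 + n) / (2 * (1 + g)) := by
    simp only [hx, Matrix.cons_val_one, Matrix.cons_val_zero, norm_mul, he, mul_one,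
      Complex.norm_real, Real.norm_eq_abs, sq_abs]
    exact hE2
  -- With |z|² = 1 - |q|², a multiple of 1 - n² = (1 - n)(1 + n), the factor 1 - n comes from z.
  -- This is why `oddAmplitude` has no zero and the parametrization stays smooth at |q| = 1.
  have Y1 : ‖y 0‖ ^ 2 = (1 - n) * (1 + g * n) / (2 * (g - 1)) := by
    simp only [hy, Matrix.cons_val_zero, norm_mul, mul_pow, Complex.norm_real, Real.norm_eq_abs,
      sq_abs]
    rw [hO2, show ‖z‖ ^ 2 = 1 - ‖q‖ ^ 2 by linarith, hQ]
    have : 1 + n ≠ 0 := by positivity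
    have : g ≠ 0 := by linarith
    have : g + 1 ≠ 0 := by linarith
    field_simp
    ring
  have X1 : ‖x 0‖ ^ 2 = (g * n - 1) * (1 + n) / (2 * (g - 1)) := by
    have : ‖x 0‖ ^ 2 = (1 + g) ^ 2 * ‖q‖ ^ 2 * ‖x 1‖ ^ 2 / (1 + g * n) ^ 2 := by
      have h1 : x 0 = ((1 + g : ℝ) : ℂ) * conj q * x 1 / (1 + g * n : ℝ) := by
        simp [hx]
      rw [h1]
      simp only [norm_div, norm_mul, div_pow, mul_pow, Complex.norm_real, Real.norm_eq_abs, sq_abs,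
        RCLike.norm_conj]
    rw [this, X2, hQ]
    have : g + 1 ≠ 0 := by linarith
    field_simp
    ring
  have Y2 : ‖y 1‖ ^ 2 = (g * n - 1) * (1 - n) / (2 * (1 + g)) := by
    have : ‖y 1‖ ^ 2 = (g - 1) ^ 2 * ‖q‖ ^ 2 * ‖y 0‖ ^ 2 / (1 + g * n) ^ 2 := by
      have h1 : y 1 = ((g - 1 : ℝ) : ℂ) * q * y 0 / (1 + g * n : ℝ) := by
        simp [hy]
      rw [h1]
      simp only [norm_div, norm_mul, div_pow, mul_pow, Complex.norm_real, Real.norm_eq_abs, sq_abs]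
    rw [this, Y1, hQ]
    have : g + 1 ≠ 0 := by linarith
    field_simp
    ring
  have n1 : ‖x 0‖ ^ 2 + ‖y 0‖ ^ 2 = n := by
    rw [X1, Y1]
    field_simp
    ring
  have n2 : ‖x 1‖ ^ 2 + ‖y 1‖ ^ 2 = n := by
    rw [X2, Y2]
    field_simp
    ring
  have hqq : conj (x 0) * x 1 + conj (y 0) * y 1 = q := by
    have h1 : conj (x 0) * x 1 = q * (((1 + n) / 2 : ℝ) : ℂ) := by
      have h2 : conj (x 0) * x 1 = (1 + g) * q * (conj (x 1) * x 1) / (1 + g * n : ℝ) := by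
        simp [hx]
        ring
      rw [h2, Complex.conj_mul', ← ofReal_pow, X2, div_eq_iff hgnc]
      have : (1 : ℂ) + g ≠ 0 := by exact_mod_cast hg2
      push_cast
      field_simp
    have h3 : conj (y 0) * y 1 = q * (((1 - n) / 2 : ℝ) : ℂ) := by
      have h2 : conj (y 0) * y 1 = (g - 1) * q * (conj (y 0) * y 0) / (1 + g * n : ℝ) := by
        simp [hy]
        ring
      rw [h2, Complex.conj_mul', ← ofReal_pow, Y1, div_eq_iff hgnc]
      have : (g : ℂ) - 1 ≠ 0 := by exact_mod_cast hg1
      push_cast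
      field_simp
    rw [h1, h3]
    push_cast
    ring
  have hQc : conj q * q * ((g - 1) * (g + 1)) = ((g : ℂ) * n - 1) * (g * n + 1) := by
    rw [Complex.conj_mul', ← ofReal_pow]
    have : ‖q‖ ^ 2 * ((g - 1) * (g + 1)) = (g * n - 1) * (g * n + 1) := by
      linear_combination -hN2
    exact_mod_cast this
  -- On even and odd parts σ acts as 1 and -1, so the vector relations decouple. `r1` and `r4` hold
  -- by construction; `r2` and `r3` are equivalent to them because (gn)² - 1 = (g² - 1)|q|².
  have r1 : (1 + (g : ℂ) * n) * x 0 = (1 + g) * conj q * x 1 := by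
    simp only [hx, Matrix.cons_val_zero, Matrix.cons_val_one]
    push_cast at hgnc ⊢
    field_simp
  have r4 : (1 + (g : ℂ) * n) * y 1 = (g - 1) * q * y 0 := by
    simp only [hy, Matrix.cons_val_zero, Matrix.cons_val_one]
    push_cast at hgnc ⊢
    field_simp
  have r2 : ((g : ℂ) * n - 1) * y 0 = (1 + g) * conj q * y 1 := by
    refine mul_left_cancel₀ hgnc ?_
    push_cast
    linear_combination -(y 0) * hQc - (1 + g) * conj q * r4
  have r3 : (1 - (g : ℂ) * n) * x 1 = (1 - g) * q * x 0 := by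
    refine mul_left_cancel₀ hgnc ?_
    push_cast
    linear_combination x 1 * hQc - (1 - g) * q * r1
  rw [hsol, ImaginaryRelations, ofParts_overlap, ofParts_norm, ofParts_norm, hqq, n1, n2]
  refine ⟨⟨rfl, by linear_combination hN2, ?_, ?_⟩, rfl⟩
  · have : (ofParts x y).1 0 * conj ((ofParts x y).1 1) + (ofParts x y).2 0 *
        conj ((ofParts x y).2 1) = conj q := by
      rw [← hqq, ← ofParts_overlap]
      simp
    rw [this]
    simp only [ofParts]
    linear_combination ((Real.sqrt 2 : ℝ) : ℂ) / 2 * (r1 + r2)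
  · simp only [ofParts]
    linear_combination ((Real.sqrt 2 : ℝ) : ℂ) / 2 * (r3 - r4)

lemma parameterOf_solutionOf (hg : 1 < g) {v : ℂ × ℂ × ℂ} (hv : v ∈ sphereCircle) :
    parameterOf g (solutionOf g v) = v := by
  have hq := (solutionOf_spec hg hv).2
  obtain ⟨q, z, e⟩ := v
  have hE : ((evenAmplitude g q : ℝ) : ℂ) ≠ 0 := ofReal_ne_zero.2 (evenAmplitude_pos hg q).ne'
  have hO : ((oddAmplitude g q : ℝ) : ℂ) ≠ 0 := ofReal_ne_zero.2 (oddAmplitude_pos hg q).ne'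
  have hs := sqrt_two_mul_self
  rw [parameterOf, hq]
  simp only [Prod.mk.injEq, true_and]
  constructor
  · rw [div_eq_iff hO]
    simp only [solutionOf, ofParts, Matrix.cons_val_zero]
    linear_combination (oddAmplitude g q * z / 2) * hs
  · rw [div_eq_iff hE]
    simp only [solutionOf, ofParts, Matrix.cons_val_one, Matrix.cons_val_zero]
    linear_combination (evenAmplitude g q * e / 2) * hs

lemma solutionOf_parameterOf (hg : 1 < g) {p : (Fin 2 → ℂ) × (Fin 2 → ℂ)}
    (hp : ImaginaryRelations g p.1 p.2) :
    parameterOf g p ∈ sphereCircle ∧ solutionOf g (parameterOf g p) = p := by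
  obtain ⟨-, s1, s2, s3, s4⟩ := (imaginaryRelations_iff (by nlinarith)).2 hp
  obtain ⟨hn, hT, -, -⟩ := hp
  obtain ⟨α, β⟩ := p
  simp only at s1 s2 s3 s4 hn hT
  set q : ℂ := conj (α 0) * α 1 + conj (β 0) * β 1 with hq
  have hqc : α 0 * conj (α 1) + β 0 * conj (β 1) = conj q := by simp [hq]
  rw [hqc] at s1 s2
  rw [← hn] at s3 s4
  set n : ℝ := ‖α 0‖ ^ 2 + ‖β 0‖ ^ 2 with hn₁
  have hn0 : 0 ≤ n := by positivity
  have hN : polarNorm g q = n := by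
    have h1 : 1 + (g ^ 2 - 1) * ‖q‖ ^ 2 = (g * n) ^ 2 := by linear_combination -hT
    rw [polarNorm, h1, Real.sqrt_sq (by positivity)]
    field_simp
  have hnpos : 0 < n := hN ▸ polarNorm_pos hg q
  have hgn : 0 < 1 + g * n := by positivity
  have hgnc : ((1 + g * n : ℝ) : ℂ) ≠ 0 := ofReal_ne_zero.2 hgn.ne'
  have hs := sqrt_two_mul_self
  set x : Fin 2 → ℂ := fun k => (α k + β k) * (Real.sqrt 2 : ℝ) / 2 with hx
  set y : Fin 2 → ℂ := fun k => (α k - β k) * (Real.sqrt 2 : ℝ) / 2 with hy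
  have hxy : ofParts x y = (α, β) := by
    rw [ofParts, Prod.mk.injEq]
    constructor
    · ext k
      simp only [hx, hy]
      linear_combination (α k / 2) * hs
    · ext k
      simp only [hx, hy]
      linear_combination (β k / 2) * hs
  have n1 : ‖x 0‖ ^ 2 + ‖y 0‖ ^ 2 = n := by
    rw [← ofParts_norm, hxy]
  have n2 : ‖x 1‖ ^ 2 + ‖y 1‖ ^ 2 = n := by
    rw [← ofParts_norm, hxy]
    exact hn.symm
  have r1 : (1 + (g : ℂ) * n) * x 0 = (1 + g) * conj q * x 1 := by
    simp only [hx]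
    linear_combination ((Real.sqrt 2 : ℝ) : ℂ) / 2 * (s1 + s2)
  have r4 : (1 + (g : ℂ) * n) * y 1 = (g - 1) * q * y 0 := by
    simp only [hy]
    linear_combination ((Real.sqrt 2 : ℝ) : ℂ) / 2 * (s4 - s3)
  have X1 : (1 + g * n) ^ 2 * ‖x 0‖ ^ 2 = (1 + g) ^ 2 * ‖q‖ ^ 2 * ‖x 1‖ ^ 2 := by
    have h : ((1 + g * n : ℝ) : ℂ) * x 0 = ((1 + g : ℝ) : ℂ) * conj q * x 1 := by
      push_cast
      exact r1
    have h' := congrArg (fun w : ℂ => ‖w‖ ^ 2) h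
    simpa only [norm_mul, mul_pow, Complex.norm_real, Real.norm_eq_abs, sq_abs,
      RCLike.norm_conj] using h'
  have Y2 : (1 + g * n) ^ 2 * ‖y 1‖ ^ 2 = (g - 1) ^ 2 * ‖q‖ ^ 2 * ‖y 0‖ ^ 2 := by
    have h : ((1 + g * n : ℝ) : ℂ) * y 1 = ((g - 1 : ℝ) : ℂ) * q * y 0 := by
      push_cast
      exact r4
    have h' := congrArg (fun w : ℂ => ‖w‖ ^ 2) h
    simpa only [norm_mul, mul_pow, Complex.norm_real, Real.norm_eq_abs, sq_abs] using h'
  have hQ : (g ^ 2 - 1) * ‖q‖ ^ 2 = (g * n - 1) * (g * n + 1) := by linear_combination -hT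
  have X1' : (g - 1) * (1 + g * n) * ‖x 0‖ ^ 2 = (1 + g) * (g * n - 1) * ‖x 1‖ ^ 2 := by
    refine mul_left_cancel₀ hgn.ne' ?_
    linear_combination (g - 1) * X1 + (1 + g) * ‖x 1‖ ^ 2 * hQ
  have Y2' : (g + 1) * (1 + g * n) * ‖y 1‖ ^ 2 = (g - 1) * (g * n - 1) * ‖y 0‖ ^ 2 := by
    refine mul_left_cancel₀ hgn.ne' ?_
    linear_combination (g + 1) * Y2 + (g - 1) * ‖y 0‖ ^ 2 * hQ
  -- The relations and |x_k|² + |y_k|² = n form a linear system for (g+1)|x₁|² and (g-1)|y₀|², of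
  -- determinant (1+gn)² - (gn-1)² = 4gn.
  have hgn4 : 4 * g * n ≠ 0 := by positivity
  have X2 : (g + 1) * ‖x 1‖ ^ 2 = (1 + g * n) * (1 + n) / 2 := by
    refine mul_left_cancel₀ hgn4 ?_
    linear_combination (g * n - 1) * X1' - (1 + g * n) * Y2' + (g + 1) * (1 + g * n) ^ 2 * n2
      - (g * n - 1) * (g - 1) * (1 + g * n) * n1
  have Y1 : (g - 1) * ‖y 0‖ ^ 2 = (1 + g * n) * (1 - n) / 2 := by
    refine mul_left_cancel₀ hgn4 ?_
    linear_combination (g * n - 1) * Y2' - (1 + g * n) * X1' + (g - 1) * (1 + g * n) ^ 2 * n1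
      - (g * n - 1) * (g + 1) * (1 + g * n) * n2
  have hE0 := evenAmplitude_pos hg q
  have hO0 := oddAmplitude_pos hg q
  have hE2 := evenAmplitude_sq hg q
  have hO2 := oddAmplitude_sq hg q
  have hpar : parameterOf g (α, β) =
      (q, y 0 / (oddAmplitude g q : ℝ), x 1 / (evenAmplitude g q : ℝ)) := rfl
  have hEc : ((evenAmplitude g q : ℝ) : ℂ) ≠ 0 := ofReal_ne_zero.2 hE0.ne'
  have hOc : ((oddAmplitude g q : ℝ) : ℂ) ≠ 0 := ofReal_ne_zero.2 hO0.ne'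
  rw [hpar]
  refine ⟨⟨?_, ?_⟩, ?_⟩
  · have h1 : ‖y 0 / (oddAmplitude g q : ℝ)‖ ^ 2 = ‖y 0‖ ^ 2 / oddAmplitude g q ^ 2 := by
      rw [norm_div, div_pow, Complex.norm_real, Real.norm_eq_abs, sq_abs]
    have h2 : ‖q‖ ^ 2 = (g * n - 1) * (g * n + 1) / (g ^ 2 - 1) := by
      rw [eq_div_iff (by nlinarith)]
      linear_combination hQ
    have h3 : ‖y 0‖ ^ 2 = (1 + g * n) * (1 - n) / 2 / (g - 1) := by
      rw [eq_div_iff (by linarith)]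
      linear_combination Y1
    simp only [h1]
    rw [hO2, hN, h2, h3]
    have e1 : g - 1 ≠ 0 := by linarith
    have e2 : g + 1 ≠ 0 := by linarith
    have e3 : 1 + n ≠ 0 := by linarith
    have e4 : g ≠ 0 := by linarith
    rw [show g ^ 2 - 1 = (g - 1) * (g + 1) by ring]
    field_simp
    ring
  · have h1 : ‖x 1‖ ^ 2 = evenAmplitude g q ^ 2 := by
      rw [hE2, hN, eq_div_iff (by linarith)]
      linear_combination 2 * X2
    have h2 : ‖x 1‖ = evenAmplitude g q := (pow_left_inj₀ (norm_nonneg _) hE0.le two_ne_zero).1 h1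
    simp only [norm_div, h2, Complex.norm_real, Real.norm_eq_abs, abs_of_pos hE0, div_self hE0.ne']
  · rw [← hxy, solutionOf]
    simp only [mul_div_cancel₀ _ hEc, mul_div_cancel₀ _ hOc, hN]
    congr 1
    · ext k
      fin_cases k
      · simp only [Fin.zero_eta, Matrix.cons_val_zero]
        rw [div_eq_iff hgnc]
        push_cast
        linear_combination -r1
      · rfl
    · ext k
      fin_cases k
      · rfl
      · simp only [Fin.mk_one, Matrix.cons_val_one, Matrix.cons_val_zero]
        rw [div_eq_iff hgnc]
        push_cast
        linear_combination -r4

lemma image_solutionOf (hg : 1 < g) : solutionOf g '' sphereCircle = imaginarySolutions g := by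
  apply Set.Subset.antisymm
  · rintro _ ⟨v, hv, rfl⟩
    exact (solutionOf_spec hg hv).1
  · intro p hp
    exact ⟨_, solutionOf_parameterOf hg hp⟩

/-- Exchange of the two solitons. -/
def swapSolitons (p : (Fin 2 → ℂ) × (Fin 2 → ℂ)) : (Fin 2 → ℂ) × (Fin 2 → ℂ) :=
  (![p.1 1, p.1 0], ![p.2 1, p.2 0])

lemma swapSolitons_swapSolitons (p : (Fin 2 → ℂ) × (Fin 2 → ℂ)) :
    swapSolitons (swapSolitons p) = p := by
  apply Prod.ext <;> ext k <;> fin_cases k <;> rfl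

lemma contDiff_swapSolitons : ContDiff ℝ ∞ swapSolitons := by
  have ha : ∀ k, ContDiff ℝ ∞ fun p : (Fin 2 → ℂ) × (Fin 2 → ℂ) => p.1 k := fun k =>
    (contDiff_apply ℝ ℂ k).comp contDiff_fst
  have hb : ∀ k, ContDiff ℝ ∞ fun p : (Fin 2 → ℂ) × (Fin 2 → ℂ) => p.2 k := fun k =>
    (contDiff_apply ℝ ℂ k).comp contDiff_snd
  refine ContDiff.prodMk (contDiff_pi.2 fun k => ?_) (contDiff_pi.2 fun k => ?_)
  · fin_cases k
    · exact ha 1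
    · exact ha 0
  · fin_cases k
    · exact hb 1
    · exact hb 0

/-- Exchanging the solitons changes the sign of g and conjugates q, which reduces g < -1 to g > 1.
-/
lemma ImaginaryRelations.swap {α β : Fin 2 → ℂ} (h : ImaginaryRelations g α β) :
    ImaginaryRelations (-g) (swapSolitons (α, β)).1 (swapSolitons (α, β)).2 := by
  obtain ⟨h1, h2, h3, h4⟩ := h
  simp only [ImaginaryRelations, swapSolitons, Matrix.cons_val_zero, Matrix.cons_val_one]
  refine ⟨h1.symm, ?_, ?_, ?_⟩
  · have h5 : conj (α 1) * α 0 + conj (β 1) * β 0 =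
        conj (conj (α 0) * α 1 + conj (β 0) * β 1) := by
      simp only [map_add, map_mul, Complex.conj_conj]
      ring
    rw [h5, RCLike.norm_conj, ← h1]
    linear_combination h2
  · refine h4.trans ?_
    push_cast
    ring
  · refine h3.trans ?_
    push_cast
    ring

lemma image_swapSolitons : swapSolitons '' imaginarySolutions (-g) = imaginarySolutions g := by
  apply Set.Subset.antisymm
  · rintro _ ⟨p, hp, rfl⟩
    have := ImaginaryRelations.swap hp
    rwa [neg_neg] at this
  · intro p hp
    exact ⟨swapSolitons p, ImaginaryRelations.swap hp, swapSolitons_swapSolitons p⟩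

/-- For g > 1 the set is the image of S³ × S¹ under `solutionOf`, and `parameterOf` is a left
inverse there that is smooth on the whole ambient space. -/
theorem hasFreeRealParameters_imaginarySolutions (hg : 1 < g ^ 2) :
    HasFreeRealParameters 4 (imaginarySolutions g) := by
  have key : ∀ {g : ℝ}, 1 < g → HasFreeRealParameters 4 (imaginarySolutions g) := by
    intro g hg
    rw [← image_solutionOf hg]
    rintro _ ⟨v, hv, rfl⟩
    exact HasChart.image (contDiff_solutionOf hg) (contDiff_parameterOf hg)
      (fun v hv => parameterOf_solutionOf hg hv) hv (hasFreeRealParameters_sphereCircle v hv)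
  rcases lt_or_ge 1 g with h | h
  · exact key h
  · have h' : 1 < -g := by nlinarith
    rw [← image_swapSolitons]
    rintro _ ⟨p, hp, rfl⟩
    exact HasChart.image contDiff_swapSolitons contDiff_swapSolitons
      (fun p _ => swapSolitons_swapSolitons p) hp (key h' p hp)

/-- Cauchy–Schwarz gives |q| ≤ n, and g²n² = 1 + (g² - 1)|q|² then forces |q| ≤ 1. Conversely, any
such q is completed to a point of S³ × S¹ by z = √(1 - |q|²) and phase 1. -/
theorem exists_imaginaryRelations_iff (hg : 1 < g ^ 2) (q : ℂ) :
    (∃ α β : Fin 2 → ℂ, ImaginaryRelations g α β ∧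
      conj (α 0) * α 1 + conj (β 0) * β 1 = q) ↔ ‖q‖ ≤ 1 := by
  constructor
  · rintro ⟨α, β, ⟨hn, hT, -, -⟩, rfl⟩
    set q := conj (α 0) * α 1 + conj (β 0) * β 1 with hq
    have hcs : ‖q‖ ^ 2 ≤ (‖α 0‖ ^ 2 + ‖β 0‖ ^ 2) * (‖α 1‖ ^ 2 + ‖β 1‖ ^ 2) := by
      have h : (‖α 0‖ ^ 2 + ‖β 0‖ ^ 2) * (‖α 1‖ ^ 2 + ‖β 1‖ ^ 2) - ‖q‖ ^ 2 =
          ‖α 0 * β 1 - β 0 * α 1‖ ^ 2 := by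
        simp only [hq, Complex.sq_norm, Complex.normSq_apply, add_re, add_im, sub_re, sub_im,
          mul_re, mul_im, conj_re, conj_im]
        ring
      nlinarith [sq_nonneg ‖α 0 * β 1 - β 0 * α 1‖]
    rw [← hn] at hcs
    have h1 : ‖q‖ ^ 2 ≤ 1 := by nlinarith
    nlinarith [norm_nonneg q]
  · have key : ∀ {g : ℝ}, 1 < g → ∀ q : ℂ, ‖q‖ ≤ 1 → ∃ α β : Fin 2 → ℂ,
        ImaginaryRelations g α β ∧ conj (α 0) * α 1 + conj (β 0) * β 1 = q := by
      intro g hg q hq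
      have hv : (q, ((Real.sqrt (1 - ‖q‖ ^ 2) : ℝ) : ℂ), (1 : ℂ)) ∈ sphereCircle := by
        refine ⟨?_, norm_one⟩
        simp only [Complex.norm_real, Real.norm_eq_abs, sq_abs]
        rw [Real.sq_sqrt (by nlinarith [norm_nonneg q])]
        ring
      exact ⟨_, _, solutionOf_spec hg hv⟩
    intro hq
    rcases lt_or_ge 1 g with h | h
    · exact key h q hq
    · have h' : 1 < -g := by nlinarith
      obtain ⟨α, β, hr, hαβ⟩ := key h' (conj q) (by rwa [RCLike.norm_conj])
      refine ⟨_, _, by simpa using hr.swap, ?_⟩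
      have := congrArg conj hαβ
      simp only [map_add, map_mul, Complex.conj_conj] at this
      simp only [swapSolitons, Matrix.cons_val_zero, Matrix.cons_val_one]
      linear_combination this

end Parametrization

/-! ### Jost solutions -/

open Set in
theorem hasDerivAt_integral_Ioi {E : Type*} [NormedAddCommGroup E] [NormedSpace ℝ E]
    [CompleteSpace E] {h : ℝ → E} (hc : Continuous h) (hi : ∀ x, IntegrableOn h (Ioi x)) (x : ℝ) :
    HasDerivAt (fun x => ∫ y in Ioi x, h y) (-h x) x := by
  have h1 : HasDerivAt (fun u => ∫ y in x..u, h y) (h x) x :=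
    intervalIntegral.integral_hasDerivAt_right (hc.intervalIntegrable _ _)
      (hc.stronglyMeasurableAtFilter _ _) hc.continuousAt
  refine (h1.const_sub (∫ y in Ioi x, h y)).congr_of_eventuallyEq (.of_forall fun u => ?_)
  simp only
  rw [← intervalIntegral.integral_Ioi_sub_Ioi' (hi x) (hi u)]
  abel

/-- The solution of `F' = a F - f` which vanishes at `+∞`, for integrable `f` and `0 ≤ Re a`. -/
noncomputable def expTail (a : ℂ) (f : ℝ → ℂ) (x : ℝ) : ℂ :=
  exp (a * x) * ∫ y in Set.Ioi x, exp (-(a * y)) * f y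

section expTail
open Set
variable {a : ℂ} {f g : ℝ → ℂ}

theorem norm_exp_neg_mul_le (ha : 0 ≤ a.re) {x y : ℝ} (h : x ≤ y) :
    ‖exp (-(a * y))‖ ≤ Real.exp (-(a.re * x)) := by
  rw [norm_exp]
  simp only [neg_re, mul_re, ofReal_re, ofReal_im, mul_zero, sub_zero]
  gcongr

theorem integrableOn_exp_neg_mul (ha : 0 ≤ a.re) (hi : Integrable f) (x : ℝ) :
    IntegrableOn (fun y : ℝ => exp (-(a * y)) * f y) (Ioi x) := by
  refine (hi.integrableOn (s := Ioi x)).bdd_mul (c := Real.exp (-(a.re * x)))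
    (Continuous.aestronglyMeasurable (by fun_prop)) ?_
  filter_upwards [ae_restrict_mem measurableSet_Ioi] with y hy
  exact norm_exp_neg_mul_le ha (le_of_lt hy)

theorem hasDerivAt_expTail (ha : 0 ≤ a.re) (hc : Continuous f) (hi : Integrable f) (x : ℝ) :
    HasDerivAt (expTail a f) (a * expTail a f x - f x) x := by
  have h1 : HasDerivAt (fun x : ℝ => exp (a * x)) (exp (a * x) * (a * 1)) x :=
    (((hasDerivAt_id x).ofReal_comp).const_mul a).cexp
  have h2 := hasDerivAt_integral_Ioi (h := fun y : ℝ => exp (-(a * y)) * f y)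
    (by fun_prop) (integrableOn_exp_neg_mul ha hi) x
  have : exp (a * x) * exp (-(a * x)) = 1 := by rw [← exp_add]; simp
  refine (h1.mul h2).congr_deriv ?_
  unfold expTail
  linear_combination -f x * this

theorem norm_expTail_le (ha : 0 ≤ a.re) (hi : Integrable f) (x : ℝ) :
    ‖expTail a f x‖ ≤ ∫ y in Ioi x, ‖f y‖ := by
  have h1 : ‖∫ y in Ioi x, exp (-(a * y)) * f y‖ ≤
      ∫ y in Ioi x, Real.exp (-(a.re * x)) * ‖f y‖ := by
    refine norm_integral_le_of_norm_le (hi.norm.integrableOn.const_mul _) ?_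
    filter_upwards [ae_restrict_mem measurableSet_Ioi] with y hy
    rw [norm_mul]
    exact mul_le_mul_of_nonneg_right (norm_exp_neg_mul_le ha (le_of_lt hy)) (norm_nonneg _)
  rw [expTail, norm_mul]
  refine (mul_le_mul_of_nonneg_left h1 (norm_nonneg _)).trans_eq ?_
  rw [integral_const_mul, ← mul_assoc, norm_exp, ← Real.exp_add]
  simp

theorem expTail_sub (ha : 0 ≤ a.re) (hfi : Integrable f) (hgi : Integrable g) (x : ℝ) :
    expTail a f x - expTail a g x = expTail a (fun y => f y - g y) x := by
  simp only [expTail, mul_sub]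
  rw [integral_sub (integrableOn_exp_neg_mul ha hfi x) (integrableOn_exp_neg_mul ha hgi x)]
  ring

theorem tendsto_expTail (ha : 0 ≤ a.re) (hi : Integrable f) :
    Tendsto (expTail a f) atTop (𝓝 0) :=
  squeeze_zero_norm (norm_expTail_le ha hi) (tendsto_integral_Ioi_zero tendsto_id)

end expTail

section weight
open Set
variable {b : ℝ → ℝ}

/-- The integrand is an exact derivative. The denominator 2 becomes the contraction constant 1/2 in
the weighted norm with weight exp(-2∫ₓ^∞ b). -/
theorem integral_mul_exp_two_tail (hc : Continuous b) (hi : Integrable b) (h0 : ∀ x, 0 ≤ b x)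
    (x : ℝ) :
    ∫ y in Ioi x, b y * Real.exp (2 * ∫ z in Ioi y, b z) =
      (Real.exp (2 * ∫ z in Ioi x, b z) - 1) / 2 := by
  have hd : ∀ y, HasDerivAt (fun y => -(Real.exp (2 * ∫ z in Ioi y, b z)) / 2)
      (b y * Real.exp (2 * ∫ z in Ioi y, b z)) y := fun y => by
    have := ((((hasDerivAt_integral_Ioi hc (fun x => hi.integrableOn) y).const_mul 2).exp).neg
      ).div_const 2
    refine this.congr_deriv ?_
    ring
  have ht : Tendsto (fun y => -(Real.exp (2 * ∫ z in Ioi y, b z)) / 2) atTop (𝓝 (-1 / 2)) := by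
    have := tendsto_integral_Ioi_zero (f := b) (μ := volume) (tendsto_id (α := ℝ) (x := atTop))
    have h2 := ((((this.const_mul 2).rexp).neg).div_const 2)
    simpa using h2
  rw [integral_Ioi_of_hasDerivAt_of_nonneg' (fun y _ => hd y)
    (fun y _ => mul_nonneg (h0 y) (Real.exp_pos _).le) ht]
  ring

end weight

/-- Solutions, bounded on the whole line, of `W' = a W + B W` with prescribed limit at `+∞`. -/
theorem exists_bounded_solution {ι : Type*} [Fintype ι] {a c : ι → ℂ} (ha : ∀ i, 0 ≤ (a i).re)
    (hac : ∀ i, a i * c i = 0) {B : ℝ → Matrix ι ι ℂ} (hB : ∀ i j, Continuous fun x => B x i j)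
    (hBi : ∀ i j, Integrable fun x => B x i j) :
    ∃ W : ℝ → ι → ℂ, (∃ C, ∀ x, ‖W x‖ ≤ C) ∧ Tendsto W atTop (𝓝 c) ∧
      ∀ x, HasDerivAt W (fun i => a i * W x i + (B x *ᵥ W x) i) x := by
  classical
  let b : ℝ → ℝ := fun x => ∑ i, ∑ j, ‖B x i j‖
  have hbc : Continuous b :=
    continuous_finsetSum _ fun i _ => continuous_finsetSum _ fun j _ => (hB i j).norm
  have hbi : Integrable b :=
    integrable_finsetSum _ fun i _ => integrable_finsetSum _ fun j _ => (hBi i j).norm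
  have hb0 : ∀ x, 0 ≤ b x := fun x =>
    Finset.sum_nonneg fun i _ => Finset.sum_nonneg fun j _ => norm_nonneg _
  have hbv : ∀ x (v : ι → ℂ) i, ‖(B x *ᵥ v) i‖ ≤ b x * ‖v‖ := fun x v i => by
    calc ‖(B x *ᵥ v) i‖ ≤ ∑ j, ‖B x i j * v j‖ := norm_sum_le _ _
      _ ≤ ∑ j, ‖B x i j‖ * ‖v‖ := Finset.sum_le_sum fun j _ => by
          rw [norm_mul]; gcongr; exact norm_le_pi_norm v j
      _ = (∑ j, ‖B x i j‖) * ‖v‖ := by rw [Finset.sum_mul]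
      _ ≤ b x * ‖v‖ := by
          gcongr
          exact Finset.single_le_sum (f := fun i => ∑ j, ‖B x i j‖)
            (fun i _ => Finset.sum_nonneg fun j _ => norm_nonneg _) (Finset.mem_univ i)
  let p : ℝ → ℝ := fun x => ∫ y in Set.Ioi x, b y
  have hpc : Continuous p := continuous_iff_continuousAt.2 fun x =>
    (hasDerivAt_integral_Ioi hbc (fun x => hbi.integrableOn) x).continuousAt
  have hp0 : ∀ x, 0 ≤ p x := fun x => integral_nonneg hb0
  have hpP : ∀ x, p x ≤ ∫ y, b y := fun x => setIntegral_le_integral hbi (.of_forall hb0)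
  set P : ℝ := ∫ y, b y
  -- the inhomogeneity belonging to a bounded function
  let f : (BoundedContinuousFunction ℝ (ι → ℂ)) → ι → ℝ → ℂ := fun V i y =>
    Real.exp (2 * p y) * (B y *ᵥ V y) i
  have hfc : ∀ V i, Continuous (f V i) := fun V i => by
    have : Continuous fun y => (B y *ᵥ V y) i :=
      continuous_finsetSum _ fun j _ => (hB i j).mul ((continuous_apply j).comp V.continuous)
    fun_prop
  have hfn : ∀ V i y, ‖f V i y‖ ≤ b y * Real.exp (2 * p y) * ‖V‖ := fun V i y => by
    rw [norm_mul, norm_real, Real.norm_of_nonneg (Real.exp_pos _).le]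
    calc _ ≤ Real.exp (2 * p y) * (b y * ‖V‖) := by
          gcongr
          exact (hbv y _ i).trans (mul_le_mul_of_nonneg_left (V.norm_coe_le_norm y) (hb0 y))
      _ = _ := by ring
  have hwi : Integrable fun y => b y * Real.exp (2 * p y) := by
    refine hbi.mul_bdd (c := Real.exp (2 * P)) (Continuous.aestronglyMeasurable (by fun_prop)) ?_
    refine .of_forall fun y => ?_
    rw [Real.norm_of_nonneg (Real.exp_pos _).le]
    gcongr
    exact hpP y
  have hfi : ∀ V i, Integrable (f V i) := fun V i =>
    (hwi.mul_const ‖V‖).mono' (hfc V i).aestronglyMeasurable (.of_forall (hfn V i))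
  have hF : ∀ V i x, ‖expTail (a i) (f V i) x‖ ≤ (Real.exp (2 * p x) - 1) / 2 * ‖V‖ :=
    fun V i x => by
      refine (norm_expTail_le (ha i) (hfi V i) x).trans ?_
      rw [← integral_mul_exp_two_tail hbc hbi hb0 x, ← integral_mul_const]
      exact integral_mono (hfi V i).norm.integrableOn (hwi.mul_const _).integrableOn (hfn V i)
  have hFc : ∀ V i, Continuous (expTail (a i) (f V i)) := fun V i =>
    continuous_iff_continuousAt.2 fun x =>
      (hasDerivAt_expTail (ha i) (hfc V i) (hfi V i) x).continuousAt
  have hFw : ∀ V i x, ‖(Real.exp (-(2 * p x)) : ℂ) * expTail (a i) (f V i) x‖ ≤ 1 / 2 * ‖V‖ :=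
    fun V i x => by
      rw [norm_mul, norm_real, Real.norm_of_nonneg (Real.exp_pos _).le]
      calc _ ≤ Real.exp (-(2 * p x)) * ((Real.exp (2 * p x) - 1) / 2 * ‖V‖) := by
            gcongr; exact hF V i x
        _ = (1 - Real.exp (-(2 * p x))) * (1 / 2 * ‖V‖) := by
            have : Real.exp (-(2 * p x)) * Real.exp (2 * p x) = 1 := by
              rw [← Real.exp_add]; simp
            linear_combination (‖V‖ / 2) * this
        _ ≤ 1 * (1 / 2 * ‖V‖) := by
            gcongr
            linarith [Real.exp_pos (-(2 * p x))]
        _ = _ := one_mul _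
  -- The integral equation W = c - `expTail`, written for V = exp(-2p)W. The plain supremum norm of
  -- V is the weighted norm of W, so no smallness of B is needed.
  let T : BoundedContinuousFunction ℝ (ι → ℂ) → BoundedContinuousFunction ℝ (ι → ℂ) := fun V =>
    BoundedContinuousFunction.ofNormedAddCommGroup
      (fun x i => (Real.exp (-(2 * p x)) : ℂ) * c i
        - (Real.exp (-(2 * p x)) : ℂ) * expTail (a i) (f V i) x)
      (continuous_pi fun i => by have := hFc V i; fun_prop) (‖c‖ + 1 / 2 * ‖V‖) (fun x => by
        refine (pi_norm_le_iff_of_nonneg (by positivity)).2 fun i => ?_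
        refine (norm_sub_le _ _).trans (add_le_add ?_ (hFw V i x))
        rw [norm_mul, norm_real, Real.norm_of_nonneg (Real.exp_pos _).le]
        calc _ ≤ 1 * ‖c‖ := by
              gcongr
              · rw [Real.exp_le_one_iff]; linarith [hp0 x]
              · exact norm_le_pi_norm c i
          _ = _ := one_mul _)
  have hT : ContractingWith (1 / 2 : NNReal) T := by
    refine ⟨by norm_num, LipschitzWith.of_dist_le_mul fun U V => ?_⟩
    rw [BoundedContinuousFunction.dist_le (by positivity)]
    intro x
    refine (dist_pi_le_iff (by positivity)).2 fun i => ?_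
    have h1 : T U x i - T V x i
        = (Real.exp (-(2 * p x)) : ℂ) * expTail (a i) (f (V - U) i) x := by
      have : f (V - U) i = fun y => f V i y - f U i y := by
        funext y
        simp only [f, BoundedContinuousFunction.coe_sub, Pi.sub_apply, mulVec_sub]
        ring
      rw [this, ← expTail_sub (ha i) (hfi V i) (hfi U i)]
      simp only [T, BoundedContinuousFunction.coe_ofNormedAddCommGroup]
      ring
    rw [dist_eq_norm, h1]
    refine (hFw _ i x).trans_eq ?_
    rw [dist_comm, dist_eq_norm]
    simp
  obtain ⟨V, hV⟩ : ∃ V, T V = V := ⟨hT.fixedPoint, hT.fixedPoint_isFixedPt⟩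
  let W : ℝ → ι → ℂ := fun x i => c i - expTail (a i) (f V i) x
  have hVW : ∀ x i, (Real.exp (2 * p x) : ℂ) * V x i = W x i := fun x i => by
    have h1 : T V x i = V x i := by rw [hV]
    have h2 : (Real.exp (2 * p x) : ℂ) * (Real.exp (-(2 * p x)) : ℂ) = 1 := by
      rw [← ofReal_mul, ← Real.exp_add]; simp
    rw [← h1]
    simp only [T, W, BoundedContinuousFunction.coe_ofNormedAddCommGroup]
    linear_combination (c i - expTail (a i) (f V i) x) * h2
  have hf : ∀ i x, f V i x = (B x *ᵥ W x) i := fun i x => by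
    have : W x = (Real.exp (2 * p x) : ℂ) • V x := by
      funext j; simp only [Pi.smul_apply, smul_eq_mul, hVW]
    rw [this, mulVec_smul]
    rfl
  refine ⟨W, ⟨Real.exp (2 * P) * ‖V‖, fun x => ?_⟩, ?_, fun x => ?_⟩
  · refine (pi_norm_le_iff_of_nonneg (by positivity)).2 fun i => ?_
    rw [← hVW, norm_mul, norm_real, Real.norm_of_nonneg (Real.exp_pos _).le]
    gcongr
    · exact hpP x
    · exact (norm_le_pi_norm _ i).trans (V.norm_coe_le_norm x)
  · refine tendsto_pi_nhds.2 fun i => ?_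
    simpa using (tendsto_expTail (ha i) (hfi V i)).const_sub (c i)
  · refine hasDerivAt_pi.2 fun i => ?_
    refine ((hasDerivAt_expTail (ha i) (hfc V i) (hfi V i) x).const_sub (c i)).congr_deriv ?_
    rw [hf i x]
    simp only [W]
    -- The condition a_i c_i = 0 makes the constant c a solution of the equation without B.
    linear_combination -hac i

/-! ### Solutions of the scattering problem -/

/-- `Y` solves the scattering problem. -/
def IsScatteringSolution (q : ℝ → ℂ) (ζ : ℂ) (Y : ℝ → Fin 3 → ℂ) : Prop :=
  ∀ x, HasDerivAt Y (((-(I * ζ)) • J + Q q x) *ᵥ Y x) x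

theorem isScatteringSolution_iff {q : ℝ → ℂ} {ζ : ℂ} {Y : ℝ → Fin 3 → ℂ} :
    IsScatteringSolution q ζ Y ↔ ∀ x,
      HasDerivAt (fun x => Y x 0) (-(I * ζ) * Y x 0 + q x * Y x 2) x ∧
      HasDerivAt (fun x => Y x 1) (-(I * ζ) * Y x 1 + q (-x) * Y x 2) x ∧
      HasDerivAt (fun x => Y x 2)
        (I * ζ * Y x 2 - conj (q x) * Y x 0 - conj (q (-x)) * Y x 1) x := by
  refine forall_congr' fun x => ?_
  rw [hasDerivAt_pi, Fin.forall_fin_succ, Fin.forall_fin_succ, Fin.forall_fin_succ]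
  have : ∀ a b c : ℂ, a + b + c = c + a + b := fun a b c => by ring
  simp [J, Q, Matrix.mulVec, dotProduct, Fin.sum_univ_three, sub_eq_add_neg,
    this (-(conj (q x) * Y x 0))]

theorem norm_le_norm_of_reflect (v : Fin 3 → ℂ) : ‖(![v 1, v 0, -v 2] : Fin 3 → ℂ)‖ ≤ ‖v‖ := by
  refine (pi_norm_le_iff_of_nonneg (norm_nonneg _)).2 fun i => ?_
  fin_cases i
  · exact norm_le_pi_norm v 1
  · exact norm_le_pi_norm v 0
  · simpa using norm_le_pi_norm v 2

/-- The reflection `x ↦ -x` of a vector function, adapted to the scattering problem. -/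
def reflect (Y : ℝ → Fin 3 → ℂ) (x : ℝ) : Fin 3 → ℂ := ![Y (-x) 1, Y (-x) 0, -Y (-x) 2]

theorem norm_reflect (Y : ℝ → Fin 3 → ℂ) (x : ℝ) : ‖reflect Y x‖ = ‖Y (-x)‖ := by
  refine le_antisymm (norm_le_norm_of_reflect _) ?_
  have h : Y (-x) = ![reflect Y x 1, reflect Y x 0, -reflect Y x 2] := by
    funext i
    fin_cases i <;> simp [reflect]
  exact h ▸ norm_le_norm_of_reflect (reflect Y x)

theorem integrableOn_comp_neg {f : ℝ → ℝ} {s : Set ℝ} (h : IntegrableOn f s) :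
    IntegrableOn (fun x => f (-x)) (-s) :=
  ((Measure.measurePreserving_neg (volume : Measure ℝ)).integrableOn_comp_preimage
    (MeasurableEquiv.neg ℝ).measurableEmbedding).2 h

namespace IsScatteringSolution

variable {q : ℝ → ℂ} {ζ w : ℂ} {Y Z : ℝ → Fin 3 → ℂ}

theorem continuous (h : IsScatteringSolution q ζ Y) : Continuous Y :=
  continuous_iff_continuousAt.2 fun x => (h x).continuousAt

theorem add (h : IsScatteringSolution q ζ Y) (h' : IsScatteringSolution q ζ Z) :
    IsScatteringSolution q ζ (fun x => Y x + Z x) := fun x => by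
  rw [mulVec_add]
  exact (h x).add (h' x)

theorem smul (h : IsScatteringSolution q ζ Y) (c : ℂ) :
    IsScatteringSolution q ζ (fun x => c • Y x) := fun x => by
  rw [mulVec_smul]
  exact (h x).const_smul c

theorem reflect (h : IsScatteringSolution q ζ Y) :
    IsScatteringSolution q (-ζ) (reflect Y) := by
  rw [isScatteringSolution_iff] at h ⊢
  intro x
  obtain ⟨h0, h1, h2⟩ := h (-x)
  refine ⟨?_, ?_, ?_⟩
  · refine (h1.scomp x (hasDerivAt_neg x)).congr_deriv ?_
    simp [NonlocalNLS.reflect]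
  · refine (h0.scomp x (hasDerivAt_neg x)).congr_deriv ?_
    simp [NonlocalNLS.reflect]
  · refine (h2.scomp x (hasDerivAt_neg x)).neg.congr_deriv ?_
    simp [NonlocalNLS.reflect]; ring

theorem hasDerivAt_pairing (h : IsScatteringSolution q ζ Y) (h' : IsScatteringSolution q w Z)
    (x : ℝ) :
    HasDerivAt (fun x => conj (Z x 0) * Y x 0 + conj (Z x 1) * Y x 1 + conj (Z x 2) * Y x 2)
      (I * (conj w - ζ) * (conj (Z x 0) * Y x 0 + conj (Z x 1) * Y x 1 - conj (Z x 2) * Y x 2))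
      x := by
  obtain ⟨a0, a1, a2⟩ := isScatteringSolution_iff.1 h x
  obtain ⟨b0, b1, b2⟩ := isScatteringSolution_iff.1 h' x
  refine (((b0.star.mul a0).add (b1.star.mul a1)).add (b2.star.mul a2)).congr_deriv ?_
  simp
  ring

theorem hasDerivAt_sum_norm_sq (h : IsScatteringSolution q ζ Y) (x : ℝ) :
    HasDerivAt (fun x => ‖Y x 0‖ ^ 2 + ‖Y x 1‖ ^ 2 + ‖Y x 2‖ ^ 2)
      (2 * ζ.im * (‖Y x 0‖ ^ 2 + ‖Y x 1‖ ^ 2 - ‖Y x 2‖ ^ 2)) x := by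
  have key : ∀ z : ℂ, conj z * z = ((‖z‖ ^ 2 : ℝ) : ℂ) := fun z => by
    rw [mul_comm, mul_conj, normSq_eq_norm_sq]
  have h1 := reCLM.hasFDerivAt.comp_hasDerivAt x (h.hasDerivAt_pairing h x)
  have h2 : I * (conj ζ - ζ) = ((2 * ζ.im : ℝ) : ℂ) := by
    apply Complex.ext <;> simp; ring
  simp only [key, h2, ← ofReal_add, ← ofReal_sub, ← ofReal_mul] at h1
  exact h1

/-- A solution of the scattering problem which vanishes at one point is zero. -/
theorem eq_zero (h : IsScatteringSolution q ζ Y) {x₀ : ℝ} (h0 : Y x₀ = 0) : Y = 0 := by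
  set N : ℝ → ℝ := fun x => ‖Y x 0‖ ^ 2 + ‖Y x 1‖ ^ 2 + ‖Y x 2‖ ^ 2 with hN
  have hNn : ∀ x, 0 ≤ N x := fun x => by positivity
  have hN0 : N x₀ = 0 := by simp [N, h0]
  have hd := h.hasDerivAt_sum_norm_sq
  set K : ℝ := 2 * |ζ.im|
  have hb : ∀ x, |2 * ζ.im * (‖Y x 0‖ ^ 2 + ‖Y x 1‖ ^ 2 - ‖Y x 2‖ ^ 2)| ≤ K * N x := fun x => by
    rw [abs_mul, abs_mul, abs_two]
    refine mul_le_mul_of_nonneg_left (abs_le.2 ⟨?_, ?_⟩) (by positivity)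
    · nlinarith [sq_nonneg ‖Y x 0‖, sq_nonneg ‖Y x 1‖, hN]
    · nlinarith [sq_nonneg ‖Y x 2‖, hN]
  have hde : ∀ (k x : ℝ), HasDerivAt (fun x => N x * Real.exp (k * x))
      ((2 * ζ.im * (‖Y x 0‖ ^ 2 + ‖Y x 1‖ ^ 2 - ‖Y x 2‖ ^ 2) + k * N x) * Real.exp (k * x)) x :=
    fun k x => by
      refine ((hd x).mul (((hasDerivAt_id x).const_mul k).exp)).congr_deriv ?_
      simp only [id, N]; ring
  -- Grönwall in both directions: |N'| ≤ K N makes N exp(-Kx) nonincreasing and N exp(Kx)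
  -- nondecreasing, so a zero of N spreads to either side.
  have hanti : Antitone fun x => N x * Real.exp (-K * x) :=
    antitone_of_hasDerivAt_nonpos (hde (-K)) fun x =>
      mul_nonpos_of_nonpos_of_nonneg (by linarith [(abs_le.1 (hb x)).2]) (Real.exp_pos _).le
  have hmono : Monotone fun x => N x * Real.exp (K * x) :=
    monotone_of_hasDerivAt_nonneg (hde K) fun x =>
      mul_nonneg (by linarith [(abs_le.1 (hb x)).1]) (Real.exp_pos _).le
  have hz : ∀ x, N x = 0 := fun x => by
    refine le_antisymm ?_ (hNn x)
    rcases le_total x₀ x with hx | hx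
    · have := hanti hx
      simp only [hN0, zero_mul] at this
      exact nonpos_of_mul_nonpos_left this (Real.exp_pos _)
    · have := hmono hx
      simp only [hN0, zero_mul] at this
      exact nonpos_of_mul_nonpos_left this (Real.exp_pos _)
  funext x i
  have := hz x
  have a0 := sq_nonneg ‖Y x 0‖
  have a1 := sq_nonneg ‖Y x 1‖
  have a2 := sq_nonneg ‖Y x 2‖
  simp only [N] at this
  rw [Pi.zero_apply, Pi.zero_apply, ← norm_eq_zero, ← sq_eq_zero_iff]
  fin_cases i <;> simp only [Fin.zero_eta, Fin.mk_one, Fin.reduceFinMk] <;> linarith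

/-- Square-integrable solutions at conjugate spectral parameters are orthogonal. -/
theorem pairing_eq_zero (h : IsScatteringSolution q ζ Y)
    (h' : IsScatteringSolution q (conj ζ) Z) {s : Set ℝ} (hs : volume s = ⊤)
    (hY : IntegrableOn (fun x => ‖Y x‖ ^ 2) s) (hZ : IntegrableOn (fun x => ‖Z x‖ ^ 2) s) (x : ℝ) :
    conj (Z x 0) * Y x 0 + conj (Z x 1) * Y x 1 + conj (Z x 2) * Y x 2 = 0 := by
  set P : ℝ → ℂ := fun x => conj (Z x 0) * Y x 0 + conj (Z x 1) * Y x 1 + conj (Z x 2) * Y x 2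
  have hd : ∀ x, HasDerivAt P 0 x := fun x =>
    (h.hasDerivAt_pairing h' x).congr_deriv (by simp)
  have hc : ∀ y, P y = P x := fun y =>
    is_const_of_deriv_eq_zero (fun x => (hd x).differentiableAt) (fun x => (hd x).deriv) y x
  -- The pairing is constant, and a constant integrable over a set of infinite measure is zero.
  have hi : IntegrableOn (fun _ => P x) s := by
    refine ((hZ.add hY).const_mul 3).mono' aestronglyMeasurable_const (.of_forall fun y => ?_)
    rw [← hc y]
    have hb : ∀ i, ‖conj (Z y i) * Y y i‖ ≤ ‖Z y‖ * ‖Y y‖ := fun i => by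
      rw [norm_mul, RCLike.norm_conj]
      exact mul_le_mul (norm_le_pi_norm _ i) (norm_le_pi_norm _ i) (norm_nonneg _) (norm_nonneg _)
    refine (norm_add₃_le).trans ?_
    simp only [Pi.add_apply]
    nlinarith [hb 0, hb 1, hb 2, sq_nonneg (‖Z y‖ - ‖Y y‖), sq_nonneg (‖Z y‖ + ‖Y y‖)]
  rw [integrableOn_const_iff, hs] at hi
  simpa using hi

end IsScatteringSolution

/-- Jost solutions which decay at `+∞`. -/
theorem exists_decaying_solution {q : ℝ → ℂ} (hq : Continuous q) (hqi : Integrable q) {ζ l : ℂ}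
    (hl : l.re < 0) {c : Fin 3 → ℂ} (h₁ : 0 ≤ (-(I * ζ) - l).re) (h₂ : 0 ≤ (I * ζ - l).re)
    (h₃ : ∀ i, ![-(I * ζ) - l, -(I * ζ) - l, I * ζ - l] i * c i = 0) :
    ∃ Y, IsScatteringSolution q ζ Y ∧ Tendsto (fun x : ℝ => exp (-(l * x)) • Y x) atTop (𝓝 c) ∧
      IntegrableOn (fun x => ‖Y x‖ ^ 2) (Set.Ioi 0) := by
  have hqn : Continuous fun x => q (-x) := hq.comp continuous_neg
  have hc : ∀ i j, Continuous fun x => Q q x i j := fun i j => by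
    fin_cases i <;> fin_cases j <;> simp [Q] <;> fun_prop
  have hconj : ∀ f : ℝ → ℂ, Integrable f → Integrable fun x => conj (f x) := fun f hf =>
    conjLIE.toContinuousLinearEquiv.toContinuousLinearMap.integrable_comp hf
  have hci : ∀ i j, Integrable fun x => Q q x i j := fun i j => by
    fin_cases i <;> fin_cases j <;>
      simp [Q, hqi, hqi.comp_neg, hconj _ hqi, hconj _ hqi.comp_neg]
  -- For Y = exp(lx)W the exponents are shifted by -l. They then have nonnegative real part, and
  -- vanish in the components where c does not.
  obtain ⟨W, ⟨C, hC⟩, hW, hd⟩ := exists_bounded_solution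
    (a := ![-(I * ζ) - l, -(I * ζ) - l, I * ζ - l]) (c := c)
    (by intro i; fin_cases i <;> assumption) h₃ hc hci
  have hC0 : 0 ≤ C := (norm_nonneg _).trans (hC 0)
  have he : ∀ x : ℝ, HasDerivAt (fun x : ℝ => exp (l * x)) (exp (l * x) * (l * 1)) x := fun x =>
    (((hasDerivAt_id x).ofReal_comp).const_mul l).cexp
  have hY : IsScatteringSolution q ζ (fun x => exp (l * x) • W x) := by
    rw [isScatteringSolution_iff]
    intro x
    have hx := hasDerivAt_pi.1 (hd x)
    refine ⟨((he x).mul (hx 0)).congr_deriv ?_, ((he x).mul (hx 1)).congr_deriv ?_,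
      ((he x).mul (hx 2)).congr_deriv ?_⟩ <;>
    · simp [Q, Matrix.mulVec, dotProduct, Fin.sum_univ_three]
      ring
  refine ⟨_, hY, ?_, ?_⟩
  · refine hW.congr fun x => ?_
    rw [smul_smul, ← exp_add]
    simp
  · have h1 : IntegrableOn (fun x => Real.exp ((2 * l.re) * x)) (Set.Ioi 0) :=
      integrableOn_exp_mul_Ioi (by linarith) 0
    refine (h1.mul_const (C ^ 2)).mono'
      (hY.continuous.norm.pow 2).aestronglyMeasurable (.of_forall fun x => ?_)
    rw [Real.norm_of_nonneg (by positivity), norm_smul, mul_pow, norm_exp, ← Real.exp_nat_mul]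
    have : (l * x).re = l.re * x := by simp
    rw [this]
    push_cast
    rw [← mul_assoc]
    gcongr
    exact hC x

theorem isDiscreteEigenvalue_neg_conj {q : ℝ → ℂ} (hq : Continuous q) (hqi : Integrable q)
    {ζ : ℂ} (hζ : 0 < ζ.im) (h : IsDiscreteEigenvalue q ζ) :
    IsDiscreteEigenvalue q (-conj ζ) := by
  obtain ⟨Y, hY0, hYm, hY⟩ := h
  change IsScatteringSolution q ζ Y at hY
  have hYi : Integrable fun x => ‖Y x‖ ^ 2 :=
    (memLp_two_iff_integrable_sq_norm hY.continuous.aestronglyMeasurable).1 hYm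
  -- At ζ*, in the lower half plane, the first two components decay at +∞, with the rate -iζ*. This
  -- gives a two-dimensional space of decaying solutions.
  have hd : ∀ c : Fin 3 → ℂ, c 2 = 0 → ∃ Z, IsScatteringSolution q (conj ζ) Z ∧
      Tendsto (fun x : ℝ => exp (-(-(I * conj ζ) * x)) • Z x) atTop (𝓝 c) ∧
      IntegrableOn (fun x => ‖Z x‖ ^ 2) (Set.Ioi 0) := fun c hc => by
    refine exists_decaying_solution hq hqi (by simpa using hζ) (by simp) ?_ ?_
    · simp; linarith
    · intro i; fin_cases i <;> simp [hc]
  obtain ⟨Z₁, hZ₁, hL₁, hi₁⟩ := hd ![1, 0, 0] rfl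
  obtain ⟨Z₂, hZ₂, hL₂, hi₂⟩ := hd ![0, 1, 0] rfl
  obtain ⟨Z, hZ, hL, hi⟩ : ∃ Z, IsScatteringSolution q (-conj ζ) Z ∧
      Tendsto (fun x : ℝ => exp (-(I * -conj ζ * x)) • Z x) atTop (𝓝 ![0, 0, 1]) ∧
      IntegrableOn (fun x => ‖Z x‖ ^ 2) (Set.Ioi 0) := by
    refine exists_decaying_solution hq hqi (by simpa using hζ) ?_ (by simp) ?_
    · simp; linarith
    · intro i; fin_cases i <;> simp
  have hZ₃ : IsScatteringSolution q (conj ζ) (reflect Z) := by simpa using hZ.reflect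
  have hi₃ : IntegrableOn (fun x => ‖reflect Z x‖ ^ 2) (Set.Iio 0) := by
    simpa [norm_reflect] using integrableOn_comp_neg hi
  -- the three solutions are linearly dependent
  have hdet : (Matrix.of ![Z₁ 0, Z₂ 0, reflect Z 0]).det = 0 := by
    rw [← star_eq_zero, ← det_conjTranspose, ← det_transpose]
    refine exists_mulVec_eq_zero_iff.1 ⟨Y 0, fun h0 => hY0 (hY.eq_zero h0), ?_⟩
    funext i
    fin_cases i
    · simpa [Matrix.mulVec, dotProduct, Fin.sum_univ_three] using
        hY.pairing_eq_zero hZ₁ Real.volume_Ioi hYi.integrableOn hi₁ 0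
    · simpa [Matrix.mulVec, dotProduct, Fin.sum_univ_three] using
        hY.pairing_eq_zero hZ₂ Real.volume_Ioi hYi.integrableOn hi₂ 0
    · simpa [Matrix.mulVec, dotProduct, Fin.sum_univ_three] using
        hY.pairing_eq_zero hZ₃ Real.volume_Iio hYi.integrableOn hi₃ 0
  obtain ⟨v, hv, hv0⟩ := exists_vecMul_eq_zero_iff.2 hdet
  have hsum : (fun x => v 0 • Z₁ x + v 1 • Z₂ x + v 2 • reflect Z x) = 0 := by
    refine (((hZ₁.smul (v 0)).add (hZ₂.smul (v 1))).add (hZ₃.smul (v 2))).eq_zero (x₀ := 0) ?_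
    rw [← hv0]
    funext i
    simp [vecMul, dotProduct, Fin.sum_univ_three]
  -- The asymptotics at +∞ make `Z₁` and `Z₂` independent, so the dependence must involve the
  -- reflected solution.
  have hv2 : v 2 ≠ 0 := fun h2 => hv <| by
    have h1 := (hL₁.const_smul (v 0)).add (hL₂.const_smul (v 1))
    have h3 := tendsto_nhds_unique (h1.congr (f₂ := fun _ => 0) fun x => by
      have := congrFun hsum x
      simp only [h2, zero_smul, add_zero, Pi.zero_apply] at this
      rw [smul_comm, smul_comm (v 1), ← smul_add, this, smul_zero]) tendsto_const_nhds
    funext i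
    fin_cases i
    · simpa using congrFun h3 0
    · simpa using congrFun h3 1
    · exact h2
  have hZe : ∀ x, reflect Z x = (-(v 0 / v 2)) • Z₁ x + (-(v 1 / v 2)) • Z₂ x := fun x => by
    funext i
    have := congrFun (congrFun hsum x) i
    simp at this ⊢
    field_simp
    linear_combination this
  -- Being a combination of `Z₁` and `Z₂`, the reflected solution decays at +∞ too; hence Z is
  -- square-integrable at -∞.
  have hi₄ : IntegrableOn (fun x => ‖reflect Z x‖ ^ 2) (Set.Ioi 0) := by
    refine ((hi₁.const_mul (2 * ‖v 0 / v 2‖ ^ 2)).add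
      (hi₂.const_mul (2 * ‖v 1 / v 2‖ ^ 2))).mono'
      (hZ₃.continuous.norm.pow 2).aestronglyMeasurable (.of_forall fun x => ?_)
    rw [Real.norm_of_nonneg (by positivity), hZe x]
    have h1 := norm_add_le ((-(v 0 / v 2)) • Z₁ x) ((-(v 1 / v 2)) • Z₂ x)
    rw [norm_smul, norm_smul, norm_neg, norm_neg] at h1
    refine (pow_le_pow_left₀ (norm_nonneg _) h1 2).trans ?_
    simp only [Pi.add_apply]
    nlinarith [sq_nonneg (‖v 0 / v 2‖ * ‖Z₁ x‖ - ‖v 1 / v 2‖ * ‖Z₂ x‖)]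
  have hi₅ : IntegrableOn (fun x => ‖Z x‖ ^ 2) (Set.Iio 0) := by
    simpa [norm_reflect] using integrableOn_comp_neg hi₄
  refine ⟨Z, ?_, ?_, hZ⟩
  · rintro rfl
    have h3 := tendsto_nhds_unique (hL.congr (f₂ := fun _ => 0) fun x => by simp)
      tendsto_const_nhds
    simpa using congrFun h3 2
  · rw [memLp_two_iff_integrable_sq_norm hZ.continuous.aestronglyMeasurable,
      ← integrableOn_univ, ← Set.Iic_union_Ioi (a := (0 : ℝ)), integrableOn_union,
      integrableOn_Iic_iff_integrableOn_Iio]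
    exact ⟨hi₅, hi⟩

end NonlocalNLS

theorem theorem1 :
    -- Eigenvalue symmetry, for every profile `q`, in particular `q = u(·, t)` for a solution `u`
    -- of the nonlocal NLS equation.
    (∀ q : ℝ → ℂ, Continuous q → MeasureTheory.Integrable q →
      ∀ ζ : ℂ, 0 < ζ.im → NonlocalNLS.IsDiscreteEigenvalue q ζ →
        NonlocalNLS.IsDiscreteEigenvalue q (-(starRingEnd ℂ) ζ) ∧
        0 < (-(starRingEnd ℂ) ζ).im ∧
        (ζ.re = 0 ∨ -(starRingEnd ℂ) ζ ≠ ζ)) ∧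
    -- Manakov solitons with `v(x,t) = u(-x,t)` are solutions of the nonlocal NLS equation.
    (∀ (N : ℕ) (ζ α β : Fin N → ℂ),
      NonlocalNLS.IsSolitonData ζ α β → NonlocalNLS.SatisfiesReduction ζ α β →
        NonlocalNLS.SolvesNonlocalNLS (NonlocalNLS.solitonU ζ α β)) ∧
    -- One-solitons: the eigenvalue is purely imaginary, and the eigenvector is as follows.
    (∀ ζ α β : Fin 1 → ℂ,
      (NonlocalNLS.IsSolitonData ζ α β ∧ NonlocalNLS.SatisfiesReduction ζ α β) ↔
        (∃ η : ℝ, 0 < η ∧ ζ 0 = Complex.I * η) ∧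
        ∃ γ : ℝ, NonlocalNLS.eigenvector α β 0 =
          ![((Real.sqrt 2)⁻¹ : ℝ) * Complex.exp (Complex.I * γ),
            ((Real.sqrt 2)⁻¹ : ℝ) * Complex.exp (Complex.I * γ), 1]) ∧
    -- Two-solitons: both eigenvalues are purely imaginary, or they form a pair `(ζ, -ζ*)`.
    (∀ ζ α β : Fin 2 → ℂ,
      NonlocalNLS.IsSolitonData ζ α β → NonlocalNLS.SatisfiesReduction ζ α β →
        ((ζ 0).re = 0 ∧ (ζ 1).re = 0) ∨ ζ 1 = -(starRingEnd ℂ) (ζ 0)) ∧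
    -- Two purely imaginary eigenvalues.
    (∀ η₁ η₂ : ℝ, 0 < η₁ → 0 < η₂ → η₁ ≠ η₂ →
      (∀ α β : Fin 2 → ℂ,
        (NonlocalNLS.IsSolitonData ![Complex.I * η₁, Complex.I * η₂] α β ∧
          NonlocalNLS.SatisfiesReduction ![Complex.I * η₁, Complex.I * η₂] α β) ↔
        NonlocalNLS.ImaginaryRelations (NonlocalNLS.gPar η₁ η₂) α β) ∧
      (∀ q : ℂ,
        (∃ α β : Fin 2 → ℂ, NonlocalNLS.ImaginaryRelations (NonlocalNLS.gPar η₁ η₂) α β ∧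
          (starRingEnd ℂ) (α 0) * α 1 + (starRingEnd ℂ) (β 0) * β 1 = q) ↔ ‖q‖ ≤ 1) ∧
      NonlocalNLS.HasFreeRealParameters 4
        (NonlocalNLS.imaginarySolutions (NonlocalNLS.gPar η₁ η₂))) ∧
    -- A pair `(ζ₁, -ζ₁*)` of eigenvalues that are not purely imaginary.
    (∀ ζ₁ : ℂ, 0 < ζ₁.im → ζ₁.re ≠ 0 →
      (∀ a b : ℂ, (a, b) ≠ (0, 0) → IsUnit (NonlocalNLS.pairMatrix ζ₁ a b).det) ∧
      ∀ α β : Fin 2 → ℂ,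
        (NonlocalNLS.IsSolitonData ![ζ₁, -(starRingEnd ℂ) ζ₁] α β ∧
          NonlocalNLS.SatisfiesReduction ![ζ₁, -(starRingEnd ℂ) ζ₁] α β) ↔
        (α 0, β 0) ≠ (0, 0) ∧
          ![α 1, β 1] = Matrix.mulVec (NonlocalNLS.S ζ₁ (α 0) (β 0)) ![α 0, β 0]) := by
  refine ⟨fun q hq hqi ζ hζ h => ⟨NonlocalNLS.isDiscreteEigenvalue_neg_conj hq hqi hζ h, ?_, ?_⟩,
    fun N ζ α β hd hr => NonlocalNLS.solvesNonlocalNLS_of_reduction hd hr,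
    NonlocalNLS.oneSoliton_iff,
    fun ζ α β hd hr => NonlocalNLS.twoSoliton_eigenvalues hd hr,
    fun η₁ η₂ h₁ h₂ h => ⟨NonlocalNLS.imaginary_iff h₁ h₂ h,
      NonlocalNLS.exists_imaginaryRelations_iff (NonlocalNLS.one_lt_gPar_sq h₁ h₂ h),
      NonlocalNLS.hasFreeRealParameters_imaginarySolutions
        (NonlocalNLS.one_lt_gPar_sq h₁ h₂ h)⟩,
    fun ζ hi hr => ⟨fun a b hab => NonlocalNLS.isUnit_det_pairMatrix hi hr hab,
      NonlocalNLS.pair_iff hi hr⟩⟩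
  · simpa using hζ
  · by_cases hre : ζ.re = 0
    · exact Or.inl hre
    · refine Or.inr fun h0 => hre ?_
      have := congrArg Complex.re h0
      simp only [Complex.neg_re, Complex.conj_re] at this
      linarith
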